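/- Let $V:\mathbb R^3\to\mathbb R$ be such that its Fourier transform (in the sense of tempered distributions; the usual one if $V\in L^1(\mathbb R^3)$) is a function $\widehat V$ with $\int_{\mathbb R^3}(1+|p|^2)\,|\widehat V(p)|\,dp<\infty$, and let $K>0$. Then there are constants $C,c>0$, depending only on $V$ and $K$, such that the following holds for every integer $N\ge 1$, with $\varepsilon=N^{-1/3}$. Let $\omega_N$ be an orthogonal projection on $L^2(\mathbb R^3)$ with $\operatorname{Tr}\omega_N=N$ and $$\operatorname{Tr}|[x,\omega_N]|\le KN\varepsilon,\qquad \operatorname{Tr}|[\varepsilon\nabla,\omega_N]|\le KN\varepsilon,$$ and let $t\mapsto\omega_{N,t}$, $t\in\mathbb R$, be a solution of the time-dependent Hartree–Fock equation $$i\varepsilon\,\partial_t\omega_{N,t}=[-\varepsilon^2\Delta+V*\rho_t-X_t,\ \omega_{N,t}],\qquad \omega_{N,0}=\omega_N,$$ where $\rho_t(x)=N^{-1}\omega_{N,t}(x;x)$, $V*\rho_t$ acts by multiplication, and $X_t$ is the operator with integral kernel $X_t(x;y)=N^{-1}V(x-y)\,\omega_{N,t}(x;y)$. Then $$\operatorname{Tr}|[x,\omega_{N,t}]|\le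 CN\varepsilon\,e^{c|t|}\qquad\text{and}\qquad \operatorname{Tr}|[\varepsilon\nabla,\omega_{N,t}]|\le CN\varepsilon\,e^{c|t|}\qquad\text{for all }t\in\mathbb R.$$ Here a solution is a family of self-adjoint trace class operators on $L^2(\mathbb R^3)$, continuous in $t$ in the trace norm, that satisfies the equation weakly, that is, after taking matrix elements $\langle\varphi,\,\cdot\,\psi\rangle$ with Schwartz functions $\varphi,\psi$, with $-\varepsilon^2\Delta$ acting on the Schwartz functions. The bounds on the vector-valued commutators are meant for each of the three components $x_j$ and $\varepsilon\partial_j$; a bound includes that the commutator extends to a bounded operator. -/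

import Mathlib

open MeasureTheory Filter Topology
open scoped ENNReal InnerProductSpace SchwartzMap FourierTransform LineDeriv Laplacian
  ComplexConjugate

namespace HartreeFock

noncomputable section

/-- Physical space `ℝ³`. -/
abbrev Space : Type := EuclideanSpace ℝ (Fin 3)

/-- The one-particle Hilbert space `L²(ℝ³; ℂ)`. -/
abbrev OneParticle : Type := Lp ℂ 2 (volume : Measure Space)

/-- Bounded operators on `L²(ℝ³; ℂ)`. -/
abbrev Op : Type := OneParticle →L[ℂ] OneParticle

/-! ### Traces -/

/-- The trace `∑ᵢ ⟨eᵢ, A eᵢ⟩ ∈ [0, ∞]` of a non-negative operator `A`, over an orthonormal basis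
of the Hilbert space `H`. For `A ≥ 0` the value does not depend on the basis. -/
def posTrace {H : Type*} [NormedAddCommGroup H] [InnerProductSpace ℂ H] [CompleteSpace H]
    (A : H →L[ℂ] H) : ℝ≥0∞ :=
  ∑' i : (exists_hilbertBasis ℂ H).choose,
    ENNReal.ofReal
      (RCLike.re ⟪(exists_hilbertBasis ℂ H).choose_spec.choose i,
        A ((exists_hilbertBasis ℂ H).choose_spec.choose i)⟫_ℂ)

/-- The trace norm `Tr |A| ∈ [0, ∞]`, where `|A| = (A* A)^{1/2}`. -/
def traceNorm {H : Type*} [NormedAddCommGroup H] [InnerProductSpace ℂ H] [CompleteSpace H]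
    (A : H →L[ℂ] H) : ℝ≥0∞ :=
  posTrace (CFC.abs A)

/-! ### Position, gradient and commutators

An unbounded operator `T` is given by its graph `T f g`, meaning `f ∈ D(T)` and `T f = g`. -/

/-- The graph of multiplication by the coordinate `x_j`, with domain
`{f ∈ L² : x_j f ∈ L²}`. -/
def Position (j : Fin 3) (f g : OneParticle) : Prop :=
  (g : Space → ℂ) =ᵐ[volume] fun x => ((x j : ℝ) : ℂ) * f x

/-- The graph of `ε ∂_j`, with domain all `f ∈ L²` whose weak derivative `∂_j f` is in `L²`. -/
def ScaledGradient (ε : ℝ) (j : Fin 3) (f g : OneParticle) : Prop :=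
  ∀ φ : 𝓢(Space, ℂ),
    (ε : ℂ) * ∫ x, (∂_{(EuclideanSpace.single j (1 : ℝ) : Space)} φ) x * f x
      = - ∫ x, φ x * g x

/-- The bounded operator `C` is the commutator `[T, A] = T A - A T`: the operator `A` maps `D(T)`
into itself, and `T A f = A T f + C f` for all `f ∈ D(T)`. -/
def IsCommutator (T : OneParticle → OneParticle → Prop) (A C : Op) : Prop :=
  ∀ f g : OneParticle, T f g → T (A f) (A g + C f)

/-- `Tr |[T, A]| ≤ M`: the commutator `[T, A]` extends to a bounded operator, and this operator
has trace norm at most `M`. -/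
def CommutatorTraceLE (T : OneParticle → OneParticle → Prop) (A : Op) (M : ℝ) : Prop :=
  ∃ C : Op, IsCommutator T A C ∧ traceNorm C ≤ ENNReal.ofReal M

/-! ### The interaction potential -/

/-- The function `W` is the Fourier transform of `V` in the sense of tempered distributions.
For `V ∈ L¹` this is the usual Fourier transform, see `hasFourierTransform_of_integrable`. -/
def HasFourierTransform (V : Space → ℝ) (W : Space → ℂ) : Prop :=
  ∀ φ : 𝓢(Space, ℂ),
    Integrable (fun x => (V x : ℂ) * φ x) ∧ Integrable (fun p => W p * φ p) ∧
      ∫ x, (V x : ℂ) * (𝓕 φ) x = ∫ p, W p * φ p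

theorem hasFourierTransform_of_integrable {V : Space → ℝ} (hV : Integrable V) :
    HasFourierTransform V (𝓕 fun x => (V x : ℂ)) := by
  have hV' : Integrable (fun x => (V x : ℂ)) := hV.ofReal
  have hL : Continuous fun p : Space × Space => innerₗ Space p.1 p.2 := continuous_inner
  intro φ
  refine ⟨?_, ?_, ?_⟩
  · refine hV'.mul_bdd (c := ‖φ.toBoundedContinuousFunction‖) φ.continuous.aestronglyMeasurable ?_
    exact Eventually.of_forall fun x => φ.toBoundedContinuousFunction.norm_coe_le_norm x
  · refine φ.integrable.bdd_mul (c := ∫ x, ‖(V x : ℂ)‖) ?_ ?_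
    · exact (VectorFourier.fourierIntegral_continuous Real.continuous_fourierChar hL
        hV').aestronglyMeasurable
    · exact Eventually.of_forall fun p =>
        VectorFourier.norm_fourierIntegral_le_integral_norm _ _ _ _ _
  · have h := VectorFourier.integral_fourierIntegral_smul_eq_flip (L := innerₗ Space)
      Real.continuous_fourierChar hL hV' (φ.integrable (μ := volume))
    rw [flip_innerₗ] at h
    exact h.symm

/-- The Fourier transform of `V` is a function with `∫ (1 + |p|²) |V̂(p)| dp < ∞`. -/
def AdmissiblePotential (V : Space → ℝ) : Prop :=
  ∃ W : Space → ℂ, HasFourierTransform V W ∧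
    Integrable (fun p => ((1 + ‖p‖ ^ 2 : ℝ) : ℂ) * W p)

/-! ### The Hartree-Fock equation -/

/-- `A = ∑ⱼ |aⱼ⟩⟨bⱼ|` with `∑ⱼ ‖aⱼ‖ ‖bⱼ‖ < ∞`. The operators with such an expansion are exactly
the trace class operators. -/
def IsNuclearExpansion (A : Op) (a b : ℕ → OneParticle) : Prop :=
  Summable (fun j => ‖a j‖ * ‖b j‖) ∧ ∀ f, HasSum (fun j => ⟪b j, f⟫_ℂ • a j) (A f)

/-- The integral kernel `A(x; y) = ∑ⱼ aⱼ(x) conj(bⱼ(y))` of the trace class operator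
`A = ∑ⱼ |aⱼ⟩⟨bⱼ|`. The series converges absolutely for a.e. `(x, y)` and, on the diagonal, for
a.e. `x = y`, and its sums there do not depend on the expansion, up to null sets. -/
def kernel (a b : ℕ → OneParticle) (x y : Space) : ℂ :=
  ∑' j, (a j) x * conj ((b j) y)

/-- `D` is the direct term of the trace class operator `A`: multiplication by `V * ρ`, where
`ρ(y) = N⁻¹ A(y; y)`. -/
def IsDirectTerm (V : Space → ℝ) (N : ℕ) (A D : Op) : Prop :=
  ∃ a b : ℕ → OneParticle, IsNuclearExpansion A a b ∧
    ∀ f : OneParticle, (D f : Space → ℂ) =ᵐ[volume] fun x =>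
      (∫ y, (V (x - y) : ℂ) * ((N : ℂ)⁻¹ * kernel a b y y)) * f x

/-- `X` is the exchange term of the trace class operator `A`: the operator with integral kernel
`X(x; y) = N⁻¹ V(x - y) A(x; y)`. -/
def IsExchangeTerm (V : Space → ℝ) (N : ℕ) (A X : Op) : Prop :=
  ∃ a b : ℕ → OneParticle, IsNuclearExpansion A a b ∧
    ∀ f : OneParticle, (X f : Space → ℂ) =ᵐ[volume] fun x =>
      ∫ y, ((N : ℂ)⁻¹ * (V (x - y) : ℂ) * kernel a b x y) * f y

/-- `ω` is a (global, weak) solution of the Hartree-Fock equation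
`i ε ∂_t ω_t = [-ε² Δ + V * ρ_t - X_t, ω_t]`: a trace-norm continuous family of self-adjoint trace
class operators on `L²(ℝ³)` such that, for all Schwartz functions `φ, ψ` and all `t`,
`i ε d/dt ⟨φ, ω_t ψ⟩ = ⟨-ε² Δ φ, ω_t ψ⟩ - ⟨φ, ω_t (-ε² Δ ψ)⟩ + ⟨φ, [V * ρ_t - X_t, ω_t] ψ⟩`. -/
structure IsSolution (V : Space → ℝ) (N : ℕ) (ε : ℝ) (ω : ℝ → Op) : Prop where
  selfAdjoint : ∀ t, IsSelfAdjoint (ω t)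
  traceClass : ∀ t, traceNorm (ω t) < ∞
  continuous : ∀ t, Tendsto (fun s => traceNorm (ω s - ω t)) (𝓝 t) (𝓝 0)
  equation : ∀ t, ∃ D X : Op, IsDirectTerm V N (ω t) D ∧ IsExchangeTerm V N (ω t) X ∧
    ∀ φ ψ : 𝓢(Space, ℂ),
      HasDerivAt
        (fun s => Complex.I * (ε : ℂ) * ⟪φ.toLp 2 volume, ω s (ψ.toLp 2 volume)⟫_ℂ)
        (⟪(-((ε : ℂ) ^ 2 • Δ φ)).toLp 2 volume, ω t (ψ.toLp 2 volume)⟫_ℂ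
          - ⟪φ.toLp 2 volume, ω t ((-((ε : ℂ) ^ 2 • Δ ψ)).toLp 2 volume)⟫_ℂ
          + ⟪φ.toLp 2 volume,
              ((D - X) * ω t - ω t * (D - X)) (ψ.toLp 2 volume)⟫_ℂ) t

end

end HartreeFock

/-! The proof is a Gronwall estimate, run not on the unbounded commutators with x and ε∇ but on
commutators with the Weyl operators `weyl ε p q`, that is exp(2πi p·x) exp(ε q·∇). A trace-norm
bound M on [x_j, A] amounts to the bound |s|M on [exp(i s x_j), A] for all real s, and similarly for
ε∂_j (`commutatorTraceLE_position_iff`, `commutatorTraceLE_scaledGradient_iff`). Up to constants,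
the hypotheses therefore say Tr|[weyl ε p q, ω]| ≤ M(|p| + |q|), and this bound is propagated.

Conjugation with the free evolution keeps a Weyl operator of this form and shears its label (p, q)
(`free_mul_weyl`), by an amount independent of ε. In the interaction picture
(`WeakEvolution.trEvolution`) the equation is Ω' = i r [H, Ω] with H bounded and self-adjoint and
|r| = 1/ε. For a Weyl operator U, the derivative of [U, Ω] is i r [H, [U, Ω]] + i r [[U, H], Ω]. The
first term does not change the trace norm, so [[U, H], Ω] has to gain a factor ε. The gain comes
from writing V as a superposition of plane waves with weights V̂(k). In the direct term the
coefficients are at most |V̂(k)|; a plane wave commutes with U up to a phase 1 + O(ε|q||k|), and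
what remains is a commutator of ω with a product of Weyl operators, controlled by the quantity being
propagated (`comm_direct_le`). The second moment of V̂ enters here. In the exchange term the
commutator with U is a superposition of conjugates of [U, ω], and the gain is N⁻¹ ≤ ε
(`comm_exchange_le`).

The shear grows linearly in time, so the estimate is made over a unit time
(`WeakEvolution.comm_weyl_le`) and iterated (`IsSolution.comm_weyl_le`); a fixed factor per unit
time is exponential growth.

Trace norms are handled by duality with finite Bessel families (`TrLE`, `traceNorm_le_iff`), a form
that passes directly to sums, weak integrals and weak limits. The equation is given only weakly; in
the interaction picture it is upgraded to differentiability in trace norm (`hasDerivAt_of_schwartz`,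
`trDeriv_of_hasDerivAt`). -/

namespace HartreeFock

noncomputable section

/-! ### The trace norm by duality -/

section TraceNorm

variable {H : Type*} [NormedAddCommGroup H] [InnerProductSpace ℂ H]

/-- A finite family of vectors with Bessel constant at most one. -/
def Bessel {ι : Type*} [Fintype ι] (f : ι → H) : Prop :=
  ∀ x : H, ∑ i, ‖⟪f i, x⟫_ℂ‖ ^ 2 ≤ ‖x‖ ^ 2

theorem Bessel.sum_mul_le {ι : Type*} [Fintype ι] {f g : ι → H} (hf : Bessel f) (hg : Bessel g)
    (a b : H) : ∑ i, ‖⟪f i, a⟫_ℂ‖ * ‖⟪g i, b⟫_ℂ‖ ≤ ‖a‖ * ‖b‖ := by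
  refine abs_le_of_sq_le_sq' ?_ (by positivity) |>.2
  calc (∑ i, ‖⟪f i, a⟫_ℂ‖ * ‖⟪g i, b⟫_ℂ‖) ^ 2
      ≤ (∑ i, ‖⟪f i, a⟫_ℂ‖ ^ 2) * ∑ i, ‖⟪g i, b⟫_ℂ‖ ^ 2 := Finset.sum_mul_sq_le_sq_mul_sq _ _ _
    _ ≤ ‖a‖ ^ 2 * ‖b‖ ^ 2 :=
        mul_le_mul (hf a) (hg b) (Finset.sum_nonneg fun _ _ => by positivity) (by positivity)
    _ = (‖a‖ * ‖b‖) ^ 2 := by ring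

theorem Orthonormal.bessel {ι : Type*} [Fintype ι] {f : ι → H} (hf : Orthonormal ℂ f) :
    Bessel f := fun x => hf.sum_inner_products_le x

theorem bessel_single {x : H} (hx : ‖x‖ ≤ 1) : Bessel (fun _ : Fin 1 => x) := by
  intro y
  simp only [Finset.univ_unique, Finset.sum_const, Finset.card_singleton, one_smul]
  have h := norm_inner_le_norm (𝕜 := ℂ) x y
  have h2 : ‖x‖ * ‖y‖ ≤ ‖y‖ := by nlinarith [norm_nonneg y]
  exact pow_le_pow_left₀ (norm_nonneg _) (h.trans h2) 2

/-- `|∑ᵢ ⟨fᵢ, A gᵢ⟩| ≤ M` for all finite Bessel families. -/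
def TrLE (A : H →L[ℂ] H) (M : ℝ) : Prop :=
  ∀ (n : ℕ) (f g : Fin n → H), Bessel f → Bessel g → ‖∑ i, ⟪f i, A (g i)⟫_ℂ‖ ≤ M

theorem TrLE.nonneg {A : H →L[ℂ] H} {M : ℝ} (h : TrLE A M) : 0 ≤ M := by
  have := h 0 (fun _ => 0) (fun _ => 0) (fun x => by simp) (fun x => by simp)
  simpa using this

theorem TrLE.mono {A : H →L[ℂ] H} {M M' : ℝ} (h : TrLE A M) (hM : M ≤ M') : TrLE A M' :=
  fun n f g hf hg => (h n f g hf hg).trans hM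

theorem TrLE.fintype {A : H →L[ℂ] H} {M : ℝ} (h : TrLE A M) {ι : Type*} [Fintype ι] {f g : ι → H}
    (hf : Bessel f) (hg : Bessel g) : ‖∑ i, ⟪f i, A (g i)⟫_ℂ‖ ≤ M := by
  have e := (Fintype.equivFin ι).symm
  rw [← e.sum_comp]
  refine h _ (f ∘ e) (g ∘ e) (fun x => ?_) (fun x => ?_)
  · simpa only [Function.comp, e.sum_comp (fun i => ‖⟪f i, x⟫_ℂ‖ ^ 2)] using hf x
  · simpa only [Function.comp, e.sum_comp (fun i => ‖⟪g i, x⟫_ℂ‖ ^ 2)] using hg x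

theorem trLE_zero : TrLE (0 : H →L[ℂ] H) 0 := fun n f g _ _ => by simp

theorem TrLE.add {A B : H →L[ℂ] H} {M M' : ℝ} (h : TrLE A M) (h' : TrLE B M') :
    TrLE (A + B) (M + M') := fun n f g hf hg => by
  simp only [add_apply, inner_add_right, Finset.sum_add_distrib]
  exact (norm_add_le _ _).trans (add_le_add (h n f g hf hg) (h' n f g hf hg))

theorem TrLE.smul {A : H →L[ℂ] H} {M : ℝ} (h : TrLE A M) (c : ℂ) : TrLE (c • A) (‖c‖ * M) :=
  fun n f g hf hg => by
  simp only [smul_apply, inner_smul_right, ← Finset.mul_sum, norm_mul]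
  exact mul_le_mul_of_nonneg_left (h n f g hf hg) (norm_nonneg _)

theorem TrLE.neg {A : H →L[ℂ] H} {M : ℝ} (h : TrLE A M) : TrLE (-A) M := by
  simpa using h.smul (-1)

theorem TrLE.sub {A B : H →L[ℂ] H} {M M' : ℝ} (h : TrLE A M) (h' : TrLE B M') :
    TrLE (A - B) (M + M') := by
  rw [sub_eq_add_neg]; exact h.add h'.neg

theorem TrLE.norm_le {A : H →L[ℂ] H} {M : ℝ} (h : TrLE A M) : ‖A‖ ≤ M := by
  refine ContinuousLinearMap.opNorm_le_bound _ h.nonneg fun x => ?_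
  by_cases hx : x = 0
  · simp [hx]
  by_cases hA : A x = 0
  · simpa [hA] using mul_nonneg h.nonneg (norm_nonneg x)
  have hx' : ‖x‖ ≠ 0 := norm_ne_zero_iff.2 hx
  have hA' : ‖A x‖ ≠ 0 := norm_ne_zero_iff.2 hA
  have e1 : ‖((‖A x‖⁻¹ : ℝ) : ℂ) • A x‖ ≤ 1 := by
    rw [norm_smul]; simp [hA']
  have e2 : ‖((‖x‖⁻¹ : ℝ) : ℂ) • x‖ ≤ 1 := by
    rw [norm_smul]; simp [hx']
  have := h 1 _ _ (bessel_single e1) (bessel_single e2)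
  simp only [Finset.univ_unique, Finset.sum_const, Finset.card_singleton, one_smul, map_smul,
    inner_smul_left, inner_smul_right, norm_mul, RCLike.norm_conj, Complex.norm_real, norm_inv,
    norm_norm, inner_self_eq_norm_sq_to_K, norm_pow, Complex.coe_algebraMap] at this
  have e3 : ‖x‖⁻¹ * (‖A x‖⁻¹ * ‖A x‖ ^ 2) = ‖A x‖ / ‖x‖ := by
    field_simp
  have : ‖A x‖ / ‖x‖ ≤ M := by
    rw [← e3]; linarith
  rwa [div_le_iff₀ (by positivity)] at this

/-- Lower semicontinuity of the trace norm in the weak operator topology: the families are finite,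
so each constraint is a closed condition on finitely many matrix elements. -/
theorem trLE_of_tendsto {α : Type*} {l : Filter α} [l.NeBot] {F : α → H →L[ℂ] H} {A : H →L[ℂ] H}
    {M : ℝ} (hF : ∀ᶠ s in l, TrLE (F s) M)
    (h : ∀ f g : H, Tendsto (fun s => ⟪f, F s g⟫_ℂ) l (𝓝 ⟪f, A g⟫_ℂ)) : TrLE A M := by
  intro n f g hf hg
  refine le_of_tendsto (tendsto_finsetSum Finset.univ fun i _ => h (f i) (g i)).norm ?_
  filter_upwards [hF] with s hs using hs n f g hf hg

theorem trLE_of_nuclear {A : H →L[ℂ] H} {a b : ℕ → H} (hs : Summable fun j => ‖a j‖ * ‖b j‖)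
    (hA : ∀ f, HasSum (fun j => ⟪b j, f⟫_ℂ • a j) (A f)) : TrLE A (∑' j, ‖a j‖ * ‖b j‖) := by
  intro n f g hf hg
  have h1 : HasSum (fun j => ∑ i, ⟪f i, ⟪b j, g i⟫_ℂ • a j⟫_ℂ) (∑ i, ⟪f i, A (g i)⟫_ℂ) :=
    hasSum_sum fun i _ => (hA (g i)).mapL (innerSL ℂ (f i))
  refine h1.norm_le_of_bounded hs.hasSum fun j => ?_
  refine (norm_sum_le _ _).trans (le_trans (le_of_eq ?_) (hf.sum_mul_le hg (a j) (b j)))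
  refine Finset.sum_congr rfl fun i _ => ?_
  rw [inner_smul_right, norm_mul, mul_comm, norm_inner_symm (b j)]

section Complete

variable [CompleteSpace H]

theorem Bessel.map {ι : Type*} [Fintype ι] {f : ι → H} (hf : Bessel f) {L : H →L[ℂ] H}
    (hL : ‖L‖ ≤ 1) : Bessel fun i => L (f i) := by
  intro x
  simp only [← ContinuousLinearMap.adjoint_inner_right]
  refine (hf _).trans (pow_le_pow_left₀ (norm_nonneg _) ?_ 2)
  refine (ContinuousLinearMap.le_opNorm _ _).trans ?_
  rw [LinearIsometryEquiv.norm_map]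
  exact mul_le_of_le_one_left (norm_nonneg _) hL

theorem TrLE.mul_left {A : H →L[ℂ] H} {M : ℝ} (h : TrLE A M) (L : H →L[ℂ] H) :
    TrLE (L * A) (‖L‖ * M) := by
  by_cases hL : L = 0
  · simpa [hL] using trLE_zero
  have hL' : ‖L‖ ≠ 0 := norm_ne_zero_iff.2 hL
  have hn : ‖star (((‖L‖⁻¹ : ℝ) : ℂ) • L)‖ ≤ 1 := by
    rw [norm_star, norm_smul]
    simp [hL']
  have key : TrLE ((((‖L‖⁻¹ : ℝ) : ℂ) • L) * A) M := by
    intro n f g hf hg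
    have := h n _ g (hf.map hn) hg
    simp only [ContinuousLinearMap.star_eq_adjoint, ContinuousLinearMap.adjoint_inner_left] at this
    exact this
  have := key.smul ((‖L‖ : ℝ) : ℂ)
  rw [smul_mul_assoc, smul_smul] at this
  simpa [hL'] using this

theorem TrLE.adjoint {A : H →L[ℂ] H} {M : ℝ} (h : TrLE A M) : TrLE (star A) M := by
  intro n f g hf hg
  have := h n g f hg hf
  rw [← RCLike.norm_conj] at this
  rw [map_sum] at this
  simpa only [inner_conj_symm, ContinuousLinearMap.star_eq_adjoint,
    ContinuousLinearMap.adjoint_inner_right] using this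

theorem TrLE.mul_right {A : H →L[ℂ] H} {M : ℝ} (h : TrLE A M) (L : H →L[ℂ] H) :
    TrLE (A * L) (M * ‖L‖) := by
  have := (h.adjoint.mul_left (star L)).adjoint
  rw [star_mul, star_star, star_star, norm_star, mul_comm] at this
  exact this

/-- By the C*-identity and A*A = |A|². It reduces norm estimates for A times a function of |A| to
functional calculus on the spectrum of |A|. -/
theorem norm_mul_eq_norm_abs_mul (A R : H →L[ℂ] H) : ‖A * R‖ = ‖CFC.abs A * R‖ := by
  have h : star (A * R) * (A * R) = star (CFC.abs A * R) * (CFC.abs A * R) := by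
    have hT : star (CFC.abs A) = CFC.abs A := (CFC.abs_nonneg A).isSelfAdjoint
    rw [star_mul, star_mul, hT, mul_assoc, mul_assoc, ← mul_assoc (star A), ← CFC.abs_mul_abs,
      ← mul_assoc (CFC.abs A)]
  have h2 := CStarRing.norm_star_mul_self (x := A * R)
  rw [h, CStarRing.norm_star_mul_self] at h2
  nlinarith [norm_nonneg (A * R), norm_nonneg (CFC.abs A * R)]

/-- An approximate polar decomposition. -/
theorem exists_approx_polar (A : H →L[ℂ] H) {δ : ℝ} (hδ : 0 < δ) :
    ∃ U : H →L[ℂ] H, ‖U‖ ≤ 1 ∧ ‖A - U * CFC.abs A‖ ≤ δ ∧ ‖CFC.abs A - star U * A‖ ≤ δ := by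
  set T := CFC.abs A with hT
  have hT0 : 0 ≤ T := CFC.abs_nonneg A
  have hTs : IsSelfAdjoint T := hT0.isSelfAdjoint
  have hsp : ∀ x ∈ spectrum ℝ T, 0 ≤ x := fun x hx => spectrum_nonneg_of_nonneg hT0 hx
  have hc : ContinuousOn (fun x : ℝ => (x + δ)⁻¹) (spectrum ℝ T) :=
    ContinuousOn.inv₀ (by fun_prop) fun x hx => by have := hsp x hx; positivity
  set G := cfc (fun x : ℝ => (x + δ)⁻¹) T with hG
  have hGs : star G = G := (cfc_predicate (fun x : ℝ => (x + δ)⁻¹) T : IsSelfAdjoint _)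
  have hTG : T * G = cfc (fun x : ℝ => x * (x + δ)⁻¹) T := by
    rw [cfc_mul (fun x : ℝ => x) _ T (by fun_prop) hc, cfc_id' ℝ T hTs]
  have hGT : G * T = cfc (fun x : ℝ => (x + δ)⁻¹ * x) T := by
    rw [cfc_mul _ (fun x : ℝ => x) T hc (by fun_prop), cfc_id' ℝ T hTs]
  have hcT : ContinuousOn (fun x : ℝ => x * (x + δ)⁻¹) (spectrum ℝ T) := continuousOn_id.mul hc
  have hGT' : ContinuousOn (fun x : ℝ => (x + δ)⁻¹ * x) (spectrum ℝ T) := hc.mul continuousOn_id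
  have hTGT : T * (1 - G * T) = cfc (fun x : ℝ => x * (1 - (x + δ)⁻¹ * x)) T := by
    rw [hGT, cfc_mul (fun x : ℝ => x) (fun x : ℝ => 1 - (x + δ)⁻¹ * x) T (by fun_prop)
      (continuousOn_const.sub hGT'), cfc_id' ℝ T hTs,
      cfc_sub (fun _ : ℝ => (1 : ℝ)) (fun x : ℝ => (x + δ)⁻¹ * x) T (by fun_prop) hGT',
      cfc_const_one ℝ T]
  have hb : ‖T * (1 - G * T)‖ ≤ δ := by
    rw [hTGT]
    refine norm_cfc_le hδ.le fun x hx => ?_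
    have h0 := hsp x hx
    have : x * (1 - (x + δ)⁻¹ * x) = x / (x + δ) * δ := by field_simp; ring
    rw [this, Real.norm_of_nonneg (by positivity)]
    refine mul_le_of_le_one_left hδ.le ?_
    rw [div_le_one (by positivity)]; linarith
  -- A(|A| + δ)⁻¹ replaces the partial isometry. Its norm is the supremum of x/(x + δ), and the
  -- defect is governed by δx/(x + δ) ≤ δ.
  refine ⟨A * G, ?_, ?_, ?_⟩
  · rw [norm_mul_eq_norm_abs_mul, ← hT, hTG]
    refine norm_cfc_le zero_le_one fun x hx => ?_
    have h0 := hsp x hx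
    rw [Real.norm_of_nonneg (by positivity), ← div_eq_mul_inv, div_le_one (by positivity)]
    linarith
  · have : A - A * G * T = A * (1 - G * T) := by noncomm_ring
    rw [this, norm_mul_eq_norm_abs_mul, ← hT]
    exact hb
  · have : T - star (A * G) * A = star (T * (1 - G * T)) := by
      rw [star_mul, star_mul, star_sub, star_mul, star_one, hGs, hTs.star_eq, mul_assoc,
        ← CFC.abs_mul_abs, ← hT, sub_mul, one_mul]
      rw [hTG.trans (cfc_congr fun x _ => mul_comm _ _) |>.trans hGT.symm, mul_assoc]
    rw [this, norm_star]
    exact hb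

/-! ### The trace norm as a supremum over Bessel families -/

theorem norm_sq_hasSum {E : Type*} [NormedAddCommGroup E]
    [InnerProductSpace ℂ E] {ι : Type*} (e : HilbertBasis ι ℂ E) (x : E) :
    HasSum (fun i => ‖⟪e i, x⟫_ℂ‖ ^ 2) (‖x‖ ^ 2) := by
  have h := Complex.hasSum_re (e.hasSum_inner_mul_inner x x)
  have h2 : (⟪x, x⟫_ℂ).re = ‖x‖ ^ 2 := by
    rw [inner_self_eq_norm_sq_to_K]; norm_cast
  rw [h2] at h
  convert h using 2 with i
  rw [← inner_conj_symm x, mul_comm, Complex.mul_conj, Complex.normSq_eq_norm_sq,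
    Complex.ofReal_re]

/-- Expand each ‖S f_i‖² in the basis, exchange the sums, move S to the basis vector and use the
Bessel bound there. -/
theorem Bessel.sum_norm_sq_le {ι : Type*} (e : HilbertBasis ι ℂ H) {S : H →L[ℂ] H}
    (hS : IsSelfAdjoint S) (hsum : Summable fun j => ‖S (e j)‖ ^ 2) {κ : Type*} [Fintype κ]
    {f : κ → H} (hf : Bessel f) : ∑ i, ‖S (f i)‖ ^ 2 ≤ ∑' j, ‖S (e j)‖ ^ 2 := by
  have h1 : HasSum (fun j => ∑ i, ‖⟪e j, S (f i)⟫_ℂ‖ ^ 2) (∑ i, ‖S (f i)‖ ^ 2) :=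
    hasSum_sum fun i _ => norm_sq_hasSum e _
  refine hasSum_le (fun j => ?_) h1 hsum.hasSum
  refine le_trans (le_of_eq (Finset.sum_congr rfl fun i _ => ?_)) (hf (S (e j)))
  rw [norm_inner_symm, ← ContinuousLinearMap.adjoint_inner_right,
    ← ContinuousLinearMap.star_eq_adjoint, hS.star_eq]

/-- Duality of trace class and bounded operators. One direction writes A ≈ U S² with S = |A|^{1/2}
Hilbert–Schmidt and applies Cauchy–Schwarz to ⟨S U* f_i, S g_i⟩. The other recovers the partial sums
of Tr|A| from the families U e_i and e_i. In both, the tolerance of the polar decomposition is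
adapted to the finite family. -/
theorem traceNorm_le_iff {A : H →L[ℂ] H} {M : ℝ} (hM : 0 ≤ M) :
    traceNorm A ≤ ENNReal.ofReal M ↔ TrLE A M := by
  set e := (exists_hilbertBasis ℂ H).choose_spec.choose with he
  set T := CFC.abs A with hT
  have hT0 : 0 ≤ T := CFC.abs_nonneg A
  have hTp : T.IsPositive := (ContinuousLinearMap.nonneg_iff_isPositive T).1 hT0
  constructor
  · intro h
    set S := CFC.sqrt T with hS
    have hSS : S * S = T := CFC.sqrt_mul_sqrt_self T hT0
    have hSs : IsSelfAdjoint S := (CFC.sqrt_nonneg T).isSelfAdjoint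
    have hSa : ContinuousLinearMap.adjoint S = S := hSs
    have hTS : ∀ x y, ⟪x, T y⟫_ℂ = ⟪S x, S y⟫_ℂ := fun x y => by
      rw [← hSS, mul_apply_eq_comp, ← ContinuousLinearMap.adjoint_inner_left, hSa]
    have hre : ∀ x, RCLike.re ⟪x, T x⟫_ℂ = ‖S x‖ ^ 2 := fun x => by
      rw [hTS, inner_self_eq_norm_sq]
    have htn : traceNorm A = ∑' j, ENNReal.ofReal (‖S (e j)‖ ^ 2) := by
      rw [traceNorm, posTrace]
      exact tsum_congr fun j => by rw [← he, ← hT, hre]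
    rw [htn] at h
    have hfin := ne_top_of_le_ne_top ENNReal.ofReal_ne_top h
    have hsum : Summable fun j => ‖S (e j)‖ ^ 2 := by
      have := ENNReal.summable_toReal hfin
      simpa only [ENNReal.toReal_ofReal (sq_nonneg _)] using this
    have hle : ∑' j, ‖S (e j)‖ ^ 2 ≤ M := by
      rw [← ENNReal.ofReal_tsum_of_nonneg (fun _ => sq_nonneg _) hsum] at h
      exact (ENNReal.ofReal_le_ofReal_iff hM).1 h
    intro n f g hf hg
    set c := ∑ i, ‖f i‖ * ‖g i‖ with hc
    have hc0 : 0 ≤ c := Finset.sum_nonneg fun _ _ => by positivity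
    refine le_of_forall_pos_le_add fun η hη => ?_
    obtain ⟨U, hU, hU1, -⟩ := exists_approx_polar A (δ := η / (c + 1)) (by positivity)
    have hsplit : ∑ i, ⟪f i, A (g i)⟫_ℂ
        = ∑ i, ⟪S (star U (f i)), S (g i)⟫_ℂ + ∑ i, ⟪f i, (A - U * T) (g i)⟫_ℂ := by
      rw [← Finset.sum_add_distrib]
      refine Finset.sum_congr rfl fun i _ => ?_
      rw [← hTS, ContinuousLinearMap.star_eq_adjoint, ContinuousLinearMap.adjoint_inner_left,
        sub_apply, inner_sub_right, mul_apply_eq_comp]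
      ring
    rw [hsplit]
    refine (norm_add_le _ _).trans (add_le_add ?_ ?_)
    · have hU' : ‖star U‖ ≤ 1 := by rwa [norm_star]
      have b1 := (hf.map hU').sum_norm_sq_le e hSs hsum
      have b2 := hg.sum_norm_sq_le e hSs hsum
      refine (norm_sum_le _ _).trans ?_
      refine (Finset.sum_le_sum fun i _ => norm_inner_le_norm _ _).trans ?_
      have cs := Finset.sum_mul_sq_le_sq_mul_sq Finset.univ (fun i => ‖S (star U (f i))‖)
        (fun i => ‖S (g i)‖)
      refine abs_le_of_sq_le_sq' (cs.trans ?_) hM |>.2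
      rw [sq M]
      exact mul_le_mul (b1.trans hle) (b2.trans hle) (Finset.sum_nonneg fun _ _ => by positivity) hM
    · have : ‖∑ i, ⟪f i, (A - U * T) (g i)⟫_ℂ‖ ≤ η / (c + 1) * c := by
        rw [hc, Finset.mul_sum]
        refine (norm_sum_le _ _).trans (Finset.sum_le_sum fun i _ => ?_)
        refine (norm_inner_le_norm _ _).trans ?_
        have := ((A - U * T).le_opNorm (g i)).trans
          (mul_le_mul_of_nonneg_right hU1 (norm_nonneg (g i)))
        nlinarith [norm_nonneg (f i)]
      refine this.trans ?_
      rw [div_mul_eq_mul_div, div_le_iff₀ (by positivity)]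
      nlinarith
  · intro h
    rw [traceNorm, posTrace, ENNReal.tsum_eq_iSup_sum]
    refine iSup_le fun F => ?_
    rw [← ENNReal.ofReal_sum_of_nonneg (fun i _ => hTp.re_inner_nonneg_right _)]
    refine ENNReal.ofReal_le_ofReal ?_
    refine le_of_forall_pos_le_add fun η hη => ?_
    obtain ⟨U, hU, -, hU2⟩ := exists_approx_polar A (δ := η / (F.card + 1)) (by positivity)
    have hon : Orthonormal ℂ (fun i : F => e i) := e.orthonormal.comp _ Subtype.val_injective
    have hB := Orthonormal.bessel hon
    have h1 := h.fintype (hB.map hU) hB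
    have hsplit : ∑ i ∈ F, RCLike.re ⟪e i, T (e i)⟫_ℂ
        = RCLike.re (∑ i : F, ⟪U (e i), A (e i)⟫_ℂ)
          + ∑ i ∈ F, RCLike.re ⟪e i, (T - star U * A) (e i)⟫_ℂ := by
      rw [map_sum, Finset.sum_coe_sort F (fun i => RCLike.re ⟪U (e i), A (e i)⟫_ℂ),
        ← Finset.sum_add_distrib]
      refine Finset.sum_congr rfl fun i _ => ?_
      rw [sub_apply, inner_sub_right, mul_apply_eq_comp,
        ContinuousLinearMap.star_eq_adjoint, ContinuousLinearMap.adjoint_inner_right, map_sub]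
      ring
    rw [hsplit]
    refine add_le_add ((RCLike.re_le_norm _).trans h1) ?_
    have hbd : ∀ i ∈ F, RCLike.re ⟪e i, (T - star U * A) (e i)⟫_ℂ ≤ η / (F.card + 1) := by
      intro i _
      refine (RCLike.re_le_norm _).trans ((norm_inner_le_norm _ _).trans ?_)
      have h1 : ‖e i‖ = 1 := e.orthonormal.1 i
      have := (T - star U * A).le_opNorm (e i)
      rw [h1] at this ⊢
      linarith
    refine (Finset.sum_le_card_nsmul _ _ _ hbd).trans ?_
    rw [nsmul_eq_mul, mul_div_assoc', div_le_iff₀ (by positivity)]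
    nlinarith

/-- The trace norm as a real number. -/
def tn (A : H →L[ℂ] H) : ℝ := (traceNorm A).toReal

theorem trLE_tn {A : H →L[ℂ] H} (h : traceNorm A < ∞) : TrLE A (tn A) :=
  (traceNorm_le_iff ENNReal.toReal_nonneg).1 (ENNReal.ofReal_toReal h.ne).ge

theorem TrLE.traceNorm_lt_top {A : H →L[ℂ] H} {M : ℝ} (h : TrLE A M) : traceNorm A < ∞ :=
  ((traceNorm_le_iff h.nonneg).2 h).trans_lt ENNReal.ofReal_lt_top

theorem TrLE.tn_le {A : H →L[ℂ] H} {M : ℝ} (h : TrLE A M) : tn A ≤ M :=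
  ENNReal.toReal_le_of_le_ofReal h.nonneg ((traceNorm_le_iff h.nonneg).2 h)

theorem TrLE.trLE_tn {A : H →L[ℂ] H} {M : ℝ} (h : TrLE A M) : TrLE A (tn A) :=
  HartreeFock.trLE_tn h.traceNorm_lt_top

theorem tn_nonneg (A : H →L[ℂ] H) : 0 ≤ tn A := ENNReal.toReal_nonneg

/-- Fubini for the double series ⟨b_j, e_i⟩⟨e_i, C a_j⟩, whose sum of absolute values over i is at
most ‖b_j‖‖C a_j‖. Hence the sum over j depends on the operator alone, which matters because the
density is defined by an unspecified expansion. -/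
theorem hasSum_trace {E : Type*} [NormedAddCommGroup E]
    [InnerProductSpace ℂ E] {ι : Type*} (e : HilbertBasis ι ℂ E) {A : E →L[ℂ] E} {a b : ℕ → E}
    (hs : Summable fun j => ‖a j‖ * ‖b j‖)
    (hA : ∀ f, HasSum (fun j => ⟪b j, f⟫_ℂ • a j) (A f)) (C : E →L[ℂ] E) :
    HasSum (fun i => ⟪e i, C (A (e i))⟫_ℂ) (∑' j, ⟪b j, C (a j)⟫_ℂ) := by
  set F : ι × ℕ → ℂ := fun p => ⟪b p.2, e p.1⟫_ℂ * ⟪e p.1, C (a p.2)⟫_ℂ with hF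
  have hbd : ∀ (s : Finset ι) (x y : E), ∑ i ∈ s, ‖⟪x, e i⟫_ℂ * ⟪e i, y⟫_ℂ‖ ≤ ‖x‖ * ‖y‖ := by
    intro s x y
    have hB := Orthonormal.bessel
      (e.orthonormal.comp (Subtype.val : s → ι) Subtype.val_injective)
    have := hB.sum_mul_le hB x y
    rw [← Finset.sum_coe_sort]
    simpa only [norm_mul, norm_inner_symm x, Function.comp] using this
  have hsum : Summable fun p : ℕ × ι => F p.swap := by
    refine Summable.of_norm ?_
    rw [summable_prod_of_nonneg (fun _ => norm_nonneg _)]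
    have h1 : ∀ j, Summable fun i => ‖F (i, j)‖ := fun j =>
      summable_of_sum_le (fun _ => norm_nonneg _) fun s => hbd s (b j) (C (a j))
    refine ⟨h1, ?_⟩
    refine Summable.of_nonneg_of_le (fun _ => tsum_nonneg fun _ => norm_nonneg _) (fun j => ?_)
      (hs.mul_left ‖C‖)
    refine ((h1 j).tsum_le_of_sum_le fun s => hbd s (b j) (C (a j))).trans ?_
    nlinarith [C.le_opNorm (a j), norm_nonneg (b j)]
  have hsum' : Summable F := (Equiv.prodComm ℕ ι).summable_iff.1 hsum
  have h1 := hsum.hasSum.prod_fiberwise fun j => e.hasSum_inner_mul_inner (b j) (C (a j))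
  have h2 : HasSum (fun i => ⟪e i, C (A (e i))⟫_ℂ) (∑' p, F p) := by
    refine hsum'.hasSum.prod_fiberwise fun i => ?_
    have := (hA (e i)).mapL (innerSL ℂ (e i) ∘L C)
    simpa [inner_smul_right] using this
  have h3 : ∑' p : ℕ × ι, F p.swap = ∑' p, F p := (Equiv.prodComm ℕ ι).tsum_eq F
  rw [h1.tsum_eq, h3]
  exact h2

/-- Compares two operators whose expansions are unrelated: in a common basis the difference becomes
the trace of C(A − A'). -/
theorem norm_trace_sub_le {A A' : H →L[ℂ] H} {a b a' b' : ℕ → H}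
    (hs : Summable fun j => ‖a j‖ * ‖b j‖)
    (hA : ∀ f, HasSum (fun j => ⟪b j, f⟫_ℂ • a j) (A f))
    (hs' : Summable fun j => ‖a' j‖ * ‖b' j‖)
    (hA' : ∀ f, HasSum (fun j => ⟪b' j, f⟫_ℂ • a' j) (A' f)) {M : ℝ} (h : TrLE (A - A') M)
    (C : H →L[ℂ] H) :
    ‖∑' j, ⟪b j, C (a j)⟫_ℂ - ∑' j, ⟪b' j, C (a' j)⟫_ℂ‖ ≤ ‖C‖ * M := by
  obtain ⟨w, e, -⟩ := exists_hilbertBasis ℂ H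
  have h1 := (hasSum_trace e hs hA C).sub (hasSum_trace e hs' hA' C)
  refine le_of_tendsto h1.norm (Eventually.of_forall fun s => ?_)
  have hB := Orthonormal.bessel (e.orthonormal.comp (Subtype.val : s → w) Subtype.val_injective)
  have := (h.mul_left C).fintype hB hB
  rw [← Finset.sum_coe_sort]
  refine le_trans (le_of_eq (congrArg _ (Finset.sum_congr rfl fun i _ => ?_))) this
  simp

theorem norm_trace_le {A : H →L[ℂ] H} {a b : ℕ → H}
    (hs : Summable fun j => ‖a j‖ * ‖b j‖)
    (hA : ∀ f, HasSum (fun j => ⟪b j, f⟫_ℂ • a j) (A f)) {M : ℝ} (h : TrLE A M)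
    (C : H →L[ℂ] H) : ‖∑' j, ⟪b j, C (a j)⟫_ℂ‖ ≤ ‖C‖ * M := by
  have := norm_trace_sub_le (A' := 0) (a' := 0) (b' := 0) hs hA (by simp) (by simp)
    (by simpa using h) C
  simpa using this

end Complete

end TraceNorm

/-! ### Multiplication operators on `L²` -/

theorem norm_sq_eq_integral (f : OneParticle) : ‖f‖ ^ 2 = ∫ x, ‖f x‖ ^ 2 := by
  have h : (⟪f, f⟫_ℂ) = ((‖f‖ ^ 2 : ℝ) : ℂ) := by
    rw [inner_self_eq_norm_sq_to_K]; norm_cast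
  rw [L2.inner_def] at h
  have h2 : ∀ x, ⟪f x, f x⟫_ℂ = ((‖f x‖ ^ 2 : ℝ) : ℂ) := fun x => by
    rw [inner_self_eq_norm_sq_to_K]; norm_cast
  simp only [h2] at h
  rw [integral_complex_ofReal] at h
  exact_mod_cast h.symm

theorem integrable_norm_sq (f : OneParticle) : Integrable fun x => ‖f x‖ ^ 2 :=
  (Lp.memLp f).integrable_norm_pow (p := 2) two_ne_zero

theorem tendsto_zero_of_dominated {α : Type*} {l : Filter α} [l.IsCountablyGenerated]
    {u : α → OneParticle} {v : α → Space → ℂ} (huv : ∀ s, u s =ᵐ[volume] v s) (G : OneParticle)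
    (hb : ∀ᶠ s in l, ∀ᵐ x : Space, ‖v s x‖ ≤ ‖G x‖)
    (hl : ∀ᵐ x : Space, Tendsto (fun s => v s x) l (𝓝 0)) : Tendsto u l (𝓝 0) := by
  have h : Tendsto (fun s => ‖u s‖ ^ 2) l (𝓝 (∫ _ : Space, (0 : ℝ))) := by
    have hv : ∀ s, ‖u s‖ ^ 2 = ∫ x, ‖v s x‖ ^ 2 := fun s => by
      rw [norm_sq_eq_integral]
      refine integral_congr_ae ?_
      filter_upwards [huv s] with x hx
      rw [hx]
    simp only [hv]
    refine tendsto_integral_filter_of_dominated_convergence (fun x => ‖G x‖ ^ 2)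
      (Eventually.of_forall fun s => ?_) ?_ (integrable_norm_sq G) ?_
    · have : AEStronglyMeasurable (v s) volume :=
        (Lp.aestronglyMeasurable (u s)).congr (huv s)
      exact this.norm.pow 2
    · filter_upwards [hb] with s hs
      filter_upwards [hs] with x hx
      rw [Real.norm_of_nonneg (sq_nonneg _)]
      exact pow_le_pow_left₀ (norm_nonneg _) hx 2
    · filter_upwards [hl] with x hx
      simpa using hx.norm.pow 2
  rw [integral_zero] at h
  rw [tendsto_zero_iff_norm_tendsto_zero]
  simpa [Real.sqrt_sq] using h.sqrt

/-- Functions which are measurable and bounded by one. -/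
def Contractive (g : Space → ℂ) : Prop := Measurable g ∧ ∀ x, ‖g x‖ ≤ 1

theorem Contractive.mul {g h : Space → ℂ} (hg : Contractive g) (hh : Contractive h) :
    Contractive fun x => g x * h x :=
  ⟨hg.1.mul hh.1, fun x => by
    rw [norm_mul]; exact mul_le_one₀ (hg.2 x) (norm_nonneg _) (hh.2 x)⟩

theorem Contractive.conj {g : Space → ℂ} (hg : Contractive g) :
    Contractive fun x => conj (g x) :=
  ⟨Complex.continuous_conj.measurable.comp hg.1, fun x => by rw [RCLike.norm_conj]; exact hg.2 x⟩

theorem Contractive.memLp {g : Space → ℂ} (hg : Contractive g) (f : OneParticle) :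
    MemLp (fun x => g x * f x) 2 (volume : Measure Space) :=
  (Lp.memLp f).of_le (hg.1.aestronglyMeasurable.mul (Lp.aestronglyMeasurable f))
    (Eventually.of_forall fun x => by
      rw [norm_mul]; exact mul_le_of_le_one_left (norm_nonneg _) (hg.2 x))

/-- Multiplication by `g`. -/
def mulOp (g : Space → ℂ) (hg : Contractive g) : Op :=
  LinearMap.mkContinuous
    { toFun := fun f => (hg.memLp f).toLp
      map_add' := fun f f' => by
        rw [← MemLp.toLp_add]
        refine MemLp.toLp_congr _ _ ?_
        filter_upwards [Lp.coeFn_add f f'] with x hx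
        rw [hx, Pi.add_apply, Pi.add_apply, mul_add]
      map_smul' := fun c f => by
        rw [RingHom.id_apply, ← MemLp.toLp_const_smul]
        refine MemLp.toLp_congr _ _ ?_
        filter_upwards [Lp.coeFn_smul c f] with x hx
        rw [hx, Pi.smul_apply, Pi.smul_apply, smul_eq_mul, smul_eq_mul, mul_left_comm] }
    1 fun f => by
      rw [one_mul]
      refine Lp.norm_le_norm_of_ae_le ?_
      filter_upwards [(hg.memLp f).coeFn_toLp] with x hx
      simp only [LinearMap.coe_mk, AddHom.coe_mk]
      rw [hx, norm_mul]
      exact mul_le_of_le_one_left (norm_nonneg _) (hg.2 x)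

theorem coeFn_mulOp {g : Space → ℂ} (hg : Contractive g) (f : OneParticle) :
    mulOp g hg f =ᵐ[volume] fun x => g x * f x := (hg.memLp f).coeFn_toLp

theorem norm_mulOp_le {g : Space → ℂ} (hg : Contractive g) : ‖mulOp g hg‖ ≤ 1 :=
  LinearMap.mkContinuous_norm_le _ zero_le_one _

theorem op_mul_apply (A B : Op) (f : OneParticle) : (A * B) f = A (B f) := rfl

theorem mulOp_mul {g h : Space → ℂ} (hg : Contractive g) (hh : Contractive h) :
    mulOp g hg * mulOp h hh = mulOp _ (hg.mul hh) := by
  ext1 f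
  refine Lp.ext ?_
  filter_upwards [coeFn_mulOp hg (mulOp h hh f), coeFn_mulOp hh f, coeFn_mulOp (hg.mul hh) f]
    with x h1 h2 h3
  rw [op_mul_apply, h1, h2, h3, mul_assoc]

theorem mulOp_congr {g h : Space → ℂ} (hg : Contractive g) (hh : Contractive h)
    (e : ∀ x, g x = h x) : mulOp g hg = mulOp h hh := by
  have : g = h := funext e
  subst this; rfl

theorem star_mulOp {g : Space → ℂ} (hg : Contractive g) :
    star (mulOp g hg) = mulOp _ hg.conj := by
  rw [ContinuousLinearMap.star_eq_adjoint, eq_comm, ContinuousLinearMap.eq_adjoint_iff]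
  intro f f'
  rw [L2.inner_def, L2.inner_def]
  refine integral_congr_ae ?_
  filter_upwards [coeFn_mulOp hg f', coeFn_mulOp hg.conj f] with x h1 h2
  rw [h1, h2]
  simp only [RCLike.inner_apply, map_mul, RCLike.conj_conj]
  ring

theorem mulOp_smul {g h : Space → ℂ} (hg : Contractive g) (hh : Contractive h) (c : ℂ)
    (e : ∀ x, g x = c * h x) : mulOp g hg = c • mulOp h hh := by
  ext1 f
  refine Lp.ext ?_
  filter_upwards [coeFn_mulOp hg f, coeFn_mulOp hh f, Lp.coeFn_smul c (mulOp h hh f)]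
    with x h1 h2 h3
  rw [smul_apply, h3, Pi.smul_apply, h1, h2, e, smul_eq_mul, mul_assoc]

theorem mulOp_one (h : Contractive fun _ => 1) : mulOp _ h = 1 := by
  ext1 f
  refine Lp.ext ?_
  filter_upwards [coeFn_mulOp h f] with x h1
  rw [h1, one_mul]; rfl

/-! ### Phases -/

theorem contractive_phase (θ : C(Space, ℝ)) : Contractive fun x => Complex.exp (θ x * Complex.I) :=
  ⟨by fun_prop, fun x => (Complex.norm_exp_ofReal_mul_I _).le⟩

/-- Multiplication by `exp (i θ)`. -/
def phase (θ : C(Space, ℝ)) : Op := mulOp _ (contractive_phase θ)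

theorem coeFn_phase (θ : C(Space, ℝ)) (f : OneParticle) :
    phase θ f =ᵐ[volume] fun x => Complex.exp (θ x * Complex.I) * f x := coeFn_mulOp _ f

theorem norm_phase_le (θ : C(Space, ℝ)) : ‖phase θ‖ ≤ 1 := norm_mulOp_le _

theorem phase_add (θ η : C(Space, ℝ)) : phase (θ + η) = phase θ * phase η := by
  rw [phase, phase, phase, mulOp_mul]
  refine mulOp_congr _ _ fun x => ?_
  rw [← Complex.exp_add, ContinuousMap.add_apply]
  push_cast; ring_nf

theorem phase_comm (θ η : C(Space, ℝ)) : phase θ * phase η = phase η * phase θ := by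
  rw [← phase_add, ← phase_add, add_comm]

theorem phase_zero : phase 0 = 1 := by
  have h : Contractive fun _ => 1 := ⟨measurable_const, fun _ => by simp⟩
  rw [← mulOp_one h]
  exact mulOp_congr _ _ fun x => by simp

theorem phase_mul_neg (θ : C(Space, ℝ)) : phase θ * phase (-θ) = 1 := by
  rw [← phase_add, add_neg_cancel, phase_zero]

theorem phase_neg_mul (θ : C(Space, ℝ)) : phase (-θ) * phase θ = 1 := by
  rw [← phase_add, neg_add_cancel, phase_zero]

theorem star_phase (θ : C(Space, ℝ)) : star (phase θ) = phase (-θ) := by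
  rw [phase, star_mulOp]
  refine mulOp_congr _ _ fun x => ?_
  rw [← Complex.exp_conj]
  simp

theorem phase_const_add (θ η : C(Space, ℝ)) (c : ℝ) (h : ∀ x, θ x = c + η x) :
    phase θ = Complex.exp (c * Complex.I) • phase η := by
  refine mulOp_smul _ _ _ fun x => ?_
  rw [← Complex.exp_add, h]
  push_cast; ring_nf

theorem norm_exp_sub_one_le (s : ℝ) : ‖Complex.exp (s * Complex.I) - 1‖ ≤ |s| := by
  rw [mul_comm]; exact Real.norm_exp_I_mul_ofReal_sub_one_le

theorem tendsto_phase {α : Type*} {l : Filter α} [l.IsCountablyGenerated] {θ : α → C(Space, ℝ)}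
    {θ₀ : C(Space, ℝ)} (h : ∀ x, Tendsto (fun s => θ s x) l (𝓝 (θ₀ x))) (f : OneParticle) :
    Tendsto (fun s => phase (θ s) f) l (𝓝 (phase θ₀ f)) := by
  rw [← tendsto_sub_nhds_zero_iff]
  refine tendsto_zero_of_dominated (v := fun s x =>
    (Complex.exp (θ s x * Complex.I) - Complex.exp (θ₀ x * Complex.I)) * f x) (fun s => ?_)
    ((2 : ℂ) • f) (Eventually.of_forall fun s => ?_) (Eventually.of_forall fun x => ?_)
  · filter_upwards [Lp.coeFn_sub (phase (θ s) f) (phase θ₀ f), coeFn_phase (θ s) f,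
      coeFn_phase θ₀ f] with x h1 h2 h3
    rw [h1, Pi.sub_apply, h2, h3, sub_mul]
  · filter_upwards [Lp.coeFn_smul (2 : ℂ) f] with x h1
    rw [h1, Pi.smul_apply, norm_smul, norm_mul]
    refine mul_le_mul_of_nonneg_right ?_ (norm_nonneg _)
    refine (norm_sub_le _ _).trans ?_
    rw [Complex.norm_exp_ofReal_mul_I, Complex.norm_exp_ofReal_mul_I]
    norm_num
  · have h1 : Tendsto (fun s => Complex.exp (θ s x * Complex.I)) l
        (𝓝 (Complex.exp (θ₀ x * Complex.I))) :=
      (by fun_prop : Continuous fun y : ℝ => Complex.exp (y * Complex.I)).continuousAt.tendsto.comp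
        (h x)
    simpa using (h1.sub_const (Complex.exp (θ₀ x * Complex.I))).mul_const (f x)

/-- `s ↦ exp (i s θ) f` is differentiable for `f` in the domain of multiplication by `θ`. -/
theorem hasDerivAt_phase {θ : C(Space, ℝ)} {f g : OneParticle}
    (hfg : g =ᵐ[volume] fun x => ((θ x : ℝ) : ℂ) * f x) (s : ℝ) :
    HasDerivAt (fun s : ℝ => phase (s • θ) f) (Complex.I • phase (s • θ) g) s := by
  have key : Tendsto (fun h : ℝ => h⁻¹ • (phase (h • θ) f - f) - Complex.I • g) (𝓝[≠] 0) (𝓝 0) := by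
    -- The difference quotient of exp(ihθ) is at most |θ| in modulus, so after subtracting iθ the
    -- integrand is dominated by 2|θ f| = |2g|.
    refine tendsto_zero_of_dominated (v := fun h x =>
      ((h : ℂ)⁻¹ * (Complex.exp ((h * θ x : ℝ) * Complex.I) - 1) - Complex.I * θ x) * f x)
      (fun h => ?_) ((2 : ℂ) • g) ?_ (Eventually.of_forall fun x => ?_)
    · filter_upwards [Lp.coeFn_sub (h⁻¹ • (phase (h • θ) f - f)) (Complex.I • g),
        Lp.coeFn_smul h⁻¹ (phase (h • θ) f - f), Lp.coeFn_sub (phase (h • θ) f) f,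
        coeFn_phase (h • θ) f, Lp.coeFn_smul Complex.I g, hfg] with x h1 h2 h3 h4 h5 h6
      rw [h1, Pi.sub_apply, h2, Pi.smul_apply, h3, Pi.sub_apply, h4, h5, Pi.smul_apply, h6]
      simp only [Complex.real_smul, smul_eq_mul, ContinuousMap.smul_apply, Complex.ofReal_inv]
      ring
    · filter_upwards [self_mem_nhdsWithin] with h hh
      have hh : h ≠ 0 := hh
      filter_upwards [Lp.coeFn_smul (2 : ℂ) g, hfg] with x h1 h2
      rw [h1, Pi.smul_apply, h2, norm_smul, norm_mul, norm_mul, ← mul_assoc]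
      refine mul_le_mul_of_nonneg_right ?_ (norm_nonneg _)
      refine (norm_sub_le _ _).trans ?_
      rw [norm_mul, norm_mul, Complex.norm_I, norm_inv, Complex.norm_real, Complex.norm_real]
      have := norm_exp_sub_one_le (h * θ x)
      rw [abs_mul] at this
      have h3 : ‖h‖⁻¹ * ‖Complex.exp ((h * θ x : ℝ) * Complex.I) - 1‖ ≤ |θ x| := by
        rw [inv_mul_le_iff₀ (norm_pos_iff.2 hh)]
        exact this
      have h4 : ‖(2 : ℂ)‖ = 2 := by simp
      rw [h4]
      simp only [Real.norm_eq_abs] at h3 ⊢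
      linarith
    · have hd : HasDerivAt (fun h : ℝ => Complex.exp ((h * θ x : ℝ) * Complex.I))
          (Complex.I * θ x) 0 := by
        have h1 : HasDerivAt (fun h : ℝ => ((h * θ x : ℝ) : ℂ) * Complex.I)
            (((1 * θ x : ℝ) : ℂ) * Complex.I) 0 :=
          (((hasDerivAt_id (0 : ℝ)).mul_const (θ x)).ofReal_comp).mul_const Complex.I
        have := h1.cexp
        simpa [mul_comm] using this
      have := hd.tendsto_slope_zero
      simp only [zero_add, zero_mul, Complex.ofReal_zero, Complex.exp_zero] at this
      have h2 := (this.sub_const (Complex.I * θ x)).mul_const (f x)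
      simpa [Complex.real_smul] using h2
  have h0 : HasDerivAt (fun h : ℝ => phase (h • θ) f) (Complex.I • g) 0 := by
    rw [hasDerivAt_iff_tendsto_slope_zero, ← tendsto_sub_nhds_zero_iff]
    simpa [phase_zero] using key
  have h1 : HasDerivAt (fun r : ℝ => phase ((r - s) • θ) f) (Complex.I • g) s := by
    have h0' : HasDerivAt (fun h : ℝ => phase (h • θ) f) (Complex.I • g) (s - s) := by
      rwa [sub_self]
    exact h0'.comp_sub_const s s
  have h2 := ((phase (s • θ)).hasFDerivAt.restrictScalars ℝ).comp_hasDerivAt s h1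
  convert! h2 using 1
  · ext1 r
    rw [Function.comp_apply, ← op_mul_apply, ← phase_add, ← add_smul]
    congr 3; ring
  · simp

/-! ### Plane waves, translations and the free evolution -/

/-- The linear function `x ↦ 2π ⟨k, x⟩`. -/
def linPhase (k : Space) : C(Space, ℝ) := ⟨fun x => 2 * Real.pi * ⟪k, x⟫_ℝ, by fun_prop⟩

@[simp] theorem linPhase_apply (k x : Space) : linPhase k x = 2 * Real.pi * ⟪k, x⟫_ℝ := rfl

/-- The function `x ↦ |x|²`. -/
def normSq : C(Space, ℝ) := ⟨fun x => ‖x‖ ^ 2, by fun_prop⟩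

@[simp] theorem normSq_apply (x : Space) : normSq x = ‖x‖ ^ 2 := rfl

theorem linPhase_add (k l : Space) : linPhase (k + l) = linPhase k + linPhase l := by
  ext x; simp [inner_add_left, mul_add]

theorem linPhase_neg (k : Space) : linPhase (-k) = -linPhase k := by
  ext x; simp

theorem linPhase_zero : linPhase 0 = 0 := by
  ext x; simp

/-- Multiplication by the plane wave `exp (2 π i k · x)`. -/
def wave (k : Space) : Op := phase (linPhase k)

/-- The Fourier transform on `L²`. -/
def fourierL2 : OneParticle ≃ₗᵢ[ℂ] OneParticle := Lp.fourierTransformₗᵢ Space ℂ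

/-- Conjugation with the Fourier transform, `A ↦ F⁻¹ A F`. -/
def fconj : Op ≃⋆ₐ[ℂ] Op := fourierL2.symm.conjStarAlgEquiv

theorem fconj_apply (A : Op) (f : OneParticle) :
    fconj A f = fourierL2.symm (A (fourierL2 f)) := rfl

theorem fconj_symm_apply (A : Op) (f : OneParticle) :
    fconj.symm A f = fourierL2 (A (fourierL2.symm f)) := rfl

theorem bessel_isometry {ι : Type*} [Fintype ι] {f : ι → OneParticle} (hf : Bessel f)
    (e : OneParticle ≃ₗᵢ[ℂ] OneParticle) : Bessel fun i => e (f i) := by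
  intro x
  have h := hf (e.symm x)
  rw [LinearIsometryEquiv.norm_map] at h
  refine le_trans (le_of_eq (Finset.sum_congr rfl fun i _ => ?_)) h
  rw [← e.inner_map_map (f i), e.apply_symm_apply]

theorem TrLE.fconj {A : Op} {M : ℝ} (h : TrLE A M) : TrLE (fconj A) M := by
  intro n f g hf hg
  have := h n _ _ (bessel_isometry hf fourierL2) (bessel_isometry hg fourierL2)
  refine le_trans (le_of_eq (congrArg _ (Finset.sum_congr rfl fun i _ => ?_))) this
  rw [fconj_apply, ← fourierL2.inner_map_map, fourierL2.apply_symm_apply]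

theorem TrLE.fconj_symm {A : Op} {M : ℝ} (h : TrLE A M) : TrLE (HartreeFock.fconj.symm A) M := by
  intro n f g hf hg
  have := h n _ _ (bessel_isometry hf fourierL2.symm) (bessel_isometry hg fourierL2.symm)
  refine le_trans (le_of_eq (congrArg _ (Finset.sum_congr rfl fun i _ => ?_))) this
  rw [fconj_symm_apply, ← fourierL2.symm.inner_map_map, fourierL2.symm_apply_apply]

theorem norm_fconj (A : Op) : ‖fconj A‖ = ‖A‖ := by
  have key : ∀ A : Op, ‖fconj A‖ ≤ ‖A‖ := fun A =>
    ContinuousLinearMap.opNorm_le_bound _ (norm_nonneg _) fun f => by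
      rw [fconj_apply, LinearIsometryEquiv.norm_map]
      exact (A.le_opNorm _).trans (by rw [LinearIsometryEquiv.norm_map])
  have key' : ∀ A : Op, ‖fconj.symm A‖ ≤ ‖A‖ := fun A =>
    ContinuousLinearMap.opNorm_le_bound _ (norm_nonneg _) fun f => by
      rw [fconj_symm_apply, LinearIsometryEquiv.norm_map]
      exact (A.le_opNorm _).trans (by rw [LinearIsometryEquiv.norm_map])
  refine le_antisymm (key A) ?_
  simpa using key' (fconj A)

/-- The translation `f ↦ f (· + a)`, as a Fourier multiplier. -/
def shift (a : Space) : Op := fconj (phase (linPhase a))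

/-- The Fourier multiplier `exp (i s |ξ|²)`. -/
def free (s : ℝ) : Op := fconj (phase (s • normSq))

theorem wave_add (k l : Space) : wave (k + l) = wave k * wave l := by
  rw [wave, linPhase_add, phase_add]; rfl

theorem shift_add (k l : Space) : shift (k + l) = shift k * shift l := by
  rw [shift, linPhase_add, phase_add, map_mul]; rfl

theorem free_add (s t : ℝ) : free (s + t) = free s * free t := by
  rw [free, add_smul, phase_add, map_mul]; rfl

theorem wave_zero : wave 0 = 1 := by rw [wave, linPhase_zero, phase_zero]

theorem shift_zero : shift 0 = 1 := by rw [shift, linPhase_zero, phase_zero, map_one]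

theorem free_zero : free 0 = 1 := by rw [free, zero_smul, phase_zero, map_one]

theorem norm_wave_le (k : Space) : ‖wave k‖ ≤ 1 := norm_phase_le _

theorem norm_shift_le (k : Space) : ‖shift k‖ ≤ 1 := by
  rw [shift, norm_fconj]; exact norm_phase_le _

theorem norm_free_le (s : ℝ) : ‖free s‖ ≤ 1 := by
  rw [free, norm_fconj]; exact norm_phase_le _

theorem star_wave (k : Space) : star (wave k) = wave (-k) := by
  rw [wave, star_phase, wave, linPhase_neg]

theorem star_shift (k : Space) : star (shift k) = shift (-k) := by
  rw [shift, ← map_star, star_phase, shift, linPhase_neg]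

theorem star_free (s : ℝ) : star (free s) = free (-s) := by
  rw [free, ← map_star, star_phase, free, neg_smul]

theorem free_neg_mul (s : ℝ) : free (-s) * free s = 1 := by
  rw [← free_add, neg_add_cancel, free_zero]

theorem free_mul_neg (s : ℝ) : free s * free (-s) = 1 := by
  rw [← free_add, add_neg_cancel, free_zero]

theorem wave_neg_mul (k : Space) : wave (-k) * wave k = 1 := by
  rw [← wave_add, neg_add_cancel, wave_zero]

theorem wave_mul_neg (k : Space) : wave k * wave (-k) = 1 := by
  rw [← wave_add, add_neg_cancel, wave_zero]

theorem free_shift_comm (s : ℝ) (a : Space) : free s * shift a = shift a * free s := by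
  rw [free, shift, ← map_mul, phase_comm, map_mul]

/-! ### Schwartz functions -/

theorem iteratedDeriv_cexp_mul_I (n : ℕ) :
    iteratedDeriv n (fun s : ℝ => Complex.exp (s * Complex.I))
      = fun s : ℝ => Complex.I ^ n * Complex.exp (s * Complex.I) := by
  induction n with
  | zero => simp
  | succ n ih =>
    rw [iteratedDeriv_succ, ih]
    ext s
    have h1 : HasDerivAt (fun s : ℝ => (s : ℂ) * Complex.I) (1 * Complex.I) s :=
      (hasDerivAt_id s).ofReal_comp.mul_const _
    have h2 := (h1.cexp).const_mul (Complex.I ^ n)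
    rw [h2.deriv]
    ring

theorem hasTemperateGrowth_cexp :
    Function.HasTemperateGrowth fun s : ℝ => Complex.exp (s * Complex.I) := by
  refine ⟨(Complex.ofRealCLM.contDiff.mul contDiff_const).cexp, fun n => ⟨0, 1, fun s => ?_⟩⟩
  rw [norm_iteratedFDeriv_eq_norm_iteratedDeriv, iteratedDeriv_cexp_mul_I]
  simp [Complex.norm_exp_ofReal_mul_I]

theorem hasTemperateGrowth_phase {θ : Space → ℝ} (hθ : θ.HasTemperateGrowth) :
    Function.HasTemperateGrowth fun x => Complex.exp (θ x * Complex.I) :=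
  hasTemperateGrowth_cexp.comp hθ

theorem fourierL2_toLp (φ : 𝓢(Space, ℂ)) : fourierL2 (φ.toLp 2) = (𝓕 φ).toLp 2 :=
  SchwartzMap.toLp_fourier_eq φ

theorem fourierL2_symm_toLp (φ : 𝓢(Space, ℂ)) : fourierL2.symm (φ.toLp 2) = (𝓕⁻ φ).toLp 2 :=
  SchwartzMap.toLp_fourierInv_eq φ

theorem phase_toLp (θ : C(Space, ℝ)) (hθ : Function.HasTemperateGrowth θ) (φ : 𝓢(Space, ℂ)) :
    phase θ (φ.toLp 2)
      = (SchwartzMap.smulLeftCLM ℂ (fun x => Complex.exp (θ x * Complex.I)) φ).toLp 2 := by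
  refine Lp.ext ?_
  filter_upwards [coeFn_phase θ (φ.toLp 2), φ.coeFn_toLp 2 volume,
    (SchwartzMap.smulLeftCLM ℂ (fun x => Complex.exp (θ x * Complex.I)) φ).coeFn_toLp 2 volume]
    with x h1 h2 h3
  rw [h1, h2, h3, SchwartzMap.smulLeftCLM_apply_apply (hasTemperateGrowth_phase hθ), smul_eq_mul]

theorem denseRange_toLp : DenseRange fun φ : 𝓢(Space, ℂ) => (φ.toLp 2 : OneParticle) :=
  SchwartzMap.denseRange_toLpCLM (E := Space) (F := ℂ) (p := 2) (by simp) (μ := volume)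

theorem temperate_linPhase (k : Space) : Function.HasTemperateGrowth (linPhase k) :=
  ((Function.HasTemperateGrowth.const (2 * Real.pi)).mul (Function.hasTemperateGrowth_inner_right k) : _)

theorem temperate_normSq (s : ℝ) : Function.HasTemperateGrowth (s • normSq : C(Space, ℝ)) :=
  ((Function.HasTemperateGrowth.const s).mul (Function.hasTemperateGrowth_norm_sq (H := Space)) : _)

/-- The translation `f ↦ f (· - k)`. -/
def translate (k : Space) : OneParticle →ₗᵢ[ℂ] OneParticle :=
  Lp.compMeasurePreservingₗᵢ ℂ (fun x => x - k) (measurePreserving_sub_right volume k)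

theorem coeFn_translate (k : Space) (f : OneParticle) :
    translate k f =ᵐ[volume] fun x => f (x - k) :=
  Lp.coeFn_compMeasurePreserving f (measurePreserving_sub_right volume k)

theorem fourierL2_wave (k : Space) (f : OneParticle) :
    fourierL2 (wave k f) = translate k (fourierL2 f) := by
  refine congrFun (denseRange_toLp.equalizer (g := fun f => fourierL2 (wave k f))
    (h := fun f => translate k (fourierL2 f)) (by fun_prop) ?_ ?_) f
  · exact (translate k).continuous.comp fourierL2.continuous
  · ext1 φ
    simp only [Function.comp]
    rw [wave, phase_toLp _ (temperate_linPhase k), fourierL2_toLp, fourierL2_toLp]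
    refine Lp.ext ?_
    have hmp := measurePreserving_sub_right (volume : Measure Space) k
    filter_upwards [coeFn_translate k ((𝓕 φ).toLp 2),
      (𝓕 (SchwartzMap.smulLeftCLM ℂ (fun x => Complex.exp (linPhase k x * Complex.I))
        φ)).coeFn_toLp 2 volume,
      hmp.quasiMeasurePreserving.ae ((𝓕 φ).coeFn_toLp 2 volume)] with ξ h1 h2 h3
    rw [h1, h2, h3, SchwartzMap.fourier_coe, SchwartzMap.fourier_coe, Real.fourier_eq',
      Real.fourier_eq']
    refine integral_congr_ae (Eventually.of_forall fun x => ?_)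
    simp only
    rw [SchwartzMap.smulLeftCLM_apply_apply (hasTemperateGrowth_phase (temperate_linPhase k)),
      smul_smul, ← Complex.exp_add, linPhase_apply, inner_sub_right, real_inner_comm x k]
    congr 2
    push_cast; ring

/-- Modulation by a plane wave is translation in Fourier space, so moving it past a Fourier
multiplier translates the symbol. -/
theorem fconj_phase_mul_wave (θ η : C(Space, ℝ)) (k : Space) (h : ∀ ξ, η ξ = θ (ξ + k)) :
    fconj (phase θ) * wave k = wave k * fconj (phase η) := by
  ext1 f
  apply fourierL2.injective
  rw [op_mul_apply, op_mul_apply, fourierL2_wave, fconj_apply, fconj_apply,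
    fourierL2.apply_symm_apply, fourierL2.apply_symm_apply, fourierL2_wave]
  refine Lp.ext ?_
  have hmp := measurePreserving_sub_right (volume : Measure Space) k
  filter_upwards [coeFn_phase θ (translate k (fourierL2 f)), coeFn_translate k (fourierL2 f),
    coeFn_translate k (phase η (fourierL2 f)),
    hmp.quasiMeasurePreserving.ae (coeFn_phase η (fourierL2 f))] with ξ h1 h2 h3 h4
  rw [h1, h2, h3, h4, h, sub_add_cancel]

/-- The Weyl relation: translating a linear symbol only adds a constant. -/
theorem shift_mul_wave (a k : Space) :
    shift a * wave k
      = Complex.exp ((2 * Real.pi * ⟪a, k⟫_ℝ : ℝ) * Complex.I) • (wave k * shift a) := by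
  rw [shift, fconj_phase_mul_wave _ ⟨fun ξ => linPhase a (ξ + k), by fun_prop⟩ k fun ξ => rfl,
    phase_const_add _ (linPhase a) (2 * Real.pi * ⟪a, k⟫_ℝ), map_smul, mul_smul_comm]
  intro ξ
  simp only [ContinuousMap.coe_mk, linPhase_apply, inner_add_right]
  ring

/-- Galilean covariance, from |ξ + k|² = |ξ|² + 2ξ·k + |k|². The cross term is the symbol of a
translation; dividing by π adjusts it to the factor 2π in `linPhase`. -/
theorem free_mul_wave (s : ℝ) (k : Space) :
    free s * wave k
      = Complex.exp ((s * ‖k‖ ^ 2 : ℝ) * Complex.I) •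
        (wave k * shift ((s / Real.pi) • k) * free s) := by
  rw [free, fconj_phase_mul_wave _ ⟨fun ξ => (s • normSq) (ξ + k), by fun_prop⟩ k fun ξ => rfl,
    phase_const_add _ (linPhase ((s / Real.pi) • k) + s • normSq) (s * ‖k‖ ^ 2), map_smul,
    mul_smul_comm, phase_add, map_mul, shift, mul_assoc]
  intro ξ
  simp only [ContinuousMap.coe_mk, ContinuousMap.smul_apply, normSq_apply, ContinuousMap.add_apply,
    linPhase_apply, inner_smul_left, smul_eq_mul, norm_add_sq_real, conj_trivial]
  rw [real_inner_comm]
  field_simp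
  ring

/-- The free evolution on Schwartz functions. -/
def freeSchwartz (s : ℝ) (φ : 𝓢(Space, ℂ)) : 𝓢(Space, ℂ) :=
  SchwartzMap.fourierMultiplierCLM ℂ
    (fun ξ => Complex.exp ((s • normSq : C(Space, ℝ)) ξ * Complex.I)) φ

theorem free_toLp (s : ℝ) (φ : 𝓢(Space, ℂ)) : free s (φ.toLp 2) = (freeSchwartz s φ).toLp 2 := by
  rw [free, fconj_apply, fourierL2_toLp, phase_toLp _ (temperate_normSq s), fourierL2_symm_toLp]
  rfl

theorem fourier_laplacian_toLp (φ : 𝓢(Space, ℂ)) :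
    fourierL2 ((Δ φ).toLp 2)
      =ᵐ[volume] fun ξ => (-(2 * Real.pi) ^ 2 * ‖ξ‖ ^ 2 : ℝ) * fourierL2 (φ.toLp 2) ξ := by
  rw [fourierL2_toLp, fourierL2_toLp]
  filter_upwards [(𝓕 (Δ φ)).coeFn_toLp 2 volume, (𝓕 φ).coeFn_toLp 2 volume] with ξ h1 h2
  rw [h1, h2, SchwartzMap.laplacian_eq_fourierMultiplierCLM, FourierTransform.fourier_smul,
    SchwartzMap.fourierMultiplierCLM_apply, FourierTransform.fourier_fourierInv_eq,
    smul_apply,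
    SchwartzMap.smulLeftCLM_apply_apply (Function.hasTemperateGrowth_norm_sq (H := Space)), neg_smul,
    Complex.real_smul, Complex.real_smul]
  push_cast
  ring

theorem fourierL2_free (s : ℝ) (f : OneParticle) :
    fourierL2 (free s f) = phase (s • normSq) (fourierL2 f) := by
  rw [free, fconj_apply, fourierL2.apply_symm_apply]

theorem free_laplacian_toLp (s : ℝ) (φ : 𝓢(Space, ℂ)) :
    free s ((Δ φ).toLp 2) = (Δ (freeSchwartz s φ)).toLp 2 := by
  apply fourierL2.injective
  refine Lp.ext ?_
  rw [fourierL2_free]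
  filter_upwards [coeFn_phase (s • normSq) (fourierL2 ((Δ φ).toLp 2)), fourier_laplacian_toLp φ,
    fourier_laplacian_toLp (freeSchwartz s φ),
    coeFn_phase (s • normSq) (fourierL2 (φ.toLp 2))] with ξ h1 h2 h3 h4
  rw [h1, h2, h3, ← free_toLp, fourierL2_free, h4]
  ring

/-- The symbol |ξ|² belongs to −Δ/(2π)². Schwartz functions stay Schwartz under the free flow, so
the weak equation can be tested with freely evolving functions. -/
theorem hasDerivAt_free (s : ℝ) (φ : 𝓢(Space, ℂ)) :
    HasDerivAt (fun s : ℝ => free s (φ.toLp 2))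
      ((-Complex.I / (2 * Real.pi) ^ 2) • (Δ (freeSchwartz s φ)).toLp 2) s := by
  set g : OneParticle := (-1 / (2 * Real.pi) ^ 2 : ℂ) • fourierL2 ((Δ φ).toLp 2) with hg
  have hg' : g =ᵐ[volume] fun ξ => ((normSq ξ : ℝ) : ℂ) * fourierL2 (φ.toLp 2) ξ := by
    filter_upwards [Lp.coeFn_smul (-1 / (2 * Real.pi) ^ 2 : ℂ) (fourierL2 ((Δ φ).toLp 2)),
      fourier_laplacian_toLp φ] with ξ h1 h2
    rw [hg, h1, Pi.smul_apply, h2, smul_eq_mul, normSq_apply]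
    have : (Real.pi : ℂ) ≠ 0 := by exact_mod_cast Real.pi_ne_zero
    push_cast
    field_simp
  have h := hasDerivAt_phase hg' s
  have h2 := (fourierL2.symm.toContinuousLinearEquiv.toContinuousLinearMap.hasFDerivAt.restrictScalars
    ℝ).comp_hasDerivAt s h
  convert! h2 using 1
  rw [← free_laplacian_toLp, free, fconj_apply]
  simp [hg, smul_smul]
  congr 1
  ring

/-! ### The potential as a superposition of plane waves -/

theorem integrable_tsum {α : Type*} [MeasurableSpace α] {μ : Measure α} {F : ℕ → α → ℂ}
    (hF : ∀ j, Integrable (F j) μ) (hs : Summable fun j => ∫ a, ‖F j a‖ ∂μ) :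
    Integrable (fun a => ∑' j, F j a) μ := by
  have hm : ∀ j, AEMeasurable (fun a => ‖F j a‖ₑ) μ := fun j => (hF j).aestronglyMeasurable.enorm
  have h1 : ∫⁻ a, ∑' j, ‖F j a‖ₑ ∂μ < ∞ := by
    rw [lintegral_tsum hm]
    have : ∀ j, ∫⁻ a, ‖F j a‖ₑ ∂μ = ENNReal.ofReal (∫ a, ‖F j a‖ ∂μ) := fun j =>
      (ofReal_integral_norm_eq_lintegral_enorm (hF j)).symm
    simp only [this]
    rw [← ENNReal.ofReal_tsum_of_nonneg (fun j => integral_nonneg fun _ => norm_nonneg _) hs]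
    exact ENNReal.ofReal_lt_top
  have h2 : ∀ᵐ a ∂μ, Summable fun j => F j a := by
    filter_upwards [ae_lt_top' (AEMeasurable.tsum hm) h1.ne] with a ha
    refine Summable.of_norm ?_
    simpa using ENNReal.summable_toReal ha.ne
  refine ⟨?_, ?_⟩
  · refine aestronglyMeasurable_of_tendsto_ae (u := atTop)
      (f := fun (n : ℕ) a => ∑ j ∈ Finset.range n, F j a) (fun n => ?_) ?_
    · exact Finset.aestronglyMeasurable_fun_sum _ fun j _ => (hF j).aestronglyMeasurable
    · filter_upwards [h2] with a ha using ha.hasSum.tendsto_sum_nat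
  · exact (lintegral_mono fun a => enorm_tsum_le_tsum_enorm).trans_lt h1

theorem integral_norm_mul_norm_le (f g : OneParticle) : ∫ x, ‖f x‖ * ‖g x‖ ≤ ‖f‖ * ‖g‖ := by
  have h := integral_mul_norm_le_Lp_mul_Lq (μ := (volume : Measure Space)) (f := f) (g := g)
    Real.HolderConjugate.two_two (by simpa using Lp.memLp f) (by simpa using Lp.memLp g)
  simpa only [Real.rpow_two, ← norm_sq_eq_integral, ← Real.sqrt_eq_rpow,
    Real.sqrt_sq (norm_nonneg _)] using h

theorem integrable_mul_conj (f g : OneParticle) : Integrable fun x => f x * conj (g x) := by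
  have := L2.integrable_inner (𝕜 := ℂ) g f
  simpa only [RCLike.inner_apply] using this

theorem integral_norm_mul_conj_le (f g : OneParticle) :
    ∫ x, ‖f x * conj (g x)‖ ≤ ‖f‖ * ‖g‖ := by
  simpa only [norm_mul, RCLike.norm_conj] using integral_norm_mul_norm_le f g

/-- The plane wave `exp (2 π i k · x)`. -/
def planeWave (k x : Space) : ℂ := Complex.exp (linPhase k x * Complex.I)

theorem norm_planeWave (k x : Space) : ‖planeWave k x‖ = 1 := Complex.norm_exp_ofReal_mul_I _

theorem continuous_planeWave_left (x : Space) : Continuous fun k => planeWave k x := by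
  unfold planeWave
  simp only [linPhase_apply]
  fun_prop

theorem continuous_planeWave_right (k : Space) : Continuous fun x => planeWave k x := by
  unfold planeWave
  simp only [linPhase_apply]
  fun_prop

theorem measurable_planeWave_comp {α : Type*} [MeasurableSpace α] {T T' : α → Space}
    (hT : Measurable T) (hT' : Measurable T') : Measurable fun p => planeWave (T p) (T' p) := by
  unfold planeWave
  simp only [linPhase_apply]
  fun_prop

theorem planeWave_sub (k x y : Space) : planeWave k (x - y) = planeWave k x * planeWave (-k) y := by
  rw [planeWave, planeWave, planeWave, ← Complex.exp_add]
  simp only [linPhase_apply, inner_sub_right, inner_neg_left]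
  congr 1
  push_cast; ring

section Potential

variable {V : Space → ℝ} {W : Space → ℂ}

theorem integrable_of_weighted (hW : Integrable fun p => ((1 + ‖p‖ ^ 2 : ℝ) : ℂ) * W p) :
    Integrable W := by
  have hm : AEStronglyMeasurable W volume := by
    have h1 : AEStronglyMeasurable (fun p : Space =>
        (((1 + ‖p‖ ^ 2 : ℝ) : ℂ))⁻¹ * (((1 + ‖p‖ ^ 2 : ℝ) : ℂ) * W p)) volume := by
      refine AEStronglyMeasurable.mul ?_ hW.aestronglyMeasurable
      exact Measurable.aestronglyMeasurable (by fun_prop)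
    refine h1.congr (Eventually.of_forall fun p => ?_)
    have : (((1 + ‖p‖ ^ 2 : ℝ) : ℂ)) ≠ 0 := by
      exact_mod_cast (by positivity : (1 + ‖p‖ ^ 2 : ℝ) ≠ 0)
    simp only
    rw [inv_mul_cancel_left₀ this]
  refine hW.mono hm (Eventually.of_forall fun p => ?_)
  rw [norm_mul, Complex.norm_real, Real.norm_of_nonneg (by positivity)]
  nlinarith [norm_nonneg (W p), sq_nonneg ‖p‖, mul_nonneg (sq_nonneg ‖p‖) (norm_nonneg (W p))]

/-- The potential as a superposition of plane waves. -/
def waveSum (W : Space → ℂ) (x : Space) : ℂ := ∫ k, W k * planeWave k x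

theorem continuous_waveSum (hW : Integrable W) : Continuous (waveSum W) := by
  refine continuous_of_dominated (bound := fun k => ‖W k‖) (fun x => ?_) (fun x => ?_) hW.norm ?_
  · exact hW.aestronglyMeasurable.mul (continuous_planeWave_left x).aestronglyMeasurable
  · exact Eventually.of_forall fun k => by rw [norm_mul, norm_planeWave, mul_one]
  · exact Eventually.of_forall fun k => (continuous_planeWave_right k).const_mul (W k)

theorem norm_waveSum_le (x : Space) : ‖waveSum W x‖ ≤ ∫ k, ‖W k‖ := by
  refine (norm_integral_le_integral_norm _).trans (le_of_eq ?_)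
  simp only [norm_mul, norm_planeWave, mul_one]

theorem integrable_wave_kernel {α : Type*} [MeasurableSpace α] {μ : Measure α} [SFinite μ]
    (hW : Integrable W) {S : α → ℂ} (hS : Integrable S μ) {T : α → Space} (hT : Measurable T) :
    Integrable (Function.uncurry fun (p : α) (k : Space) => W k * planeWave k (T p) * S p)
      (μ.prod volume) := by
  have h0 : Integrable (fun p : α × Space => S p.1 * W p.2) (μ.prod volume) := hS.mul_prod hW
  have hm : Measurable fun p : α × Space => planeWave p.2 (T p.1) :=
    measurable_planeWave_comp measurable_snd (hT.comp measurable_fst)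
  have h : Integrable (fun p : α × Space => planeWave p.2 (T p.1) * (S p.1 * W p.2))
      (μ.prod volume) :=
    h0.bdd_mul (c := 1) hm.aestronglyMeasurable
      (Eventually.of_forall fun p => (norm_planeWave _ _).le)
  refine h.congr (Eventually.of_forall fun p => ?_)
  simp only [Function.uncurry]
  ring

theorem integral_waveSum_mul {α : Type*} [MeasurableSpace α] {μ : Measure α} [SFinite μ]
    (hW : Integrable W) {S : α → ℂ} (hS : Integrable S μ) {T : α → Space} (hT : Measurable T) :
    ∫ p, waveSum W (T p) * S p ∂μ = ∫ k, W k * ∫ p, planeWave k (T p) * S p ∂μ := by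
  have h := integral_integral_swap (integrable_wave_kernel hW hS hT)
  simp only [mul_assoc, integral_const_mul] at h
  rw [← h]
  refine integral_congr_ae (Eventually.of_forall fun p => ?_)
  simp only [waveSum]
  rw [← integral_mul_const]
  simp only [mul_assoc]

/-- Both sides have the same integrals against test functions χ: the distributional transform is
tested on the inverse transform of χ, and Fubini does the rest. Local integrability of V follows by
testing with a bump function equal to one near a given point. -/
theorem potential_eq_waveSum (hV : HasFourierTransform V W) (hW : Integrable W) :
    ∀ᵐ x, (V x : ℂ) = waveSum W x := by
  refine ae_eq_of_integral_contDiff_smul_eq (μ := volume) ?_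
    (continuous_waveSum hW).locallyIntegrable fun g hg hc => ?_
  · intro x
    let b : ContDiffBump x := ⟨1, 2, by norm_num, by norm_num⟩
    have hbc : HasCompactSupport fun y => ((b y : ℝ) : ℂ) :=
      b.hasCompactSupport.comp_left (g := fun r : ℝ => (r : ℂ)) (by simp)
    have hbd : ContDiff ℝ ((⊤ : ℕ∞) : WithTop ℕ∞) fun y => ((b y : ℝ) : ℂ) :=
      Complex.ofRealCLM.contDiff.comp b.contDiff
    refine ⟨Metric.closedBall x 1, Metric.closedBall_mem_nhds x one_pos, ?_⟩
    have h := (hV (hbc.toSchwartzMap hbd)).1.integrableOn (s := Metric.closedBall x 1)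
    refine h.congr_fun (fun y hy => ?_) Metric.isClosed_closedBall.measurableSet
    have : b y = 1 := b.one_of_mem_closedBall hy
    have h2 : hbc.toSchwartzMap hbd y = 1 := by
      rw [← Complex.ofReal_one, ← this]; rfl
    simp only [h2, mul_one]
  · have hgc : HasCompactSupport fun y => ((g y : ℝ) : ℂ) :=
      hc.comp_left (g := fun r : ℝ => (r : ℂ)) (by simp)
    have hgd : ContDiff ℝ ((⊤ : ℕ∞) : WithTop ℕ∞) fun y => ((g y : ℝ) : ℂ) :=
      Complex.ofRealCLM.contDiff.comp hg
    set χ : 𝓢(Space, ℂ) := hgc.toSchwartzMap hgd with hχ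
    have hχg : ∀ x, χ x = (g x : ℂ) := fun x => rfl
    have h := (hV (𝓕⁻ χ)).2.2
    rw [FourierTransform.fourier_fourierInv_eq] at h
    have h1 := integral_waveSum_mul hW (χ.integrable (μ := volume)) measurable_id
    simp only [id] at h1
    calc ∫ x, g x • (V x : ℂ) = ∫ x, (V x : ℂ) * χ x := by
          simp only [hχg, Complex.real_smul, mul_comm]
      _ = ∫ p, W p * (𝓕⁻ χ) p := h
      _ = ∫ k, W k * ∫ x, planeWave k x * χ x := by
          refine integral_congr_ae (Eventually.of_forall fun k => ?_)
          simp only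
          rw [SchwartzMap.fourierInv_coe, Real.fourierInv_eq']
          simp only [planeWave, linPhase_apply, smul_eq_mul, real_inner_comm]
      _ = ∫ x, waveSum W x * χ x := h1.symm
      _ = ∫ x, g x • waveSum W x := by
          simp only [hχg, Complex.real_smul, mul_comm]

/-- The plane wave at x − y factorises in x and y; this separation of variables turns both
mean-field terms into superpositions of simple operators. -/
theorem integral_potential_mul (hV : HasFourierTransform V W) (hW : Integrable W)
    {S : Space × Space → ℂ} (hS : Integrable S (volume.prod volume)) :
    ∫ x, ∫ y, (V (x - y) : ℂ) * S (x, y)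
      = ∫ k, W k * ∫ p : Space × Space, planeWave k p.1 * planeWave (-k) p.2 * S p
          ∂(volume.prod volume) := by
  have h1 := integral_waveSum_mul hW hS (T := fun p : Space × Space => p.1 - p.2) (by fun_prop)
  simp only [planeWave_sub] at h1
  rw [← h1, integral_prod]
  · refine integral_congr_ae (Eventually.of_forall fun x => integral_congr_ae ?_)
    have hmp := (volume : Measure Space).measurePreserving_sub_left x
    filter_upwards [hmp.quasiMeasurePreserving.ae (potential_eq_waveSum hV hW)] with y hy
    rw [hy]
  · refine hS.bdd_mul (c := ∫ k, ‖W k‖) ?_ (Eventually.of_forall fun p => norm_waveSum_le _)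
    exact ((continuous_waveSum hW).comp (by fun_prop)).aestronglyMeasurable

end Potential

/-! ### Weak integrals of operators -/

/-- `T = ∫ S_k dk` in the sense of matrix elements. -/
def WeakIntegral (T : Op) (S : Space → Op) : Prop :=
  ∀ f g : OneParticle, Integrable (fun k => ⟪f, S k g⟫_ℂ) ∧ ⟪f, T g⟫_ℂ = ∫ k, ⟪f, S k g⟫_ℂ

theorem WeakIntegral.sub {T T' : Op} {S S' : Space → Op} (h : WeakIntegral T S)
    (h' : WeakIntegral T' S') : WeakIntegral (T - T') fun k => S k - S' k := fun f g => by
  simp only [sub_apply, inner_sub_right]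
  exact ⟨(h f g).1.sub (h' f g).1, by rw [integral_sub (h f g).1 (h' f g).1, (h f g).2, (h' f g).2]⟩

theorem WeakIntegral.mul_right {T : Op} {S : Space → Op} (h : WeakIntegral T S) (B : Op) :
    WeakIntegral (T * B) fun k => S k * B := fun f g => h f (B g)

theorem WeakIntegral.mul_left {T : Op} {S : Space → Op} (h : WeakIntegral T S) (B : Op) :
    WeakIntegral (B * T) fun k => B * S k := fun f g => by
  simpa only [op_mul_apply, ContinuousLinearMap.adjoint_inner_left] using
    h (ContinuousLinearMap.adjoint B f) g

theorem WeakIntegral.comm {T : Op} {S : Space → Op} (h : WeakIntegral T S) (B : Op) :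
    WeakIntegral (T * B - B * T) fun k => S k * B - B * S k :=
  (h.mul_right B).sub (h.mul_left B)

/-- The triangle inequality for integrals. Only finite sums of matrix elements are integrated, so no
measurability of k ↦ S k in an operator topology is required. -/
theorem WeakIntegral.trLE {T : Op} {S : Space → Op} (h : WeakIntegral T S) {M : Space → ℝ}
    (hM : Integrable M) (hS : ∀ k, TrLE (S k) (M k)) : TrLE T (∫ k, M k) := by
  intro n f g hf hg
  have : ∑ i, ⟪f i, T (g i)⟫_ℂ = ∫ k, ∑ i, ⟪f i, S k (g i)⟫_ℂ := by
    rw [integral_finsetSum _ fun i _ => (h (f i) (g i)).1]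
    exact Finset.sum_congr rfl fun i _ => (h (f i) (g i)).2
  rw [this]
  exact norm_integral_le_of_norm_le hM (Eventually.of_forall fun k => hS k n f g hf hg)

theorem WeakIntegral.norm_le {T : Op} {S : Space → Op} (h : WeakIntegral T S) {M : Space → ℝ}
    (hM : Integrable M) (hS : ∀ k, ‖S k‖ ≤ M k) : ‖T‖ ≤ ∫ k, M k := by
  have hM0 : ∀ k, 0 ≤ M k := fun k => (norm_nonneg _).trans (hS k)
  have hfg : ∀ f g : OneParticle, ‖⟪f, T g⟫_ℂ‖ ≤ (∫ k, M k) * (‖f‖ * ‖g‖) := by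
    intro f g
    rw [(h f g).2, ← integral_mul_const]
    refine norm_integral_le_of_norm_le (hM.mul_const _) (Eventually.of_forall fun k => ?_)
    refine (norm_inner_le_norm _ _).trans ?_
    have := ((S k).le_opNorm g).trans (mul_le_mul_of_nonneg_right (hS k) (norm_nonneg g))
    nlinarith [norm_nonneg f]
  refine ContinuousLinearMap.opNorm_le_bound _ (integral_nonneg hM0) fun g => ?_
  by_cases hg : T g = 0
  · rw [hg, norm_zero]
    exact mul_nonneg (integral_nonneg hM0) (norm_nonneg _)
  have h1 := hfg (T g) g
  rw [inner_self_eq_norm_sq_to_K, norm_pow, RCLike.norm_ofReal, abs_norm, sq] at h1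
  have h2 : 0 < ‖T g‖ := norm_pos_iff.2 hg
  refine le_of_mul_le_mul_left (h1.trans (le_of_eq ?_)) h2
  ring

/-! ### Fourier representation of the direct and exchange terms -/

theorem tendsto_wave {k : Space} (f : OneParticle) :
    Tendsto (fun l => wave l f) (𝓝 k) (𝓝 (wave k f)) :=
  tendsto_phase (fun x => by
    simp only [linPhase_apply]
    exact (by fun_prop : Continuous fun l : Space => 2 * Real.pi * ⟪l, x⟫_ℝ).tendsto k) f

theorem continuous_wave (f : OneParticle) : Continuous fun k => wave k f :=
  continuous_iff_continuousAt.2 fun _ => tendsto_wave f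

theorem continuous_wave_neg (f : OneParticle) : Continuous fun k => wave (-k) f :=
  (continuous_wave f).comp continuous_neg

theorem norm_wave_apply_le (k : Space) (f : OneParticle) : ‖wave k f‖ ≤ ‖f‖ := by
  simpa using (wave k).le_of_opNorm_le (norm_wave_le k) f

/-- The Fourier transform of the density of `∑ⱼ |aⱼ⟩⟨bⱼ|`. -/
def densityFT (a b : ℕ → OneParticle) (k : Space) : ℂ := ∑' j, ⟪b j, wave (-k) (a j)⟫_ℂ

theorem continuous_densityFT {a b : ℕ → OneParticle} (h : Summable fun j => ‖a j‖ * ‖b j‖) :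
    Continuous (densityFT a b) := by
  refine continuous_tsum (f := fun j k => ⟪b j, wave (-k) (a j)⟫_ℂ) (fun j => ?_) h fun j k => ?_
  · exact Continuous.inner (𝕜 := ℂ) continuous_const (continuous_wave_neg (a j))
  · refine (norm_inner_le_norm _ _).trans ?_
    nlinarith [norm_wave_apply_le (-k) (a j), norm_nonneg (b j)]

theorem norm_densityFT_le {A : Op} {a b : ℕ → OneParticle} (h : IsNuclearExpansion A a b) {M : ℝ}
    (hA : TrLE A M) (k : Space) : ‖densityFT a b k‖ ≤ M :=
  (norm_trace_le h.1 h.2 hA (wave (-k))).trans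
    (mul_le_of_le_one_left hA.nonneg (norm_wave_le _))

theorem inner_wave_eq (k : Space) (f g : OneParticle) :
    ⟪f, wave k g⟫_ℂ = ∫ x, planeWave k x * (g x * conj (f x)) := by
  rw [L2.inner_def]
  refine integral_congr_ae ?_
  filter_upwards [coeFn_phase (linPhase k) g] with x hx
  rw [wave, hx, RCLike.inner_apply, planeWave, mul_assoc]

/-- The convolution V * ρ has Fourier transform V̂ρ̂. Only matrix elements are computed, where
Fubini applies. -/
theorem weakIntegral_direct {V : Space → ℝ} {W : Space → ℂ} (hV : HasFourierTransform V W)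
    (hW : Integrable W) {N : ℕ} {A D : Op} {a b : ℕ → OneParticle}
    (hab : IsNuclearExpansion A a b)
    (hD : ∀ f : OneParticle, (D f : Space → ℂ) =ᵐ[volume] fun x =>
      (∫ y, (V (x - y) : ℂ) * ((N : ℂ)⁻¹ * kernel a b y y)) * f x) :
    WeakIntegral D fun k => (W k * ((N : ℂ)⁻¹ * densityFT a b k)) • wave k := by
  intro f g
  have hρ : Integrable fun y => kernel a b y y := by
    refine integrable_tsum (fun j => integrable_mul_conj (a j) (b j)) ?_
    exact Summable.of_nonneg_of_le (fun j => integral_nonneg fun _ => norm_nonneg _)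
      (fun j => integral_norm_mul_conj_le (a j) (b j)) hab.1
  have hρk : ∀ k, ∫ y, planeWave (-k) y * kernel a b y y = densityFT a b k := by
    intro k
    have h := hasSum_integral_of_summable_integral_norm (μ := (volume : Measure Space))
      (F := fun j y => planeWave (-k) y * (a j y * conj (b j y))) (fun j => ?_) ?_
    · rw [densityFT]
      simp only [inner_wave_eq]
      rw [h.tsum_eq]
      simp only [kernel, tsum_mul_left]
    · refine (integrable_mul_conj (a j) (b j)).bdd_mul (c := 1) ?_ ?_
      · exact (continuous_planeWave_right (-k)).aestronglyMeasurable
      · exact Eventually.of_forall fun y => (norm_planeWave _ _).le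
    · simp only [norm_mul (planeWave _ _), norm_planeWave, one_mul]
      exact Summable.of_nonneg_of_le (fun j => integral_nonneg fun _ => norm_nonneg _)
        (fun j => integral_norm_mul_conj_le (a j) (b j)) hab.1
  simp only [smul_apply, inner_smul_right]
  constructor
  · obtain ⟨M, hM⟩ : ∃ M, TrLE A M := ⟨_, trLE_of_nuclear hab.1 hab.2⟩
    have : Integrable fun k => ((N : ℂ)⁻¹ * densityFT a b k * ⟪f, wave k g⟫_ℂ) * W k := by
      refine hW.bdd_mul (c := ‖(N : ℂ)⁻¹‖ * M * (‖f‖ * ‖g‖)) ?_ (Eventually.of_forall fun k => ?_)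
      · exact ((continuous_const.mul (continuous_densityFT hab.1)).mul
          (continuous_const.inner (continuous_wave g))).aestronglyMeasurable
      · rw [norm_mul, norm_mul]
        have h1 := norm_densityFT_le hab hM k
        have h2 : ‖⟪f, wave k g⟫_ℂ‖ ≤ ‖f‖ * ‖g‖ := (norm_inner_le_norm _ _).trans
          (mul_le_mul_of_nonneg_left (norm_wave_apply_le k g) (norm_nonneg _))
        have hM0 := hM.nonneg
        gcongr
    refine this.congr (Eventually.of_forall fun k => ?_)
    simp only
    ring
  · have hS : Integrable (fun p : Space × Space =>
        (g p.1 * conj (f p.1)) * ((N : ℂ)⁻¹ * kernel a b p.2 p.2)) (volume.prod volume) :=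
      (integrable_mul_conj g f).mul_prod (hρ.const_mul _)
    have h1 := integral_potential_mul hV hW hS
    have h2 : ⟪f, D g⟫_ℂ = ∫ x, ∫ y, (V (x - y) : ℂ) *
        ((g x * conj (f x)) * ((N : ℂ)⁻¹ * kernel a b y y)) := by
      rw [L2.inner_def]
      refine integral_congr_ae ?_
      filter_upwards [hD g] with x hx
      rw [hx, RCLike.inner_apply, mul_assoc, ← integral_mul_const]
      refine integral_congr_ae (Eventually.of_forall fun y => ?_)
      simp only
      ring
    rw [h2, h1]
    refine integral_congr_ae (Eventually.of_forall fun k => ?_)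
    simp only
    have h3 : ∀ p : Space × Space, planeWave k p.1 * planeWave (-k) p.2 *
        ((g p.1 * conj (f p.1)) * ((N : ℂ)⁻¹ * kernel a b p.2 p.2))
        = (planeWave k p.1 * (g p.1 * conj (f p.1))) *
          ((N : ℂ)⁻¹ * (planeWave (-k) p.2 * kernel a b p.2 p.2)) := fun p => by ring
    simp only [h3]
    rw [integral_prod_mul (fun x => planeWave k x * (g x * conj (f x)))
      (fun y => (N : ℂ)⁻¹ * (planeWave (-k) y * kernel a b y y)), integral_const_mul, hρk,
      inner_wave_eq]
    ring

/-- Multiplying a kernel by exp(2πi k·(x − y)) conjugates the operator with a plane wave;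
superposing these with weights V̂(k) multiplies the kernel by V(x − y). -/
theorem weakIntegral_exchange {V : Space → ℝ} {W : Space → ℂ} (hV : HasFourierTransform V W)
    (hW : Integrable W) {N : ℕ} {A X : Op} {a b : ℕ → OneParticle}
    (hab : IsNuclearExpansion A a b)
    (hX : ∀ f : OneParticle, (X f : Space → ℂ) =ᵐ[volume] fun x =>
      ∫ y, ((N : ℂ)⁻¹ * (V (x - y) : ℂ) * kernel a b x y) * f y) :
    WeakIntegral X fun k => (W k * (N : ℂ)⁻¹) • (wave k * A * wave (-k)) := by
  intro f g
  have hin : ∀ k, ⟪f, (wave k * A * wave (-k)) g⟫_ℂ = ⟪wave (-k) f, A (wave (-k) g)⟫_ℂ := by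
    intro k
    rw [op_mul_apply, op_mul_apply, ← ContinuousLinearMap.adjoint_inner_left,
      ← ContinuousLinearMap.star_eq_adjoint, star_wave]
  simp only [smul_apply, inner_smul_right]
  constructor
  · have : Integrable fun k => ((N : ℂ)⁻¹ * ⟪wave (-k) f, A (wave (-k) g)⟫_ℂ) * W k := by
      refine hW.bdd_mul (c := ‖(N : ℂ)⁻¹‖ * (‖f‖ * (‖A‖ * ‖g‖))) ?_
        (Eventually.of_forall fun k => ?_)
      · exact (continuous_const.mul ((continuous_wave_neg f).inner
          (A.continuous.comp (continuous_wave_neg g)))).aestronglyMeasurable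
      · rw [norm_mul]
        have h1 := norm_wave_apply_le (-k) f
        have h2 := norm_wave_apply_le (-k) g
        have h3 := A.le_opNorm (wave (-k) g)
        have h4 := norm_inner_le_norm (𝕜 := ℂ) (wave (-k) f) (A (wave (-k) g))
        have h5 : ‖A (wave (-k) g)‖ ≤ ‖A‖ * ‖g‖ :=
          h3.trans (mul_le_mul_of_nonneg_left h2 (norm_nonneg _))
        refine mul_le_mul_of_nonneg_left (h4.trans ?_) (norm_nonneg _)
        gcongr
    refine this.congr (Eventually.of_forall fun k => ?_)
    simp only
    rw [hin]
    ring
  · set F : ℕ → Space × Space → ℂ := fun j p =>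
      (a j p.1 * conj (f p.1)) * ((N : ℂ)⁻¹ * (g p.2 * conj (b j p.2))) with hF
    have hFi : ∀ j, Integrable (F j) (volume.prod volume) := fun j =>
      (integrable_mul_conj (a j) f).mul_prod ((integrable_mul_conj g (b j)).const_mul _)
    have hFs : Summable fun j => ∫ p, ‖F j p‖ ∂((volume : Measure Space).prod volume) := by
      refine Summable.of_nonneg_of_le (fun j => integral_nonneg fun _ => norm_nonneg _)
        (fun j => ?_) (hab.1.mul_left (‖f‖ * ‖(N : ℂ)⁻¹‖ * ‖g‖))
      simp only [hF, norm_mul (a j _ * _), norm_mul (N : ℂ)⁻¹]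
      rw [integral_prod_mul (fun x => ‖a j x * conj (f x)‖)
        (fun y => ‖(N : ℂ)⁻¹‖ * ‖g y * conj (b j y)‖), integral_const_mul]
      have h1 := integral_norm_mul_conj_le (a j) f
      have h2 := integral_norm_mul_conj_le g (b j)
      have h3 : 0 ≤ ∫ y, ‖g y * conj (b j y)‖ := integral_nonneg fun _ => norm_nonneg _
      calc (∫ x, ‖a j x * conj (f x)‖) * (‖(N : ℂ)⁻¹‖ * ∫ y, ‖g y * conj (b j y)‖)
          ≤ (‖a j‖ * ‖f‖) * (‖(N : ℂ)⁻¹‖ * (‖g‖ * ‖b j‖)) := by gcongr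
        _ = _ := by ring
    have hS : Integrable (fun p => ∑' j, F j p) ((volume : Measure Space).prod volume) :=
      integrable_tsum hFi hFs
    have h1 := integral_potential_mul hV hW hS
    have h2 : ⟪f, X g⟫_ℂ = ∫ x, ∫ y, (V (x - y) : ℂ) * ∑' j, F j (x, y) := by
      rw [L2.inner_def]
      refine integral_congr_ae ?_
      filter_upwards [hX g] with x hx
      rw [hx, RCLike.inner_apply, ← integral_mul_const]
      refine integral_congr_ae (Eventually.of_forall fun y => ?_)
      simp only [hF, kernel]
      have : ∀ j, a j x * conj (f x) * ((N : ℂ)⁻¹ * (g y * conj (b j y)))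
          = (conj (f x) * (N : ℂ)⁻¹ * g y) * (a j x * conj (b j y)) := fun j => by ring
      simp only [this, tsum_mul_left]
      ring
    rw [h2, h1]
    refine integral_congr_ae (Eventually.of_forall fun k => ?_)
    simp only
    rw [mul_assoc]
    congr 1
    have h := hasSum_integral_of_summable_integral_norm
      (μ := (volume : Measure Space).prod volume)
      (F := fun j p => planeWave k p.1 * planeWave (-k) p.2 * F j p) (fun j => ?_) ?_
    · simp only [tsum_mul_left] at h
      rw [← h.tsum_eq, hin]
      have hA := (hab.2 (wave (-k) g)).mapL (innerSL ℂ (wave (-k) f))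
      simp only [innerSL_apply_apply, inner_smul_right] at hA
      rw [← hA.tsum_eq, ← tsum_mul_left]
      refine tsum_congr fun j => ?_
      have h3 : ∀ p : Space × Space, planeWave k p.1 * planeWave (-k) p.2 * F j p
          = (planeWave k p.1 * (a j p.1 * conj (f p.1))) *
            ((N : ℂ)⁻¹ * (planeWave (-k) p.2 * (g p.2 * conj (b j p.2)))) := fun p => by
        simp only [hF]; ring
      simp only [h3]
      rw [integral_prod_mul (fun x => planeWave k x * (a j x * conj (f x)))
        (fun y => (N : ℂ)⁻¹ * (planeWave (-k) y * (g y * conj (b j y)))), integral_const_mul,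
        ← inner_wave_eq, ← inner_wave_eq, ← ContinuousLinearMap.adjoint_inner_left (wave k),
        ← ContinuousLinearMap.star_eq_adjoint, star_wave]
      ring
    · refine (hFi j).bdd_mul (c := 1) ?_ ?_
      · exact ((measurable_planeWave_comp measurable_const measurable_fst).mul
          (measurable_planeWave_comp measurable_const measurable_snd)).aestronglyMeasurable
      · exact Eventually.of_forall fun p => by
          rw [norm_mul, norm_planeWave, norm_planeWave, one_mul]
    · simpa only [norm_mul (_ * _) (F _ _), norm_mul (planeWave _ _), norm_planeWave, one_mul]
        using hFs

/-! ### Differential inequalities in trace norm -/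

/-- Continuity in trace norm. -/
def TrCont (G : ℝ → Op) : Prop := ∀ t : ℝ, ∀ η > 0, ∀ᶠ s in 𝓝 t, TrLE (G s - G t) η

/-- `G` is the derivative of `Ω` in trace norm. -/
def TrDeriv (Ω G : ℝ → Op) : Prop :=
  ∀ t : ℝ, ∀ η > 0, ∀ᶠ s in 𝓝 t, TrLE (Ω s - Ω t - ((s - t : ℝ) : ℂ) • G t) (η * |s - t|)

theorem TrCont.continuous {G : ℝ → Op} (h : TrCont G) : Continuous G := by
  refine continuous_iff_continuousAt.2 fun t => Metric.tendsto_nhds.2 fun η hη => ?_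
  filter_upwards [h t (η / 2) (half_pos hη)] with s hs
  rw [dist_eq_norm]
  exact hs.norm_le.trans_lt (half_lt_self hη)

/-- The linear functional `A ↦ ⟨f, A g⟩`. -/
def matCoeff (f g : OneParticle) : Op →L[ℂ] ℂ :=
  (innerSL ℂ f) ∘L (ContinuousLinearMap.apply ℂ OneParticle g)

@[simp] theorem matCoeff_apply (f g : OneParticle) (A : Op) : matCoeff f g A = ⟪f, A g⟫_ℂ := rfl

/-- The mean value inequality is applied to each functional A ↦ Σᵢ ⟨fᵢ, A gᵢ⟩. The neighbourhood
comes from trace-norm continuity of G and does not depend on the families; this uniformity upgrades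
the operator-norm derivative. -/
theorem trDeriv_of_hasDerivAt {Ω G : ℝ → Op} (hG : TrCont G)
    (h : ∀ t, HasDerivAt Ω (G t) t) : TrDeriv Ω G := by
  intro t η hη
  obtain ⟨ρ, hρ, hb⟩ := Metric.eventually_nhds_iff_ball.1 (hG t η hη)
  filter_upwards [Metric.ball_mem_nhds t hρ] with s hs
  intro n f g hf hg
  set ℓ : Op →L[ℂ] ℂ := ∑ i, matCoeff (f i) (g i) with hℓ
  have hℓa : ∀ A : Op, ℓ A = ∑ i, ⟪f i, A (g i)⟫_ℂ := fun A => by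
    simp [hℓ]
  have hd : ∀ r ∈ Metric.ball t ρ, HasDerivWithinAt
      (fun r : ℝ => ℓ (Ω r - ((r : ℝ) : ℂ) • G t)) (ℓ (G r - G t)) (Metric.ball t ρ) r := by
    intro r _
    have h1 : HasDerivAt (fun r : ℝ => ((r : ℝ) : ℂ) • G t) ((1 : ℂ) • G t) r :=
      (hasDerivAt_id r).ofReal_comp.smul_const (G t)
    rw [one_smul] at h1
    exact ((ℓ.hasFDerivAt.restrictScalars ℝ).comp_hasDerivAt r ((h r).sub h1)).hasDerivWithinAt
  have := (convex_ball t ρ).norm_image_sub_le_of_norm_hasDerivWithin_le (C := η) hd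
    (fun r hr => by rw [hℓa]; exact hb r hr n f g hf hg) (Metric.mem_ball_self hρ) hs
  rw [← map_sub, Real.norm_eq_abs] at this
  rw [← hℓa]
  have e : Ω s - Ω t - ((s - t : ℝ) : ℂ) • G t
      = Ω s - ((s : ℝ) : ℂ) • G t - (Ω t - ((t : ℝ) : ℂ) • G t) := by
    push_cast
    rw [sub_smul]
    abel
  rw [e]
  exact this

/-- One-sided growth control suffices, so norms and suprema of norms need not be differentiable. -/
theorem gronwall_of_eventually_le {f : ℝ → ℝ} {K T : ℝ} (hf : Continuous f)
    (hd : ∀ t ∈ Set.Ico 0 T, ∀ η > 0, ∀ᶠ s in 𝓝[>] t, f s ≤ f t + (s - t) * (K * f t + η)) :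
    ∀ t ∈ Set.Icc 0 T, f t ≤ f 0 * Real.exp (K * t) := by
  intro t ht
  have := le_gronwallBound_of_liminf_deriv_right_le (f := f) (f' := fun t => K * f t) (δ := f 0)
    (K := K) (ε := 0) (a := 0) (b := T) hf.continuousOn (fun x hx r hr => ?_) le_rfl
    (fun x _ => by simp) t ht
  · rwa [gronwallBound_ε0, sub_zero] at this
  · refine Eventually.frequently ?_
    filter_upwards [hd x hx ((r - K * f x) / 2) (by linarith), self_mem_nhdsWithin] with s hs hsx
    have hsx : x < s := hsx
    rw [inv_mul_lt_iff₀ (by linarith)]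
    nlinarith

/-- For self-adjoint H the first-order terms of (1 + irH)*(1 + irH) cancel, leaving 1 + r²H². -/
theorem norm_one_add_le {H : Op} (hH : IsSelfAdjoint H) (r : ℝ) :
    ‖1 + (Complex.I * r) • H‖ ^ 2 ≤ 1 + r ^ 2 * ‖H‖ ^ 2 := by
  have h1 : star (1 + (Complex.I * r) • H) * (1 + (Complex.I * r) • H)
      = 1 + ((r ^ 2 : ℝ) : ℂ) • (H * H) := by
    rw [star_add, star_one, star_smul, hH.star_eq]
    simp only [RCLike.star_def, map_mul, Complex.conj_I, Complex.conj_ofReal, add_mul, mul_add,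
      one_mul, mul_one, smul_mul_assoc, mul_smul_comm, smul_add, smul_smul]
    have : Complex.I * r * (-Complex.I * r) = ((r ^ 2 : ℝ) : ℂ) := by
      push_cast; linear_combination (-(r : ℂ) ^ 2) * Complex.I_sq
    rw [this]
    module
  rw [sq, ← CStarRing.norm_star_mul_self, h1]
  refine (norm_add_le _ _).trans (add_le_add ?_ ?_)
  · exact ContinuousLinearMap.norm_id_le
  · rw [norm_smul, Complex.norm_real, Real.norm_of_nonneg (sq_nonneg r), sq ‖H‖]
    exact mul_le_mul_of_nonneg_left (norm_mul_le _ _) (sq_nonneg r)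

/-- An Euler step of the flow generated by [H, ·] is conjugation with 1 + irH up to second order: a
discrete form of unitary invariance, with no propagator to construct. -/
theorem add_comm_smul_eq (H Y : Op) (r : ℝ) :
    Y + (Complex.I * r) • (H * Y - Y * H)
      = (1 + (Complex.I * r) • H) * Y * (1 + (Complex.I * (-r : ℝ)) • H)
        - ((r ^ 2 : ℝ) : ℂ) • (H * Y * H) := by
  simp only [add_mul, mul_add, one_mul, mul_one, smul_mul_assoc, mul_smul_comm, smul_add, smul_smul]
  have : Complex.I * ((-r : ℝ) : ℂ) * (Complex.I * r) = ((r ^ 2 : ℝ) : ℂ) := by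
    push_cast; linear_combination (-(r : ℂ) ^ 2) * Complex.I_sq
  rw [this]
  push_cast
  module

theorem norm_one_add_mul_le {H : Op} (hH : IsSelfAdjoint H) (r : ℝ) :
    ‖1 + (Complex.I * r) • H‖ * ‖1 + (Complex.I * (-r : ℝ)) • H‖ ≤ 1 + r ^ 2 * ‖H‖ ^ 2 := by
  have h1 := norm_one_add_le hH r
  have h2 := norm_one_add_le hH (-r)
  rw [neg_sq] at h2
  nlinarith [sq_nonneg (‖1 + (Complex.I * r) • H‖ - ‖1 + (Complex.I * (-r : ℝ)) • H‖)]

theorem TrLE.add_comm_smul {H Y : Op} (hH : IsSelfAdjoint H) {M : ℝ} (hY : TrLE Y M) (r : ℝ) :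
    TrLE (Y + (Complex.I * r) • (H * Y - Y * H)) ((1 + 2 * r ^ 2 * ‖H‖ ^ 2) * M) := by
  rw [add_comm_smul_eq]
  have h1 := ((hY.mul_left (1 + (Complex.I * r) • H)).mul_right (1 + (Complex.I * (-r : ℝ)) • H)).sub
    (((hY.mul_left H).mul_right H).smul ((r ^ 2 : ℝ) : ℂ))
  refine h1.mono ?_
  rw [Complex.norm_real, Real.norm_of_nonneg (sq_nonneg r)]
  have := mul_le_mul_of_nonneg_right (norm_one_add_mul_le hH r) hY.nonneg
  nlinarith

theorem norm_add_comm_smul_le {H : Op} (Y : Op) (hH : IsSelfAdjoint H) (r : ℝ) :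
    ‖Y + (Complex.I * r) • (H * Y - Y * H)‖ ≤ (1 + 2 * r ^ 2 * ‖H‖ ^ 2) * ‖Y‖ := by
  rw [add_comm_smul_eq]
  have h0 : ‖(1 + (Complex.I * r) • H) * Y * (1 + (Complex.I * (-r : ℝ)) • H)‖
      ≤ ‖1 + (Complex.I * r) • H‖ * ‖Y‖ * ‖1 + (Complex.I * (-r : ℝ)) • H‖ :=
    (norm_mul_le _ _).trans (mul_le_mul_of_nonneg_right (norm_mul_le _ _) (norm_nonneg _))
  have h1 : ‖H * Y * H‖ ≤ ‖H‖ * ‖Y‖ * ‖H‖ :=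
    (norm_mul_le _ _).trans (mul_le_mul_of_nonneg_right (norm_mul_le _ _) (norm_nonneg _))
  refine (norm_sub_le _ _).trans ?_
  rw [norm_smul, Complex.norm_real, Real.norm_of_nonneg (sq_nonneg r)]
  have h2 := mul_le_mul_of_nonneg_right (norm_one_add_mul_le hH r) (norm_nonneg Y)
  have h3 := mul_le_mul_of_nonneg_left h1 (sq_nonneg r)
  nlinarith

/-- `Ω` solves `Ω' = i r [H, Ω]` in trace norm, where the operators `H t` are bounded and
self-adjoint. -/
structure TrEvolution (Ω H : ℝ → Op) (r : ℝ) : Prop where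
  selfAdjoint : ∀ t, IsSelfAdjoint (H t)
  trClass : ∀ t, ∃ M, TrLE (Ω t) M
  deriv : TrDeriv Ω fun t => (Complex.I * r) • (H t * Ω t - Ω t * H t)

section Evolution

variable {Ω H : ℝ → Op} {r : ℝ}

theorem TrDeriv.continuous_tn {G : ℝ → Op} (h : TrDeriv Ω G) (hG : ∀ t, ∃ M, TrLE (G t) M) (t : ℝ)
    {η : ℝ} (hη : 0 < η) : ∀ᶠ s in 𝓝 t, TrLE (Ω s - Ω t) η := by
  obtain ⟨M, hM⟩ := hG t
  have hM0 := hM.nonneg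
  have h1 := h t 1 one_pos
  have h2 : ∀ᶠ s in 𝓝 t, |s - t| < η / (M + 1) := by
    have := Metric.ball_mem_nhds t (show 0 < η / (M + 1) by positivity)
    filter_upwards [this] with s hs
    rwa [Metric.mem_ball, Real.dist_eq] at hs
  filter_upwards [h1, h2] with s hs hs2
  have h3 := hs.add (hM.smul ((s - t : ℝ) : ℂ))
  rw [sub_add_cancel, Complex.norm_real, Real.norm_eq_abs] at h3
  refine h3.mono ?_
  rw [lt_div_iff₀ (by positivity)] at hs2
  linarith

theorem TrEvolution.trLE_deriv (h : TrEvolution Ω H r) (t : ℝ) :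
    ∃ M, TrLE ((Complex.I * r) • (H t * Ω t - Ω t * H t)) M := by
  obtain ⟨M, hM⟩ := h.trClass t
  exact ⟨_, ((hM.mul_left _).sub (hM.mul_right _)).smul _⟩

theorem TrEvolution.trCont (h : TrEvolution Ω H r) : TrCont Ω := fun t _ hη =>
  h.deriv.continuous_tn h.trLE_deriv t hη

theorem eventually_sq_le (t c : ℝ) {η : ℝ} (hη : 0 < η) :
    ∀ᶠ s in 𝓝[>] t, t < s ∧ |s - t| = s - t ∧ (s - t) * c ≤ η := by
  have h2 : Tendsto (fun s => (s - t) * c) (𝓝[>] t) (𝓝 0) := by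
    have : Tendsto (fun s => (s - t) * c) (𝓝 t) (𝓝 ((t - t) * c)) :=
      (by fun_prop : Continuous fun s => (s - t) * c).tendsto t
    rw [sub_self, zero_mul] at this
    exact this.mono_left nhdsWithin_le_nhds
  filter_upwards [self_mem_nhdsWithin, h2.eventually_lt_const hη] with s hs hs2
  exact ⟨hs, abs_of_pos (sub_pos.2 hs), hs2.le⟩

theorem continuous_of_abs_sub_le {f : ℝ → ℝ} {C : ℝ} (hC : 0 < C) (hΩ : TrCont Ω)
    (h : ∀ s t η, TrLE (Ω s - Ω t) η → |f s - f t| ≤ C * η) : Continuous f := by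
  refine continuous_iff_continuousAt.2 fun t => Metric.tendsto_nhds.2 fun η hη => ?_
  filter_upwards [hΩ t (η / (2 * C)) (by positivity)] with s hs
  rw [Real.dist_eq]
  refine (h s t _ hs).trans_lt ?_
  have : C * (η / (2 * C)) = η / 2 := by field_simp
  rw [this]
  exact half_lt_self hη

theorem tn_sub_abs_le {A B : Op} {M M' η : ℝ} (hA : TrLE A M) (hB : TrLE B M')
    (h : TrLE (A - B) η) : |tn A - tn B| ≤ η := by
  have h1 : tn A ≤ η + tn B := by
    have := (h.add hB.trLE_tn).tn_le
    rwa [sub_add_cancel] at this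
  have h2 : tn B ≤ η + tn A := by
    have := (h.neg.add hA.trLE_tn).tn_le
    rwa [neg_sub, sub_add_cancel] at this
  rw [abs_le]; constructor <;> linarith

theorem TrEvolution.step (h : TrEvolution Ω H r) (t : ℝ) {η : ℝ} (hη : 0 < η) :
    ∀ᶠ s in 𝓝[>] t, TrLE (Ω s - (Ω t + (Complex.I * ((s - t) * r : ℝ)) •
      (H t * Ω t - Ω t * H t))) (η * (s - t)) := by
  filter_upwards [(h.deriv t η hη).filter_mono nhdsWithin_le_nhds, self_mem_nhdsWithin]
    with s hs hst
  rw [abs_of_pos (sub_pos.2 hst)] at hs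
  convert hs using 1
  rw [smul_smul, sub_sub]
  congr 3
  push_cast; ring

/-- An Euler step increases the trace norm only at second order, so Gronwall applies with rate zero.
-/
theorem TrEvolution.tn_le (h : TrEvolution Ω H r) {M : ℝ} (h0 : TrLE (Ω 0) M) {t : ℝ}
    (ht : 0 ≤ t) : TrLE (Ω t) M := by
  have hc : Continuous fun t => tn (Ω t) := by
    refine continuous_of_abs_sub_le one_pos h.trCont fun s t η hst => ?_
    obtain ⟨M, hM⟩ := h.trClass s
    obtain ⟨M', hM'⟩ := h.trClass t
    rw [one_mul]
    exact tn_sub_abs_le hM hM' hst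
  have := gronwall_of_eventually_le (K := 0) (T := t) hc (fun t _ η hη => ?_) t ⟨ht, le_rfl⟩
  · obtain ⟨M', hM'⟩ := h.trClass t
    refine hM'.trLE_tn.mono (this.trans ?_)
    simpa using h0.tn_le
  · obtain ⟨M, hM⟩ := h.trClass t
    have hM0 := tn_nonneg (Ω t)
    filter_upwards [h.step t (half_pos hη),
      eventually_sq_le t (2 * r ^ 2 * ‖H t‖ ^ 2 * tn (Ω t)) (half_pos hη)] with s hs ⟨h1, _, h3⟩
    have h4 := hs.add (hM.trLE_tn.add_comm_smul (h.selfAdjoint t) ((s - t) * r))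
    rw [sub_add_cancel] at h4
    refine h4.tn_le.trans ?_
    have h5 := mul_le_mul_of_nonneg_left h3 (sub_nonneg.2 h1.le)
    nlinarith

theorem TrEvolution.norm_le (h : TrEvolution Ω H r) {M : ℝ} (h0 : ‖Ω 0‖ ≤ M) {t : ℝ}
    (ht : 0 ≤ t) : ‖Ω t‖ ≤ M := by
  have hc : Continuous fun t => ‖Ω t‖ := h.trCont.continuous.norm
  have := gronwall_of_eventually_le (K := 0) (T := t) hc (fun t _ η hη => ?_) t ⟨ht, le_rfl⟩
  · refine this.trans ?_
    simpa using h0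
  · filter_upwards [h.step t (half_pos hη),
      eventually_sq_le t (2 * r ^ 2 * ‖H t‖ ^ 2 * ‖Ω t‖) (half_pos hη)] with s hs ⟨h1, _, h3⟩
    have h4 := hs.norm_le
    have h6 := norm_add_comm_smul_le (Ω t) (h.selfAdjoint t) ((s - t) * r)
    have h7 : ‖Ω s‖ ≤ η / 2 * (s - t) + (1 + 2 * ((s - t) * r) ^ 2 * ‖H t‖ ^ 2) * ‖Ω t‖ := by
      refine le_trans ?_ (add_le_add h4 h6)
      refine le_trans (le_of_eq ?_) (norm_add_le _ _)
      rw [sub_add_cancel]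
    have h5 := mul_le_mul_of_nonneg_left h3 (sub_nonneg.2 h1.le)
    nlinarith

/-- The Jacobi identity. The first summand is again a commutator with H and is harmless for the
trace norm; the second is the source of growth. -/
theorem comm_jacobi (W H Y : Op) (z : ℂ) :
    W * (z • (H * Y - Y * H)) - (z • (H * Y - Y * H)) * W
      = z • (H * (W * Y - Y * W) - (W * Y - Y * W) * H)
        + z • ((W * H - H * W) * Y - Y * (W * H - H * W)) := by
  rw [mul_smul_comm, smul_mul_assoc, ← smul_sub, ← smul_add]
  congr 1
  noncomm_ring

theorem TrLE.comm {W A : Op} {M : ℝ} (hA : TrLE A M) (hW : ‖W‖ ≤ 1) :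
    TrLE (W * A - A * W) (2 * M) := by
  refine ((hA.mul_left W).sub (hA.mul_right W)).mono ?_
  have := hA.nonneg
  nlinarith

/-- Growth of commutators of an evolution with a family of contractions. -/
theorem TrEvolution.commutator_gronwall (h : TrEvolution Ω H r) {ι : Type*} [Nonempty ι]
    {W : ι → Op} (hW : ∀ z, ‖W z‖ ≤ 1) {w : ι → ℝ} {δ : ℝ} (hδ : 0 < δ) (hw : ∀ z, δ ≤ w z)
    {C T : ℝ}
    (hQ : ∀ t ∈ Set.Ico 0 T, ∀ m, (∀ z, TrLE (W z * Ω t - Ω t * W z) (m * w z)) →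
      ∀ z, TrLE ((r : ℂ) • ((W z * H t - H t * W z) * Ω t - Ω t * (W z * H t - H t * W z)))
        (C * m * w z))
    {m₀ : ℝ} (h0 : ∀ z, TrLE (W z * Ω 0 - Ω 0 * W z) (m₀ * w z)) {t : ℝ} (ht : t ∈ Set.Icc 0 T)
    (z : ι) : TrLE (W z * Ω t - Ω t * W z) (m₀ * Real.exp (C * t) * w z) := by
  have hw0 : ∀ z, 0 < w z := fun z => hδ.trans_le (hw z)
  -- The lower bound δ on the weights makes the supremum over z finite and the errors of size o(s −
  -- t) uniform in z.
  set q : ℝ → ι → ℝ := fun t z => tn (W z * Ω t - Ω t * W z) / w z with hq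
  have hqb : ∀ t, BddAbove (Set.range (q t)) := by
    intro t
    obtain ⟨M, hM⟩ := h.trClass t
    refine ⟨2 * M / δ, ?_⟩
    rintro _ ⟨z, rfl⟩
    have h1 := (hM.comm (hW z)).tn_le
    have h2 := (hM.comm (hW z)).nonneg
    exact div_le_div₀ h2 h1 hδ (hw z)
  have hcl : ∀ t z, TrLE (W z * Ω t - Ω t * W z) (tn (W z * Ω t - Ω t * W z)) := fun t z => by
    obtain ⟨M, hM⟩ := h.trClass t
    exact (hM.comm (hW z)).trLE_tn
  set m : ℝ → ℝ := fun t => ⨆ z, q t z with hm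
  have hmle : ∀ t z, TrLE (W z * Ω t - Ω t * W z) (m t * w z) := fun t z => by
    refine (hcl t z).mono ?_
    rw [← div_le_iff₀ (hw0 z)]
    exact le_ciSup (hqb t) z
  have hm0 : ∀ t, 0 ≤ m t := fun t => by
    have z := Classical.arbitrary ι
    have := (hmle t z).nonneg
    exact nonneg_of_mul_nonneg_left this (hw0 z)
  have hmsup : ∀ t c, (∀ z, TrLE (W z * Ω t - Ω t * W z) (c * w z)) → m t ≤ c := fun t c hc => by
    refine ciSup_le fun z => ?_
    rw [hq]
    simp only
    rw [div_le_iff₀ (hw0 z)]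
    exact (hc z).tn_le
  have hstep : ∀ s t η, TrLE (Ω s - Ω t) η → m s ≤ m t + 2 / δ * η := by
    intro s t η hst
    refine hmsup _ _ fun z => ?_
    have h1 := (hmle t z).add (hst.comm (hW z))
    have h2 : W z * Ω t - Ω t * W z + (W z * (Ω s - Ω t) - (Ω s - Ω t) * W z)
        = W z * Ω s - Ω s * W z := by noncomm_ring
    rw [h2] at h1
    refine h1.mono ?_
    have h3 : 2 * η ≤ 2 / δ * η * w z := by
      have := mul_le_mul_of_nonneg_left (hw z) (show 0 ≤ 2 / δ * η by
        have := hst.nonneg; positivity)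
      refine le_trans (le_of_eq ?_) this
      field_simp
    linarith
  have hmc : Continuous m := by
    refine continuous_of_abs_sub_le (C := 2 / δ) (by positivity) h.trCont fun s t η hst => ?_
    have h1 := hstep s t η hst
    have h2 := hstep t s η (by simpa using hst.neg)
    rw [abs_le]; constructor <;> linarith
  have key := gronwall_of_eventually_le (K := C) (T := T) hmc (fun t ht η hη => ?_) t ht
  · refine (hmle t z).mono (mul_le_mul_of_nonneg_right (key.trans ?_) (hw0 z).le)
    exact mul_le_mul_of_nonneg_right (hmsup 0 m₀ h0) (Real.exp_nonneg _)
  -- Taking a commutator doubles the error ηδ/4, and the weights are at least δ, so this uses half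
  -- of η. The other half absorbs the second-order part of the Euler step.
  · filter_upwards [h.step t (show 0 < η * δ / 4 by positivity),
      eventually_sq_le t (2 * r ^ 2 * ‖H t‖ ^ 2 * m t) (half_pos hη)] with s hs ⟨h1, _, h3⟩
    refine hmsup _ _ fun z => ?_
    have e1 := (hmle t z).add_comm_smul (h.selfAdjoint t) ((s - t) * r)
    have e2 := (hQ t ht (m t) (hmle t) z).smul (Complex.I * (s - t : ℝ))
    have e3 := (e1.add e2).add (hs.comm (hW z))
    have e4 : (W z * Ω t - Ω t * W z + (Complex.I * ((s - t) * r : ℝ)) •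
          (H t * (W z * Ω t - Ω t * W z) - (W z * Ω t - Ω t * W z) * H t)
        + (Complex.I * (s - t : ℝ)) • ((r : ℂ) •
          ((W z * H t - H t * W z) * Ω t - Ω t * (W z * H t - H t * W z))))
        = W z * (Ω t + (Complex.I * ((s - t) * r : ℝ)) • (H t * Ω t - Ω t * H t))
          - (Ω t + (Complex.I * ((s - t) * r : ℝ)) • (H t * Ω t - Ω t * H t)) * W z := by
      have := comm_jacobi (W z) (H t) (Ω t) (Complex.I * ((s - t) * r : ℝ))
      have e : Complex.I * ((s - t : ℝ) : ℂ) * r = Complex.I * ((s - t) * r : ℝ) := by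
        push_cast; ring
      rw [mul_add (W z), add_mul, add_sub_add_comm, this, smul_smul, add_assoc, e]
    rw [e4] at e3
    have e5 : W z * (Ω t + (Complex.I * ((s - t) * r : ℝ)) • (H t * Ω t - Ω t * H t))
          - (Ω t + (Complex.I * ((s - t) * r : ℝ)) • (H t * Ω t - Ω t * H t)) * W z
        + (W z * (Ω s - (Ω t + (Complex.I * ((s - t) * r : ℝ)) • (H t * Ω t - Ω t * H t)))
          - (Ω s - (Ω t + (Complex.I * ((s - t) * r : ℝ)) • (H t * Ω t - Ω t * H t))) * W z)
        = W z * Ω s - Ω s * W z := by noncomm_ring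
    rw [e5] at e3
    refine e3.mono ?_
    rw [norm_mul, Complex.norm_I, one_mul, Complex.norm_real, Real.norm_of_nonneg (by linarith)]
    have hw1 := hw z
    have hst : 0 < s - t := by linarith
    have f1 : (s - t) * ((s - t) * (2 * r ^ 2 * ‖H t‖ ^ 2 * m t)) * w z
        ≤ (s - t) * (η / 2) * w z :=
      mul_le_mul_of_nonneg_right (mul_le_mul_of_nonneg_left h3 hst.le) (hw0 z).le
    have f2 : 2 * (η * δ / 4 * (s - t)) ≤ (s - t) * (η / 2) * w z := by
      have := mul_le_mul_of_nonneg_left hw1 (show 0 ≤ (s - t) * (η / 2) by positivity)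
      nlinarith
    nlinarith

end Evolution

/-! ### The interaction picture -/

/-- A weak solution of `ω' = -i κ [-ε² Δ + B, ω]` with bounded operators `B t`. -/
structure WeakEvolution (κ ε : ℝ) (ω B : ℝ → Op) : Prop where
  selfAdjoint : ∀ t, IsSelfAdjoint (ω t)
  nuclear : ∀ t, ∃ a b, IsNuclearExpansion (ω t) a b
  trCont : TrCont ω
  continuous : Continuous B
  deriv : ∀ (t : ℝ) (φ ψ : 𝓢(Space, ℂ)),
    HasDerivAt (fun s => ⟪φ.toLp 2 volume, ω s (ψ.toLp 2 volume)⟫_ℂ)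
      (-(Complex.I * κ) * (⟪(-((ε : ℂ) ^ 2 • Δ φ)).toLp 2 volume, ω t (ψ.toLp 2 volume)⟫_ℂ
          - ⟪φ.toLp 2 volume, ω t ((-((ε : ℂ) ^ 2 • Δ ψ)).toLp 2 volume)⟫_ℂ
          + ⟪φ.toLp 2 volume, (B t * ω t - ω t * B t) (ψ.toLp 2 volume)⟫_ℂ)) t

/-- A product rule when ω is differentiable only between fixed vectors. The difference quotient
splits into slopes of u, of v and of the matrix element at u t, v t; norm continuity of ω passes the
first two to the limit. -/
theorem hasDerivAt_inner_apply {u v : ℝ → OneParticle} {ω : ℝ → Op} {t : ℝ} {u' v' : OneParticle}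
    {q : ℂ} (hu : HasDerivAt u u' t) (hv : HasDerivAt v v' t) (hω : ContinuousAt ω t)
    (hq : HasDerivAt (fun s => ⟪u t, ω s (v t)⟫_ℂ) q t) :
    HasDerivAt (fun s => ⟪u s, ω s (v s)⟫_ℂ) (⟪u', ω t (v t)⟫_ℂ + ⟪u t, ω t v'⟫_ℂ + q) t := by
  rw [hasDerivAt_iff_tendsto_slope] at *
  have hω' : Tendsto ω (𝓝[≠] t) (𝓝 (ω t)) := hω.tendsto.mono_left nhdsWithin_le_nhds
  have hvt : Tendsto v (𝓝[≠] t) (𝓝 (v t)) := by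
    have := (hasDerivAt_iff_tendsto_slope.2 hv).continuousAt
    exact this.tendsto.mono_left nhdsWithin_le_nhds
  have h1 : Tendsto (fun s => ⟪slope u t s, ω s (v s)⟫_ℂ) (𝓝[≠] t) (𝓝 ⟪u', ω t (v t)⟫_ℂ) :=
    hu.inner ((isBoundedBilinearMap_apply.continuous.tendsto (ω t, v t)).comp (hω'.prodMk_nhds hvt))
  have h2 : Tendsto (fun s => ⟪u t, ω s (slope v t s)⟫_ℂ) (𝓝[≠] t) (𝓝 ⟪u t, ω t v'⟫_ℂ) :=
    tendsto_const_nhds.inner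
      ((isBoundedBilinearMap_apply.continuous.tendsto (ω t, v')).comp (hω'.prodMk_nhds hv))
  refine ((h1.add h2).add hq).congr fun s => ?_
  simp only [slope, vsub_eq_sub]
  rw [inner_smul_left_eq_smul, (ω s).map_smul_of_tower, inner_smul_right_eq_smul, ← smul_add,
    ← smul_add, map_sub, inner_sub_left, inner_sub_right]
  congr 1
  ring

/-- Strong convergence becomes trace-norm convergence next to a trace class operator, by dominated
convergence in its expansion. The free evolution is used here only through its strong continuity. -/
theorem nuclear_tendsto {A : Op} {a b : ℕ → OneParticle} (h : IsNuclearExpansion A a b) (L : Op)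
    {X : ℝ → Op} {t : ℝ} (hX : ∀ f, Tendsto (fun s => X s f) (𝓝 t) (𝓝 (X t f)))
    (hb : ∀ s, ‖X s‖ ≤ 1) {η : ℝ} (hη : 0 < η) :
    ∀ᶠ s in 𝓝 t, TrLE ((X s - X t) * (L * A)) η := by
  have hdiff : ∀ s f, ‖(X s - X t) f‖ ≤ 2 * ‖f‖ := fun s f => by
    rw [sub_apply]
    have h1 := (X s).le_of_opNorm_le (hb s) f
    have h2 := (X t).le_of_opNorm_le (hb t) f
    linarith [norm_sub_le (X s f) (X t f)]
  have hbd : ∀ s j, ‖(X s - X t) (L (a j))‖ * ‖b j‖ ≤ 2 * ‖L‖ * (‖a j‖ * ‖b j‖) := fun s j => by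
    have h1 := (hdiff s (L (a j))).trans (mul_le_mul_of_nonneg_left (L.le_opNorm (a j)) zero_le_two)
    nlinarith [norm_nonneg (b j)]
  have hsum : Summable fun j => 2 * ‖L‖ * (‖a j‖ * ‖b j‖) := h.1.mul_left _
  have hs : ∀ s, Summable fun j => ‖(X s - X t) (L (a j))‖ * ‖b j‖ := fun s =>
    Summable.of_nonneg_of_le (fun _ => by positivity) (hbd s) hsum
  have htr : ∀ s, TrLE ((X s - X t) * (L * A)) (∑' j, ‖(X s - X t) (L (a j))‖ * ‖b j‖) := fun s => by
    refine trLE_of_nuclear (hs s) fun f => ?_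
    have := (h.2 f).mapL ((X s - X t) * L)
    simpa [op_mul_apply] using this
  have hlim : Tendsto (fun s => ∑' j, ‖(X s - X t) (L (a j))‖ * ‖b j‖) (𝓝 t) (𝓝 (∑' _ : ℕ, 0)) := by
    refine tendsto_tsum_of_dominated_convergence hsum (fun j => ?_)
      (Eventually.of_forall fun s j => ?_)
    · have h1 : Tendsto (fun s => (X s - X t) (L (a j))) (𝓝 t) (𝓝 0) := by
        simp only [sub_apply]
        exact tendsto_sub_nhds_zero_iff.2 (hX _)
      simpa using h1.norm.mul_const ‖b j‖
    · rw [Real.norm_of_nonneg (by positivity)]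
      exact hbd s j
  rw [tsum_zero] at hlim
  filter_upwards [hlim.eventually_lt_const hη] with s hs2 using (htr s).mono hs2.le

theorem tendsto_free {c t : ℝ} (f : OneParticle) :
    Tendsto (fun s => free (c * s) f) (𝓝 t) (𝓝 (free (c * t) f)) := by
  have h1 : Tendsto (fun s => phase ((c * s) • normSq) (fourierL2 f)) (𝓝 t)
      (𝓝 (phase ((c * t) • normSq) (fourierL2 f))) :=
    tendsto_phase (fun x => by
      simp only [ContinuousMap.smul_apply, smul_eq_mul]
      exact (by fun_prop : Continuous fun s => c * s * normSq x).tendsto t) _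
  exact (fourierL2.symm.continuous.tendsto _).comp h1

/-- `A` in the frame moving with the free evolution. -/
def frame (c : ℝ) (A : ℝ → Op) (t : ℝ) : Op := free (-(c * t)) * A t * free (c * t)

theorem frame_mul (c : ℝ) (A B : ℝ → Op) (t : ℝ) :
    frame c A t * frame c B t = frame c (fun t => A t * B t) t := by
  simp only [frame]
  have := free_mul_neg (c * t)
  calc free (-(c * t)) * A t * free (c * t) * (free (-(c * t)) * B t * free (c * t))
      = free (-(c * t)) * A t * (free (c * t) * free (-(c * t))) * B t * free (c * t) := by
        noncomm_ring
    _ = _ := by rw [this, mul_one]; noncomm_ring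

theorem star_frame (c : ℝ) (A : ℝ → Op) (t : ℝ) :
    star (frame c A t) = frame c (fun t => star (A t)) t := by
  simp only [frame, star_mul, star_free, neg_neg, mul_assoc]

theorem TrLE.frame {A : ℝ → Op} {t M : ℝ} (h : TrLE (A t) M) (c : ℝ) :
    TrLE (frame c A t) M := by
  refine ((h.mul_left (free (-(c * t)))).mul_right (free (c * t))).mono ?_
  have h1 := norm_free_le (-(c * t))
  have h2 := norm_free_le (c * t)
  have h3 := h.nonneg
  calc ‖free (-(c * t))‖ * M * ‖free (c * t)‖ ≤ 1 * M * 1 := by gcongr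
    _ = M := by ring

/-- The right factor `free (c * s)` is treated by passing to adjoints, hence the second hypothesis
on `star (K t)`. -/
theorem trCont_frame {c : ℝ} {K : ℝ → Op} (hK : TrCont K)
    (h1 : ∀ t, ∀ η > 0, ∀ᶠ s in 𝓝 t, TrLE ((free (-(c * s)) - free (-(c * t))) * K t) η)
    (h2 : ∀ t, ∀ η > 0, ∀ᶠ s in 𝓝 t, TrLE ((free (-(c * s)) - free (-(c * t))) * star (K t)) η) :
    TrCont (frame c K) := by
  intro t η hη
  filter_upwards [hK t (η / 3) (by linarith), h1 t (η / 3) (by linarith),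
    h2 t (η / 3) (by linarith)] with s a1 a2 a3
  have e1 := (a1.mul_left (free (-(c * s)))).mul_right (free (c * s))
  have e2 := a2.mul_right (free (c * s))
  have e3 := (a3.adjoint).mul_left (free (-(c * t)))
  rw [star_mul, star_star, star_sub, star_free, star_free, neg_neg, neg_neg] at e3
  have := (e1.add e2).add e3
  have e : free (-(c * s)) * (K s - K t) * free (c * s)
        + (free (-(c * s)) - free (-(c * t))) * K t * free (c * s)
        + free (-(c * t)) * (K t * (free (c * s) - free (c * t)))
      = frame c K s - frame c K t := by
    simp only [frame]; noncomm_ring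
  rw [e] at this
  refine this.mono ?_
  have f1 := norm_free_le (-(c * s))
  have f2 := norm_free_le (c * s)
  have f3 := norm_free_le (-(c * t))
  calc ‖free (-(c * s))‖ * (η / 3) * ‖free (c * s)‖ + η / 3 * ‖free (c * s)‖
        + ‖free (-(c * t))‖ * (η / 3) ≤ 1 * (η / 3) * 1 + η / 3 * 1 + 1 * (η / 3) := by gcongr
    _ = η := by ring

/-- Integrating the matrix elements and using density of Schwartz functions gives Ω s = Ω t + ∫ G.
The integral converges in norm, so the fundamental theorem of calculus yields a norm derivative. -/
theorem hasDerivAt_of_schwartz {Ω G : ℝ → Op} (hG : Continuous G)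
    (h : ∀ (r : ℝ) (φ ψ : 𝓢(Space, ℂ)),
      HasDerivAt (fun s => ⟪φ.toLp 2 volume, Ω s (ψ.toLp 2 volume)⟫_ℂ)
        ⟪φ.toLp 2 volume, G r (ψ.toLp 2 volume)⟫_ℂ r) (t : ℝ) :
    HasDerivAt Ω (G t) t := by
  have hint : ∀ s, Ω s = Ω t + ∫ r in t..s, G r := by
    intro s
    have hz : ∀ φ ψ : 𝓢(Space, ℂ), ⟪φ.toLp 2 volume,
        (Ω s - Ω t - ∫ r in t..s, G r) (ψ.toLp 2 volume)⟫_ℂ = 0 := by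
      intro φ ψ
      have h1 := (matCoeff (φ.toLp 2) (ψ.toLp 2)).intervalIntegral_comp_comm
        (hG.intervalIntegrable (μ := volume) t s)
      have hc : Continuous fun r => ⟪φ.toLp 2 volume, G r (ψ.toLp 2 volume)⟫_ℂ := by fun_prop
      have h2 := intervalIntegral.integral_eq_sub_of_hasDerivAt (a := t) (b := s)
        (fun r _ => h r φ ψ) (hc.intervalIntegrable t s)
      have h3 : ⟪φ.toLp 2 volume, (∫ r in t..s, G r) (ψ.toLp 2 volume)⟫_ℂ
          = ⟪φ.toLp 2 volume, Ω s (ψ.toLp 2 volume)⟫_ℂ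
            - ⟪φ.toLp 2 volume, Ω t (ψ.toLp 2 volume)⟫_ℂ :=
        h1.symm.trans h2
      rw [sub_apply, sub_apply, inner_sub_right, inner_sub_right, h3]
      ring
    have hR0 : Ω s - Ω t - ∫ r in t..s, G r = 0 := by
      generalize Ω s - Ω t - ∫ r in t..s, G r = R at hz
      have hz2 : ∀ (φ : 𝓢(Space, ℂ)) (g : OneParticle), ⟪φ.toLp 2 volume, R g⟫_ℂ = 0 := fun φ g =>
        congrFun (denseRange_toLp.equalizer (g := fun g => ⟪(φ.toLp 2 volume : OneParticle), R g⟫_ℂ)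
          (h := fun _ => 0) (by fun_prop) continuous_const (funext fun ψ => hz φ ψ)) g
      have hz3 : ∀ f g : OneParticle, ⟪f, R g⟫_ℂ = 0 := fun f g =>
        congrFun (denseRange_toLp.equalizer (g := fun f => ⟪f, R g⟫_ℂ)
          (h := fun _ => 0) (by fun_prop) continuous_const (funext fun φ => hz2 φ g)) f
      ext1 g
      exact inner_self_eq_zero.1 (hz3 (R g) g)
    rw [← sub_eq_zero.1 hR0]; abel
  have hd : HasDerivAt (fun s => Ω t + ∫ r in t..s, G r) (G t) t :=
    (hG.integral_hasStrictDerivAt t t).hasDerivAt.const_add _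
  exact hd.congr_of_eventuallyEq (Eventually.of_forall hint)

section Weak

variable {κ ε : ℝ} {ω B : ℝ → Op}

theorem WeakEvolution.trClass (h : WeakEvolution κ ε ω B) (t : ℝ) : ∃ M, TrLE (ω t) M := by
  obtain ⟨a, b, hab⟩ := h.nuclear t
  exact ⟨_, trLE_of_nuclear hab.1 hab.2⟩

theorem WeakEvolution.trCont_comm (h : WeakEvolution κ ε ω B) :
    TrCont fun t => B t * ω t - ω t * B t := by
  intro t η hη
  obtain ⟨M, hM⟩ := h.trClass t
  have hM0 := hM.nonneg
  set b := ‖B t‖ with hb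
  have h1 := h.trCont t (min 1 (η / (4 * (b + 1)))) (lt_min one_pos (by positivity))
  have h2 := Metric.tendsto_nhds.1 (h.continuous.tendsto t) (η / (4 * (M + 1))) (by positivity)
  filter_upwards [h1, h2] with s a1 a2
  rw [dist_eq_norm] at a2
  have a3 : TrLE (ω s) (M + 1) := by
    have := a1.add hM
    rw [sub_add_cancel] at this
    exact this.mono (by linarith [min_le_left 1 (η / (4 * (b + 1)))])
  have a4 := a1.mono (min_le_right _ _)
  have e1 := ((a3.mul_left (B s - B t)).add (a4.mul_left (B t))).sub
    ((a3.mul_right (B s - B t)).add (a4.mul_right (B t)))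
  have e : (B s - B t) * ω s + B t * (ω s - ω t) - (ω s * (B s - B t) + (ω s - ω t) * B t)
      = (B s * ω s - ω s * B s) - (B t * ω t - ω t * B t) := by noncomm_ring
  rw [e] at e1
  refine e1.mono ?_
  rw [← hb]
  have f1 : ‖B s - B t‖ * (M + 1) ≤ η / 4 := by
    rw [lt_div_iff₀ (by positivity)] at a2
    linarith
  have f2 : b * (η / (4 * (b + 1))) ≤ η / 4 := by
    rw [mul_div_assoc', div_le_div_iff₀ (by positivity) (by norm_num)]
    nlinarith [norm_nonneg (B t)]
  linarith [mul_comm (M + 1) ‖B s - B t‖, mul_comm b (η / (4 * (b + 1)))]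

theorem WeakEvolution.trCont_frame_comm (h : WeakEvolution κ ε ω B) (c : ℝ) :
    TrCont (frame c fun t => B t * ω t - ω t * B t) := by
  have key : ∀ (C : Op) (t : ℝ), ∀ η > 0, ∀ᶠ s in 𝓝 t,
      TrLE ((free (-(c * s)) - free (-(c * t))) * (C * ω t - ω t * C)) η := by
    intro C t η hη
    obtain ⟨a, b, hab⟩ := h.nuclear t
    have hX : ∀ f, Tendsto (fun s => free (-(c * s)) f) (𝓝 t) (𝓝 (free (-(c * t)) f)) := by
      intro f
      simpa only [neg_mul] using tendsto_free (c := -c) (t := t) f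
    have h1 := nuclear_tendsto hab C hX (fun s => norm_free_le _) (half_pos hη)
    have h2 := nuclear_tendsto hab 1 hX (fun s => norm_free_le _)
      (show 0 < η / (2 * (‖C‖ + 1)) by positivity)
    filter_upwards [h1, h2] with s a1 a2
    rw [one_mul] at a2
    have := a1.sub (a2.mul_right C)
    rw [mul_assoc, ← mul_sub] at this
    refine this.mono ?_
    have f2 : η / (2 * (‖C‖ + 1)) * ‖C‖ ≤ η / 2 := by
      rw [div_mul_eq_mul_div, div_le_div_iff₀ (by positivity) (by norm_num)]
      nlinarith [norm_nonneg C]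
    linarith
  refine trCont_frame h.trCont_comm (fun t => key (B t) t) (fun t η hη => ?_)
  filter_upwards [key (star (B t)) t η hη] with s hs
  have e : star (B t * ω t - ω t * B t) = -(star (B t) * ω t - ω t * star (B t)) := by
    rw [star_sub, star_mul, star_mul, (h.selfAdjoint t).star_eq, neg_sub]
  rw [e, mul_neg]
  exact hs.neg

theorem laplacian_smul_toLp (c : ℂ) (φ : 𝓢(Space, ℂ)) :
    (-(c • Δ φ)).toLp 2 volume = (-c) • ((Δ φ).toLp 2 volume : OneParticle) := by
  rw [← neg_smul]
  exact map_smul (SchwartzMap.toLpCLM ℂ ℂ 2 (volume : Measure Space)) (-c) (Δ φ)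

/-- The frame constant is chosen so that the derivatives of the evolving test functions cancel the
two Laplacian terms, leaving only the bounded part. -/
theorem WeakEvolution.hasDerivAt_schwartz (h : WeakEvolution κ ε ω B) (t : ℝ)
    (φ ψ : 𝓢(Space, ℂ)) :
    HasDerivAt (fun s => ⟪φ.toLp 2 volume,
        frame (-(2 * Real.pi) ^ 2 * κ * ε ^ 2) ω s (ψ.toLp 2 volume)⟫_ℂ)
      ⟪φ.toLp 2 volume, (-(Complex.I * κ) • frame (-(2 * Real.pi) ^ 2 * κ * ε ^ 2)
        (fun t => B t * ω t - ω t * B t) t) (ψ.toLp 2 volume)⟫_ℂ t := by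
  set c := -(2 * Real.pi) ^ 2 * κ * ε ^ 2 with hc
  have hfr : ∀ (A : ℝ → Op) (s : ℝ) (f g : OneParticle),
      ⟪f, frame c A s g⟫_ℂ = ⟪free (c * s) f, A s (free (c * s) g)⟫_ℂ := by
    intro A s f g
    rw [frame, op_mul_apply, op_mul_apply, ← ContinuousLinearMap.adjoint_inner_left,
      ← ContinuousLinearMap.star_eq_adjoint, star_free, neg_neg]
  have hdf : ∀ χ : 𝓢(Space, ℂ), HasDerivAt (fun s : ℝ => free (c * s) (χ.toLp 2))
      ((Complex.I * κ * ε ^ 2) • ((Δ (freeSchwartz (c * t) χ)).toLp 2 : OneParticle)) t := by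
    intro χ
    have h1 : HasDerivAt (fun s : ℝ => c * s) c t := by
      simpa using (hasDerivAt_id t).const_mul c
    have := (hasDerivAt_free (c * t) χ).scomp t h1
    convert! this using 1
    have e : ∀ (r : ℝ) (z : ℂ) (x : OneParticle), r • z • x = ((r : ℂ) * z) • x := fun r z x => by
      rw [mul_smul]; rfl
    rw [e]
    congr 1
    rw [hc]
    have : (Real.pi : ℂ) ≠ 0 := by exact_mod_cast Real.pi_ne_zero
    push_cast
    field_simp
  have hω := h.trCont.continuous.continuousAt (x := t)
  have hq := h.deriv t (freeSchwartz (c * t) φ) (freeSchwartz (c * t) ψ)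
  rw [← free_toLp, ← free_toLp] at hq
  have key := hasDerivAt_inner_apply (hdf φ) (hdf ψ) hω hq
  simp only [← hfr] at key
  convert key using 1
  rw [smul_apply, inner_smul_right, hfr, laplacian_smul_toLp, laplacian_smul_toLp]
  simp only [map_smul, inner_smul_left, inner_smul_right, map_mul, map_neg, map_pow, Complex.conj_I,
    Complex.conj_ofReal]
  ring

theorem WeakEvolution.hasDerivAt (h : WeakEvolution κ ε ω B) (t : ℝ) :
    HasDerivAt (frame (-(2 * Real.pi) ^ 2 * κ * ε ^ 2) ω)
      (-(Complex.I * κ) • frame (-(2 * Real.pi) ^ 2 * κ * ε ^ 2)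
        (fun t => B t * ω t - ω t * B t) t) t :=
  hasDerivAt_of_schwartz (G := fun t => -(Complex.I * κ) •
      frame (-(2 * Real.pi) ^ 2 * κ * ε ^ 2) (fun t => B t * ω t - ω t * B t) t)
    ((h.trCont_frame_comm _).continuous.const_smul (-(Complex.I * (κ : ℂ))))
    h.hasDerivAt_schwartz t

/-- Self-adjointness of B need not be known. Since ω is self-adjoint, so is its derivative in the
frame; averaging the derivative with its adjoint replaces B by its self-adjoint part without
changing the equation. -/
theorem WeakEvolution.trEvolution (h : WeakEvolution κ ε ω B) :
    TrEvolution (frame (-(2 * Real.pi) ^ 2 * κ * ε ^ 2) ω)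
      (frame (-(2 * Real.pi) ^ 2 * κ * ε ^ 2) fun t => (1 / 2 : ℂ) • (B t + star (B t))) (-κ) := by
  set c := -(2 * Real.pi) ^ 2 * κ * ε ^ 2 with hc
  have hsa : ∀ t, star (frame c ω t) = frame c ω t := fun t => by
    rw [star_frame]; simp only [frame, (h.selfAdjoint t).star_eq]
  have hGs : ∀ t, star (-(Complex.I * κ) • frame c (fun t => B t * ω t - ω t * B t) t)
      = -(Complex.I * κ) • frame c (fun t => B t * ω t - ω t * B t) t := by
    intro t
    have : StarModule ℝ Op := StarModule.complexToReal
    have h1 := (h.hasDerivAt t).star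
    have h2 : (fun t => star (frame c ω t)) = frame c ω := funext hsa
    rw [h2] at h1
    exact h1.unique (h.hasDerivAt t)
  have hG : ∀ t, (Complex.I * ((-κ : ℝ) : ℂ)) •
        (frame c (fun t => (1 / 2 : ℂ) • (B t + star (B t))) t * frame c ω t
          - frame c ω t * frame c (fun t => (1 / 2 : ℂ) • (B t + star (B t))) t)
      = -(Complex.I * κ) • frame c (fun t => B t * ω t - ω t * B t) t := by
    intro t
    have h1 := hGs t
    have e1 : frame c (fun t => (1 / 2 : ℂ) • (B t + star (B t))) t * frame c ω t
          - frame c ω t * frame c (fun t => (1 / 2 : ℂ) • (B t + star (B t))) t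
        = (1 / 2 : ℂ) • (frame c (fun t => B t * ω t - ω t * B t) t
          - star (frame c (fun t => B t * ω t - ω t * B t) t)) := by
      rw [frame_mul, frame_mul, star_frame]
      simp only [frame, star_sub, star_mul, (h.selfAdjoint t).star_eq, smul_mul_assoc,
        mul_smul_comm, ← smul_sub]
      congr 1
      noncomm_ring
    rw [star_smul] at h1
    have e2 : star (-(Complex.I * κ)) = Complex.I * κ := by simp
    rw [e2] at h1
    rw [e1, smul_smul, smul_sub]
    have e3 : Complex.I * ((-κ : ℝ) : ℂ) * (1 / 2) = (1 / 2) * (-(Complex.I * κ)) := by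
      push_cast; ring
    rw [e3]
    rw [mul_smul, mul_smul, neg_smul _ (star _), h1]
    module
  refine ⟨fun t => ?_, fun t => ?_, ?_⟩
  · rw [IsSelfAdjoint, star_frame]
    simp only [frame]
    rw [star_smul, star_add, star_star, add_comm (star (B t))]
    simp
  · obtain ⟨M, hM⟩ := h.trClass t
    exact ⟨M, hM.frame c⟩
  · simp only [hG]
    refine trDeriv_of_hasDerivAt ?_ h.hasDerivAt
    intro t η hη
    filter_upwards [h.trCont_frame_comm c t (η / (‖-(Complex.I * κ)‖ + 1)) (by positivity)]
      with s hs
    have := hs.smul (-(Complex.I * κ))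
    rw [smul_sub] at this
    refine this.mono ?_
    rw [mul_div_assoc', div_le_iff₀ (by positivity)]
    nlinarith [norm_nonneg (-(Complex.I * (κ : ℂ)))]

end Weak

/-! ### Commutators with Weyl operators -/

theorem TrLE.contraction_mul {A L : Op} {M : ℝ} (h : TrLE A M) (hL : ‖L‖ ≤ 1) : TrLE (L * A) M :=
  (h.mul_left L).mono (mul_le_of_le_one_left h.nonneg hL)

theorem TrLE.mul_contraction {A L : Op} {M : ℝ} (h : TrLE A M) (hL : ‖L‖ ≤ 1) : TrLE (A * L) M :=
  (h.mul_right L).mono (mul_le_of_le_one_right h.nonneg hL)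

theorem TrLE.smul_of_norm_le {A : Op} {M r : ℝ} (h : TrLE A M) {z : ℂ} (hz : ‖z‖ ≤ r) :
    TrLE (z • A) (r * M) :=
  (h.smul z).mono (mul_le_mul_of_nonneg_right hz h.nonneg)

theorem TrLE.comm_mul {A B Y : Op} {a b : ℝ} (hA : TrLE (A * Y - Y * A) a)
    (hB : TrLE (B * Y - Y * B) b) (hA1 : ‖A‖ ≤ 1) (hB1 : ‖B‖ ≤ 1) :
    TrLE (A * B * Y - Y * (A * B)) (a + b) := by
  have := (hA.mul_contraction hB1).add (hB.contraction_mul hA1)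
  have e : (A * Y - Y * A) * B + A * (B * Y - Y * B) = A * B * Y - Y * (A * B) := by noncomm_ring
  rwa [e] at this

theorem TrLE.comm_smul {A Y : Op} {a : ℝ} (hA : TrLE (A * Y - Y * A) a) {u : ℂ} (hu : ‖u‖ = 1) :
    TrLE ((u • A) * Y - Y * (u • A)) a := by
  have := hA.smul_of_norm_le hu.le
  rwa [one_mul, smul_sub, ← smul_mul_assoc, ← mul_smul_comm] at this

theorem TrLE.comm_conj {A Y U U' : Op} {a : ℝ} (hA : TrLE (A * Y - Y * A) a) (hU : U' * U = 1)
    (h1 : ‖U‖ ≤ 1) (h2 : ‖U'‖ ≤ 1) :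
    TrLE (U * A * U' * (U * Y * U') - U * Y * U' * (U * A * U')) a := by
  have := (hA.contraction_mul h1).mul_contraction h2
  have e : U * A * U' * (U * Y * U') - U * Y * U' * (U * A * U')
      = U * (A * Y - Y * A) * U' := by
    calc _ = U * A * (U' * U) * Y * U' - U * Y * (U' * U) * A * U' := by noncomm_ring
      _ = _ := by rw [hU]; noncomm_ring
  rwa [e]

theorem TrLE.comm_star {A Y : Op} {a : ℝ} (hA : TrLE (A * Y - Y * A) a) (hY : IsSelfAdjoint Y) :
    TrLE (star A * Y - Y * star A) a := by
  have := hA.adjoint.neg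
  rwa [star_sub, star_mul, star_mul, hY.star_eq, neg_sub] at this

theorem TrLE.of_forall_lt {A : Op} {M : ℝ} (h : ∀ η > 0, TrLE A (M + η)) : TrLE A M :=
  fun n f g hf hg => le_of_forall_pos_le_add fun η hη => h η hη n f g hf hg

/-- The Weyl operator `exp (2 π i p · x) exp (ε q · ∇)`. -/
def weyl (ε : ℝ) (p q : Space) : Op := wave p * shift (ε • q)

theorem norm_weyl_le (ε : ℝ) (p q : Space) : ‖weyl ε p q‖ ≤ 1 :=
  (norm_mul_le _ _).trans (mul_le_one₀ (norm_wave_le p) (norm_nonneg _) (norm_shift_le _))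

theorem weyl_zero_right (ε : ℝ) (p : Space) : weyl ε p 0 = wave p := by
  rw [weyl, smul_zero, shift_zero, mul_one]

theorem weyl_zero_left (ε : ℝ) (q : Space) : weyl ε 0 q = shift (ε • q) := by
  rw [weyl, wave_zero, one_mul]

theorem weyl_add (ε : ℝ) (p p' q q' : Space) :
    ∃ u : ℂ, ‖u‖ = 1 ∧ weyl ε (p + p') (q + q') = u • (weyl ε p q * weyl ε p' q') := by
  refine ⟨Complex.exp ((-(2 * Real.pi * ⟪ε • q, p'⟫_ℝ) : ℝ) * Complex.I),
    Complex.norm_exp_ofReal_mul_I _, ?_⟩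
  have e : weyl ε p q * weyl ε p' q' = wave p * (shift (ε • q) * wave p') * shift (ε • q') := by
    simp only [weyl, mul_assoc]
  rw [e, shift_mul_wave, mul_smul_comm, smul_mul_assoc, smul_smul, ← Complex.exp_add, ← add_mul,
    ← Complex.ofReal_add, neg_add_cancel, Complex.ofReal_zero, zero_mul, Complex.exp_zero, one_smul,
    weyl, wave_add, smul_add, shift_add]
  simp only [mul_assoc]

theorem star_weyl (ε : ℝ) (p q : Space) :
    ∃ u : ℂ, ‖u‖ = 1 ∧ star (weyl ε p q) = u • weyl ε (-p) (-q) := by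
  refine ⟨_, Complex.norm_exp_ofReal_mul_I (2 * Real.pi * ⟪ε • -q, -p⟫_ℝ), ?_⟩
  rw [weyl, star_mul, star_wave, star_shift, ← smul_neg, shift_mul_wave, weyl]

theorem wave_mul_weyl (ε : ℝ) (k p q : Space) :
    ∃ u : ℂ, ‖u‖ = 1 ∧ ‖u - 1‖ ≤ 2 * Real.pi * |ε| * ‖q‖ * ‖k‖ ∧
      wave k * weyl ε p q = u • (weyl ε p q * wave k) := by
  refine ⟨Complex.exp ((-(2 * Real.pi * ⟪ε • q, k⟫_ℝ) : ℝ) * Complex.I),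
    Complex.norm_exp_ofReal_mul_I _, ?_, ?_⟩
  · refine (norm_exp_sub_one_le _).trans ?_
    rw [abs_neg, abs_mul, abs_of_pos Real.two_pi_pos]
    have := abs_real_inner_le_norm (ε • q) k
    rw [norm_smul, Real.norm_eq_abs] at this
    calc 2 * Real.pi * |⟪ε • q, k⟫_ℝ| ≤ 2 * Real.pi * (|ε| * ‖q‖ * ‖k‖) := by gcongr
      _ = _ := by ring
  · rw [weyl, mul_assoc (wave p), shift_mul_wave, mul_smul_comm, smul_smul, ← Complex.exp_add,
      ← add_mul, ← Complex.ofReal_add, neg_add_cancel, Complex.ofReal_zero, zero_mul,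
      Complex.exp_zero, one_smul, ← mul_assoc, ← mul_assoc, ← wave_add, ← wave_add, add_comm k p]

/-- Free motion acts on the labels as a shear. The factor 1/ε appears because translations are
measured in units of ε. -/
theorem free_mul_weyl {ε : ℝ} (hε : ε ≠ 0) (s : ℝ) (p q : Space) :
    ∃ u : ℂ, ‖u‖ = 1 ∧
      free s * weyl ε p q * free (-s) = u • weyl ε p (q + (s / (Real.pi * ε)) • p) := by
  refine ⟨_, Complex.norm_exp_ofReal_mul_I (s * ‖p‖ ^ 2), ?_⟩
  have e : ε • (q + (s / (Real.pi * ε)) • p) = (s / Real.pi) • p + ε • q := by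
    rw [smul_add, smul_smul, add_comm]
    congr 2
    field_simp
  rw [weyl, ← mul_assoc, free_mul_wave, weyl, e, shift_add, smul_mul_assoc, smul_mul_assoc,
    mul_assoc _ (free s), free_shift_comm]
  simp only [mul_assoc, free_mul_neg, mul_one]

theorem TrLE.comm_weyl_nsmul {ε : ℝ} {Y : Op} {p q : Space} {a : ℝ}
    (h : TrLE (weyl ε p q * Y - Y * weyl ε p q) a) (n : ℕ) :
    TrLE (weyl ε (n • p) (n • q) * Y - Y * weyl ε (n • p) (n • q)) (n * a) := by
  induction n with
  | zero =>
    simpa [weyl, wave_zero, shift_zero] using trLE_zero (H := OneParticle)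
  | succ n ih =>
    obtain ⟨u, hu, e⟩ := weyl_add ε (n • p) p (n • q) q
    rw [succ_nsmul, succ_nsmul, e]
    have := (ih.comm_mul h (norm_weyl_le _ _ _) (norm_weyl_le _ _ _)).comm_smul hu
    refine this.mono (le_of_eq ?_)
    push_cast; ring

theorem exists_nat_smul_eq (p q : Space) :
    ∃ (n : ℕ) (p' q' : Space), n • p' = p ∧ n • q' = q ∧ ‖p'‖ + ‖q'‖ ≤ 1 ∧
      (n : ℝ) ≤ ‖p‖ + ‖q‖ + 1 := by
  by_cases h0 : ‖p‖ + ‖q‖ = 0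
  · have hp : ‖p‖ = 0 := by linarith [norm_nonneg p, norm_nonneg q]
    have hq : ‖q‖ = 0 := by linarith [norm_nonneg p, norm_nonneg q]
    exact ⟨0, 0, 0, by simp [norm_eq_zero.1 hp], by simp [norm_eq_zero.1 hq], by simp, by simp [hp, hq]⟩
  have hpos : 0 < ‖p‖ + ‖q‖ := lt_of_le_of_ne (by positivity) (Ne.symm h0)
  have hn : 0 < ⌈‖p‖ + ‖q‖⌉₊ := Nat.ceil_pos.2 hpos
  have hn' : (0 : ℝ) < ⌈‖p‖ + ‖q‖⌉₊ := by exact_mod_cast hn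
  refine ⟨⌈‖p‖ + ‖q‖⌉₊, (⌈‖p‖ + ‖q‖⌉₊ : ℝ)⁻¹ • p, (⌈‖p‖ + ‖q‖⌉₊ : ℝ)⁻¹ • q, ?_, ?_, ?_,
    (Nat.ceil_lt_add_one hpos.le).le⟩
  · rw [← Nat.cast_smul_eq_nsmul ℝ, smul_inv_smul₀ hn'.ne']
  · rw [← Nat.cast_smul_eq_nsmul ℝ, smul_inv_smul₀ hn'.ne']
  · rw [norm_smul, norm_smul, ← mul_add, Real.norm_of_nonneg (by positivity), inv_mul_le_iff₀ hn',
      mul_one]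
    exact Nat.le_ceil _

/-- The label is divided into n ≤ |p| + |q| + 1 equal parts inside the unit ball, and the Leibniz
rule is applied to the power. The linear part of the bound scales exactly; only δ is multiplied by
n. -/
theorem TrLE.comm_weyl_of_unit {ε : ℝ} {Y : Op} {m δ : ℝ} (hm : 0 ≤ m) (hδ : 0 ≤ δ)
    (h : ∀ p q : Space, ‖p‖ + ‖q‖ ≤ 1 →
      TrLE (weyl ε p q * Y - Y * weyl ε p q) (m * (‖p‖ + ‖q‖ + δ))) (p q : Space) :
    TrLE (weyl ε p q * Y - Y * weyl ε p q)
      (m * (‖p‖ + ‖q‖ + (‖p‖ + ‖q‖ + 1) * δ)) := by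
  obtain ⟨n, p', q', rfl, rfl, h1, hn⟩ := exists_nat_smul_eq p q
  refine ((h p' q' h1).comm_weyl_nsmul n).mono ?_
  have e : ∀ x : Space, ‖n • x‖ = n * ‖x‖ := fun x => by
    rw [← Nat.cast_smul_eq_nsmul ℝ, norm_smul, Real.norm_natCast]
  rw [e, e] at *
  have : n * (m * (‖p'‖ + ‖q'‖ + δ)) = m * (n * ‖p'‖ + n * ‖q'‖ + n * δ) := by ring
  rw [this]
  gcongr

/-! ### The mean-field potential -/

/-- Each [wave k, U] equals (u − 1) U wave k with |u − 1| ≤ b|k|, and the commutator of U wave k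
with Y costs β + m(2L|k| + 1). As β ≤ 2m, the product is at most bm(2L|k|² + 3|k|), hence the second
moment of W. -/
theorem comm_direct_le {W : Space → ℂ} (hW : Integrable fun k => (1 + ‖k‖ ^ 2) * ‖W k‖)
    {D : Op} {c : Space → ℂ} (hD : WeakIntegral D fun k => c k • wave k)
    (hc : ∀ k, ‖c k‖ ≤ ‖W k‖) {Y U : Op} {m β b L : ℝ} (hU : ‖U‖ ≤ 1) (hL : 0 ≤ L)
    (hU2 : TrLE (U * Y - Y * U) β) (hβ : β ≤ 2 * m)
    (hk : ∀ k, TrLE (wave k * Y - Y * wave k) (m * (2 * L * ‖k‖ + 1)))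
    (hb : 0 ≤ b)
    (hcomm : ∀ k, ∃ u : ℂ, ‖u‖ = 1 ∧ ‖u - 1‖ ≤ b * ‖k‖ ∧ wave k * U = u • (U * wave k)) :
    TrLE ((U * D - D * U) * Y - Y * (U * D - D * U))
      (b * m * ((2 * L + 3) * ∫ k, (1 + ‖k‖ ^ 2) * ‖W k‖)) := by
  have hm : 0 ≤ m := by linarith [hU2.nonneg]
  have key := ((hD.comm U).comm Y).trLE
    (M := fun k => b * m * ((2 * L + 3) * ((1 + ‖k‖ ^ 2) * ‖W k‖)))
    ((hW.const_mul _).const_mul _) fun k => ?_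
  · rw [integral_const_mul, integral_const_mul] at key
    have e : (U * D - D * U) * Y - Y * (U * D - D * U)
        = -((D * U - U * D) * Y - Y * (D * U - U * D)) := by noncomm_ring
    rw [e]
    exact key.neg
  · obtain ⟨u, -, hu, e⟩ := hcomm k
    have e1 : c k • wave k * U - U * c k • wave k = (c k * (u - 1)) • (U * wave k) := by
      rw [smul_mul_assoc, e, mul_smul_comm]; module
    have h2 := (hU2.comm_mul (hk k) hU (norm_wave_le k)).smul (c k * (u - 1))
    rw [e1, smul_mul_assoc, mul_smul_comm, ← smul_sub]
    refine h2.mono ?_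
    rw [norm_mul]
    have h3 := hc k
    have hk0 := norm_nonneg k
    have hβ0 := hU2.nonneg
    calc ‖c k‖ * ‖u - 1‖ * (β + m * (2 * L * ‖k‖ + 1))
        ≤ ‖W k‖ * (b * ‖k‖) * (2 * m + m * (2 * L * ‖k‖ + 1)) := by gcongr
      _ = b * m * (‖W k‖ * (2 * L * ‖k‖ ^ 2 + 3 * ‖k‖)) := by ring
      _ ≤ b * m * (‖W k‖ * ((2 * L + 3) * (1 + ‖k‖ ^ 2))) := by
        gcongr
        nlinarith [sq_nonneg (‖k‖ - 1)]
      _ = _ := by ring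

/-- U moves past the pair of opposite plane waves at the cost of one phase, so [U, X] is a
superposition of conjugates of [U, Y] with weight N⁻¹. The outer commutator costs a factor two, by
‖Y‖ ≤ 1. -/
theorem comm_exchange_le {W : Space → ℂ} (hW : Integrable W) {X Y : Op} {N : ℕ}
    (hX : WeakIntegral X fun k => (W k * (N : ℂ)⁻¹) • (wave k * Y * wave (-k)))
    {U : Op} {β : ℝ} (hU2 : TrLE (U * Y - Y * U) β) (hY : ‖Y‖ ≤ 1)
    (hcomm : ∀ k, ∃ u : ℂ, ‖u‖ = 1 ∧ wave k * U = u • (U * wave k)) :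
    TrLE ((U * X - X * U) * Y - Y * (U * X - X * U)) (2 * ((N : ℝ)⁻¹ * β * ∫ k, ‖W k‖)) := by
  have key := (hX.comm U).trLE (M := fun k => (N : ℝ)⁻¹ * β * ‖W k‖) (hW.norm.const_mul _)
    fun k => ?_
  · rw [integral_const_mul] at key
    have h1 := (key.mul_contraction hY).sub (key.contraction_mul hY)
    have e : (U * X - X * U) * Y - Y * (U * X - X * U)
        = -((X * U - U * X) * Y - Y * (X * U - U * X)) := by noncomm_ring
    rw [e, two_mul]
    exact h1.neg
  · obtain ⟨u, hu, e⟩ := hcomm (-k)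
    have e1 : wave k * Y * wave (-k) * U - U * (wave k * Y * wave (-k))
        = -(u • (wave k * (U * Y - Y * U) * wave (-k))) := by
      have h2 : wave k * Y * wave (-k) * U = u • (wave k * (Y * U) * wave (-k)) := by
        rw [mul_assoc, e, mul_smul_comm]; simp only [mul_assoc]
      have h3 : U * (wave k * Y * wave (-k)) = u • (wave k * (U * Y) * wave (-k)) := by
        calc U * (wave k * Y * wave (-k))
            = wave k * wave (-k) * U * (wave k * Y * wave (-k)) := by rw [wave_mul_neg, one_mul]
          _ = wave k * (wave (-k) * U) * (wave k * Y * wave (-k)) := by simp only [mul_assoc]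
          _ = u • (wave k * U * (wave (-k) * wave k) * Y * wave (-k)) := by
            rw [e, mul_smul_comm, smul_mul_assoc]; simp only [mul_assoc]
          _ = _ := by rw [wave_neg_mul, mul_one]; simp only [mul_assoc]
      rw [h2, h3, ← smul_sub, ← smul_neg]
      congr 1
      noncomm_ring
    rw [smul_mul_assoc, mul_smul_comm, ← smul_sub, e1]
    have h4 := (((hU2.contraction_mul (norm_wave_le k)).mul_contraction
      (norm_wave_le (-k))).smul_of_norm_le hu.le).neg.smul (W k * (N : ℂ)⁻¹)
    refine h4.mono (le_of_eq ?_)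
    rw [norm_mul, norm_inv, Complex.norm_natCast]
    ring

/-- `B` is the mean-field potential `D - X` generated by `Y`. -/
def IsMeanField (W : Space → ℂ) (N : ℕ) (Y B : Op) : Prop :=
  ∃ (D X : Op) (c : Space → ℂ), B = D - X ∧ (∀ k, ‖c k‖ ≤ ‖W k‖) ∧
    (WeakIntegral D fun k => c k • wave k) ∧
    WeakIntegral X fun k => (W k * (N : ℂ)⁻¹) • (wave k * Y * wave (-k))

theorem IsMeanField.comm_le {W : Space → ℂ} {N : ℕ} {Y B : Op} (h : IsMeanField W N Y B)
    (hW : Integrable W) (hW2 : Integrable fun k => (1 + ‖k‖ ^ 2) * ‖W k‖) {U : Op}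
    {m β b L : ℝ} (hU : ‖U‖ ≤ 1) (hL : 0 ≤ L)
    (hU2 : TrLE (U * Y - Y * U) β) (hβ : β ≤ 2 * m)
    (hk : ∀ k, TrLE (wave k * Y - Y * wave k) (m * (2 * L * ‖k‖ + 1)))
    (hb : 0 ≤ b) (hY : ‖Y‖ ≤ 1)
    (hcomm : ∀ k, ∃ u : ℂ, ‖u‖ = 1 ∧ ‖u - 1‖ ≤ b * ‖k‖ ∧ wave k * U = u • (U * wave k)) :
    TrLE ((U * B - B * U) * Y - Y * (U * B - B * U))
      (b * m * ((2 * L + 3) * ∫ k, (1 + ‖k‖ ^ 2) * ‖W k‖)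
        + 2 * ((N : ℝ)⁻¹ * β * ∫ k, ‖W k‖)) := by
  obtain ⟨D, X, c, rfl, hc, hD, hX⟩ := h
  have h1 := comm_direct_le hW2 hD hc hU hL hU2 hβ hk hb hcomm
  have h2 := comm_exchange_le hW hX hU2 hY fun k => by
    obtain ⟨u, a1, -, a3⟩ := hcomm k
    exact ⟨u, a1, a3⟩
  have e : (U * (D - X) - (D - X) * U) * Y - Y * (U * (D - X) - (D - X) * U)
      = ((U * D - D * U) * Y - Y * (U * D - D * U))
        - ((U * X - X * U) * Y - Y * (U * X - X * U)) := by noncomm_ring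
  rw [e]
  exact h1.sub h2

/-! ### Propagation over a unit time -/

theorem frame_zero (c : ℝ) (A : ℝ → Op) : frame c A 0 = A 0 := by
  simp [frame, free_zero]

theorem trLE_comm_weyl_of_frame {ε : ℝ} (hε : ε ≠ 0) {c t a : ℝ} {ω : ℝ → Op} {p q : Space}
    (h : TrLE (weyl ε p (q + (-(c * t) / (Real.pi * ε)) • p) * frame c ω t
      - frame c ω t * weyl ε p (q + (-(c * t) / (Real.pi * ε)) • p)) a) :
    TrLE (weyl ε p q * ω t - ω t * weyl ε p q) a := by
  obtain ⟨u, hu, e⟩ := free_mul_weyl hε (-(c * t)) p q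
  rw [neg_neg] at e
  have h1 := h.comm_smul hu
  rw [← e] at h1
  have h2 := h1.comm_conj (free_neg_mul (c * t)) (norm_free_le (c * t)) (norm_free_le (-(c * t)))
  have e1 : ∀ A : Op, free (c * t) * (free (-(c * t)) * A * free (c * t)) * free (-(c * t)) = A := by
    intro A
    calc _ = (free (c * t) * free (-(c * t))) * A * (free (c * t) * free (-(c * t))) := by
          noncomm_ring
      _ = A := by rw [free_mul_neg, one_mul, mul_one]
  rwa [frame, e1, e1] at h2

theorem wave_mul_smul_weyl (ε : ℝ) (k p q : Space) (v : ℂ) :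
    ∃ u : ℂ, ‖u‖ = 1 ∧ ‖u - 1‖ ≤ 2 * Real.pi * |ε| * ‖q‖ * ‖k‖ ∧
      wave k * (v • weyl ε p q) = u • ((v • weyl ε p q) * wave k) := by
  obtain ⟨u, h1, h2, h3⟩ := wave_mul_weyl ε k p q
  exact ⟨u, h1, h2, by rw [mul_smul_comm, h3, smul_mul_assoc, smul_comm]⟩

/-- The bound with B* is the adjoint of the bound for B with U* in place of U, and U* is again a
Weyl operator up to a phase. Averaging gives the self-adjoint part of B. -/
theorem IsMeanField.comm_weyl_le {W : Space → ℂ} {N : ℕ} {Y B : Op} (h : IsMeanField W N Y B)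
    (hW : Integrable W) (hW2 : Integrable fun k => (1 + ‖k‖ ^ 2) * ‖W k‖) (hYs : IsSelfAdjoint Y)
    {m β L ε : ℝ} (hL : 0 ≤ L) {p q : Space} {v : ℂ} (hv : ‖v‖ = 1)
    (hU : TrLE (weyl ε p q * Y - Y * weyl ε p q) β) (hβ : β ≤ 2 * m)
    (hk : ∀ k, TrLE (wave k * Y - Y * wave k) (m * (2 * L * ‖k‖ + 1))) (hY : ‖Y‖ ≤ 1) :
    TrLE (((v • weyl ε p q) * ((1 / 2 : ℂ) • (B + star B))
          - ((1 / 2 : ℂ) • (B + star B)) * (v • weyl ε p q)) * Y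
        - Y * ((v • weyl ε p q) * ((1 / 2 : ℂ) • (B + star B))
          - ((1 / 2 : ℂ) • (B + star B)) * (v • weyl ε p q)))
      (2 * Real.pi * |ε| * ‖q‖ * m * ((2 * L + 3) * ∫ k, (1 + ‖k‖ ^ 2) * ‖W k‖)
        + 2 * ((N : ℝ)⁻¹ * β * ∫ k, ‖W k‖)) := by
  have hn : ‖v • weyl ε p q‖ ≤ 1 := by rw [norm_smul, hv, one_mul]; exact norm_weyl_le _ _ _
  have h1 := h.comm_le hW hW2 hn hL (hU.comm_smul hv) hβ hk (by positivity) hY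
    fun k => wave_mul_smul_weyl ε k p q v
  obtain ⟨u, hu, e⟩ := star_weyl ε p q
  have e' : star (v • weyl ε p q) = (star v * u) • weyl ε (-p) (-q) := by
    rw [star_smul, e, smul_smul]
  have h2 := h.comm_le hW hW2 (U := star (v • weyl ε p q)) ((norm_star (E := Op) _).trans_le hn) hL
    ((hU.comm_smul hv).comm_star hYs) hβ hk (b := 2 * Real.pi * |ε| * ‖q‖) (by positivity) hY
    fun k => by
      rw [e']
      simpa using wave_mul_smul_weyl ε k (-p) (-q) (star v * u)
  have h3 := (h1.add h2.adjoint).smul (1 / 2)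
  generalize v • weyl ε p q = U at *
  have e3 : (1 / 2 : ℂ) • ((U * B - B * U) * Y - Y * (U * B - B * U)
      + star ((star U * B - B * star U) * Y - Y * (star U * B - B * star U)))
      = (U * ((1 / 2 : ℂ) • (B + star B)) - ((1 / 2 : ℂ) • (B + star B)) * U) * Y
        - Y * (U * ((1 / 2 : ℂ) • (B + star B)) - ((1 / 2 : ℂ) • (B + star B)) * U) := by
    simp only [star_sub, star_mul, star_star, hYs.star_eq, mul_smul_comm, smul_mul_assoc,
      ← smul_sub]
    congr 1
    noncomm_ring
  rw [e3] at h3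
  refine h3.mono (le_of_eq ?_)
  norm_num
  ring

theorem conj_comm_comm {U U' : Op} (h : U * U' = 1) (X A Y : Op) :
    (U' * X * U * (U' * A * U) - U' * A * U * (U' * X * U)) * (U' * Y * U)
        - U' * Y * U * (U' * X * U * (U' * A * U) - U' * A * U * (U' * X * U))
      = U' * ((X * A - A * X) * Y - Y * (X * A - A * X)) * U := by
  have e : ∀ P Q : Op, U' * P * U * (U' * Q * U) = U' * (P * Q) * U := fun P Q => by
    calc U' * P * U * (U' * Q * U) = U' * P * (U * U') * Q * U := by noncomm_ring
      _ = _ := by rw [h]; noncomm_ring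
  have e2 : ∀ P Q : Op, U' * P * U - U' * Q * U = U' * (P - Q) * U := fun P Q => by noncomm_ring
  simp only [e, e2]

/-- Distortion of phase space by the free flow over a unit time. -/
def distortion : ℝ := 1 + 4 * Real.pi

/-- The exponential rate of growth of the commutators. -/
def growthRate (W : Space → ℂ) : ℝ :=
  distortion * (2 * Real.pi * ((2 * distortion + 3) * ∫ k, (1 + ‖k‖ ^ 2) * ‖W k‖)
    + 2 * ∫ k, ‖W k‖)

theorem one_le_distortion : 1 ≤ distortion := by
  have := Real.pi_pos
  unfold distortion; linarith

theorem norm_add_distortion {p q : Space} {s : ℝ} (hs : |s| ≤ 4 * Real.pi) :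
    ‖p‖ + ‖q + s • p‖ ≤ distortion * (‖p‖ + ‖q‖) := by
  have h1 := norm_add_le q (s • p)
  rw [norm_smul, Real.norm_eq_abs] at h1
  have h2 := mul_le_mul_of_nonneg_right hs (norm_nonneg p)
  have h3 := mul_nonneg Real.pi_pos.le (norm_nonneg q)
  unfold distortion
  nlinarith

/-- Gronwall runs over labels in the unit ball: the direct term produces |q| times the commutator
with U, quadratic in the label, and becomes linear only once that commutator is at most 2m. All
other labels follow by subdivision. -/
theorem WeakEvolution.comm_weyl_le {κ ε : ℝ} {ω B : ℝ → Op} (h : WeakEvolution κ ε ω B)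
    (hε : 0 < ε) (hκ : |κ| * ε = 1) {N : ℕ} (hN : (N : ℝ)⁻¹ ≤ ε) {W : Space → ℂ}
    (hW : Integrable W) (hW2 : Integrable fun k => (1 + ‖k‖ ^ 2) * ‖W k‖)
    (hB : ∀ t, IsMeanField W N (ω t) (B t)) (hω : ∀ t, ‖ω t‖ ≤ 1) {M : ℝ}
    (h0 : ∀ p q, TrLE (weyl ε p q * ω 0 - ω 0 * weyl ε p q) (M * (‖p‖ + ‖q‖)))
    {t : ℝ} (ht : t ∈ Set.Icc (0 : ℝ) 1) (p q : Space) :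
    TrLE (weyl ε p q * ω t - ω t * weyl ε p q)
      (distortion * Real.exp (growthRate W) * M * (‖p‖ + ‖q‖)) := by
  set c := -(2 * Real.pi) ^ 2 * κ * ε ^ 2 with hc
  have hL := one_le_distortion
  have hL0 : 0 ≤ distortion := zero_le_one.trans hL
  have hM : 0 ≤ M := by
    simpa using (h0 (EuclideanSpace.single 0 1) 0).nonneg
  -- The shear equals −4πtκε, and |κ|ε = 1 removes its dependence on ε.
  have hs : ∀ t ∈ Set.Icc (0 : ℝ) 1, |c * t / (Real.pi * ε)| ≤ 4 * Real.pi := by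
    intro t ht
    have e : c * t / (Real.pi * ε) = -(4 * Real.pi * t) * (κ * ε) := by
      rw [hc]
      have := Real.pi_pos
      field_simp
      ring
    rw [e, abs_mul, abs_mul, abs_of_pos hε, hκ, mul_one, abs_neg, abs_of_nonneg]
    · nlinarith [Real.pi_pos, ht.2]
    · exact mul_nonneg (by positivity) ht.1
  have hs' : ∀ t ∈ Set.Icc (0 : ℝ) 1, |-(c * t) / (Real.pi * ε)| ≤ 4 * Real.pi := by
    intro t ht
    rw [neg_div, abs_neg]; exact hs t ht
  have hI1 : 0 ≤ ∫ k, ‖W k‖ := integral_nonneg fun _ => norm_nonneg _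
  have hI2 : 0 ≤ ∫ k, (1 + ‖k‖ ^ 2) * ‖W k‖ := integral_nonneg fun _ => by positivity
  -- Positivity of δ keeps the Gronwall supremum finite; the growth rate does not depend on δ, so
  -- that δ can be removed afterwards.
  have main : ∀ δ, 0 < δ → δ ≤ 1 → ∀ p q : Space, ‖p‖ + ‖q‖ ≤ 1 →
      TrLE (weyl ε p q * frame c ω t - frame c ω t * weyl ε p q)
        (M * Real.exp (growthRate W) * (‖p‖ + ‖q‖ + δ)) := by
    intro δ hδ hδ1 p q hpq
    let ι := {z : Space × Space // ‖z.1‖ + ‖z.2‖ ≤ 1}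
    have : Nonempty ι := ⟨⟨0, by simp⟩⟩
    have key := h.trEvolution.commutator_gronwall (ι := ι)
      (W := fun z => weyl ε z.1.1 z.1.2) (fun z => norm_weyl_le _ _ _)
      (w := fun z => ‖z.1.1‖ + ‖z.1.2‖ + δ) hδ
      (fun z => by linarith [norm_nonneg z.1.1, norm_nonneg z.1.2])
      (C := growthRate W) (T := 1) ?_ (m₀ := M) (fun z => ?_) ht ⟨(p, q), hpq⟩
    · refine key.mono ?_
      have hg : 0 ≤ growthRate W := by
        have := Real.pi_pos
        unfold growthRate; positivity
      have : Real.exp (growthRate W * t) ≤ Real.exp (growthRate W) :=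
        Real.exp_le_exp.2 (mul_le_of_le_one_right hg ht.2)
      exact mul_le_mul_of_nonneg_right (mul_le_mul_of_nonneg_left this hM) (by positivity)
    · rintro s ⟨hs0, hs1⟩ m hm ⟨⟨p, q⟩, hz⟩
      have hsI : s ∈ Set.Icc (0 : ℝ) 1 := ⟨hs0, hs1.le⟩
      have hm0 : 0 ≤ m := by
        have := (hm ⟨0, by simp⟩).nonneg
        simp only [Prod.fst_zero, Prod.snd_zero, norm_zero, zero_add] at this
        exact nonneg_of_mul_nonneg_left this hδ
      have hall := TrLE.comm_weyl_of_unit hm0 hδ.le fun p q hpq => hm ⟨(p, q), hpq⟩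
      -- Subdivision in the frame gives x + (x + 1)δ with x at most the distortion times |k|; δ ≤ 1
      -- leaves at most 2x + 1.
      have hwave : ∀ k, TrLE (wave k * ω s - ω s * wave k) (m * (2 * distortion * ‖k‖ + 1)) := by
        intro k
        rw [← weyl_zero_right ε k]
        refine (trLE_comm_weyl_of_frame hε.ne' (hall k _)).mono ?_
        have h1 := norm_add_distortion (p := k) (q := 0) (hs' s hsI)
        rw [norm_zero, add_zero] at h1
        have h2 : 0 ≤ ‖k‖ + ‖0 + (-(c * s) / (Real.pi * ε)) • k‖ := by positivity
        refine mul_le_mul_of_nonneg_left ?_ hm0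
        have h3 := mul_le_mul_of_nonneg_left hδ1 (add_nonneg h2 zero_le_one)
        linarith
      obtain ⟨u, hu, e⟩ := free_mul_weyl hε.ne' (c * s) p q
      set q' := q + (c * s / (Real.pi * ε)) • p with hq'
      have hq'n : ‖q'‖ ≤ distortion * (‖p‖ + ‖q‖) :=
        (le_add_of_nonneg_left (norm_nonneg p)).trans (norm_add_distortion (hs s hsI))
      have hback : q' + (-(c * s) / (Real.pi * ε)) • p = q := by
        rw [hq', neg_div, neg_smul, add_neg_cancel_right]
      have hz2 := hm ⟨(p, q), hz⟩
      have hV : TrLE (weyl ε p q' * ω s - ω s * weyl ε p q') (m * (‖p‖ + ‖q‖ + δ)) := by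
        refine trLE_comm_weyl_of_frame hε.ne' (c := c) (t := s) ?_
        rw [hback]
        exact hz2
      have hmf := (hB s).comm_weyl_le hW hW2 (h.selfAdjoint s) (m := m) hL0 hu hV
        (by nlinarith) hwave (hω s)
      have e2 : weyl ε p q = free (-(c * s)) * (u • weyl ε p q') * free (c * s) := by
        rw [← e]
        calc weyl ε p q = (free (-(c * s)) * free (c * s)) * weyl ε p q
              * (free (-(c * s)) * free (c * s)) := by rw [free_neg_mul, one_mul, mul_one]
          _ = _ := by noncomm_ring
      have e3 := conj_comm_comm (free_mul_neg (c * s)) (u • weyl ε p q')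
        ((1 / 2 : ℂ) • (B s + star (B s))) (ω s)
      rw [← e2] at e3
      have h5 := ((hmf.contraction_mul (norm_free_le (-(c * s)))).mul_contraction
        (norm_free_le (c * s))).smul (((-κ : ℝ)) : ℂ)
      rw [← e3] at h5
      refine h5.mono ?_
      rw [Complex.norm_real, Real.norm_eq_abs, abs_neg, abs_of_pos hε]
      have hw : 0 ≤ ‖p‖ + ‖q‖ + δ := by positivity
      have hκ0 := abs_nonneg κ
      have hlast : ‖p‖ + ‖q‖ ≤ ‖p‖ + ‖q‖ + δ := by linarith
      -- The large factor |κ| is absorbed by ε from the phase in the direct term and by N⁻¹ ≤ ε in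
      -- the exchange term.
      calc |κ| * (2 * Real.pi * ε * ‖q'‖ * m
              * ((2 * distortion + 3) * ∫ k, (1 + ‖k‖ ^ 2) * ‖W k‖)
            + 2 * ((N : ℝ)⁻¹ * (m * (‖p‖ + ‖q‖ + δ)) * ∫ k, ‖W k‖))
          ≤ |κ| * (2 * Real.pi * ε * (distortion * (‖p‖ + ‖q‖ + δ)) * m
              * ((2 * distortion + 3) * ∫ k, (1 + ‖k‖ ^ 2) * ‖W k‖)
            + 2 * (ε * (distortion * m * (‖p‖ + ‖q‖ + δ)) * ∫ k, ‖W k‖)) := by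
            gcongr
            · exact hq'n.trans (mul_le_mul_of_nonneg_left hlast hL0)
            · exact le_mul_of_one_le_left hm0 hL
        _ = (|κ| * ε) * (growthRate W * m * (‖p‖ + ‖q‖ + δ)) := by
            unfold growthRate; ring
        _ = _ := by rw [hκ, one_mul]
    · rw [frame_zero]
      refine (h0 _ _).mono ?_
      have := mul_nonneg hM hδ.le
      linarith
  have hunit : ∀ p q : Space, ‖p‖ + ‖q‖ ≤ 1 →
      TrLE (weyl ε p q * frame c ω t - frame c ω t * weyl ε p q)
        (M * Real.exp (growthRate W) * (‖p‖ + ‖q‖ + 0)) := by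
    intro p q hpq
    set G := M * Real.exp (growthRate W) with hG
    have hG0 : 0 ≤ G := by positivity
    refine TrLE.of_forall_lt fun η hη => ?_
    refine (main (min 1 (η / (G + 1))) (by positivity) (min_le_left _ _) p q hpq).mono ?_
    have h1 : G * min 1 (η / (G + 1)) ≤ G * (η / (G + 1)) :=
      mul_le_mul_of_nonneg_left (min_le_right _ _) hG0
    have h2 : G * (η / (G + 1)) ≤ η := by
      rw [mul_div_assoc', div_le_iff₀ (by positivity)]
      nlinarith
    linarith
  have hall := TrLE.comm_weyl_of_unit (by positivity) le_rfl hunit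
  refine (trLE_comm_weyl_of_frame hε.ne' (hall p _)).mono ?_
  have h1 := norm_add_distortion (p := p) (q := q) (hs' t ht)
  calc M * Real.exp (growthRate W) * (‖p‖ + ‖q + (-(c * t) / (Real.pi * ε)) • p‖
        + (‖p‖ + ‖q + (-(c * t) / (Real.pi * ε)) • p‖ + 1) * 0)
      = M * Real.exp (growthRate W) * (‖p‖ + ‖q + (-(c * t) / (Real.pi * ε)) • p‖) := by ring
    _ ≤ M * Real.exp (growthRate W) * (distortion * (‖p‖ + ‖q‖)) := by gcongr
    _ = _ := by ring

/-! ### Solutions of the Hartree-Fock equation -/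

/-- `B` is the mean-field potential of a trace class operator `Y`, in Fourier representation. -/
def IsPotential (W : Space → ℂ) (N : ℕ) (Y B : Op) : Prop :=
  ∃ (D X : Op) (a b : ℕ → OneParticle), B = D - X ∧ IsNuclearExpansion Y a b ∧
    (WeakIntegral D fun k => (W k * ((N : ℂ)⁻¹ * densityFT a b k)) • wave k) ∧
    WeakIntegral X fun k => (W k * (N : ℂ)⁻¹) • (wave k * Y * wave (-k))

/-- The Fourier transform of the density is at most Tr|Y| ≤ N, so after division by N the
coefficients are bounded by |W| uniformly in N. -/
theorem IsPotential.isMeanField {W : Space → ℂ} {N : ℕ} {Y B : Op} (h : IsPotential W N Y B)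
    (hN : 1 ≤ N) (hY : TrLE Y N) : IsMeanField W N Y B := by
  obtain ⟨D, X, a, b, hB, hab, hD, hX⟩ := h
  refine ⟨D, X, _, hB, fun k => ?_, hD, hX⟩
  rw [norm_mul, norm_mul, norm_inv, Complex.norm_natCast]
  have h1 := norm_densityFT_le hab hY k
  have hN0 : (0 : ℝ) < N := by exact_mod_cast hN
  have h2 : (N : ℝ)⁻¹ * ‖densityFT a b k‖ ≤ 1 := by
    rw [inv_mul_le_iff₀ hN0]; simpa using h1
  exact mul_le_of_le_one_right (norm_nonneg _) h2

theorem norm_wave_conj_le (k : Space) (Y : Op) : ‖wave k * Y * wave (-k)‖ ≤ ‖Y‖ := by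
  calc ‖wave k * Y * wave (-k)‖ ≤ ‖wave k‖ * ‖Y‖ * ‖wave (-k)‖ :=
        (norm_mul_le _ _).trans (mul_le_mul_of_nonneg_right (norm_mul_le _ _) (norm_nonneg _))
    _ ≤ 1 * ‖Y‖ * 1 := by gcongr <;> exact norm_wave_le _
    _ = ‖Y‖ := by ring

/-- Lipschitz dependence on Y in trace norm. It makes the mean field norm continuous in time
although expansions are chosen separately at each time. -/
theorem IsPotential.norm_sub_le {W : Space → ℂ} (hW : Integrable W) {N : ℕ} (hN : 1 ≤ N)
    {Y Y' B B' : Op} (h : IsPotential W N Y B) (h' : IsPotential W N Y' B') {η : ℝ}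
    (hη : TrLE (Y - Y') η) : ‖B - B'‖ ≤ 2 * η * ∫ k, ‖W k‖ := by
  obtain ⟨D, X, a, b, rfl, hab, hD, hX⟩ := h
  obtain ⟨D', X', a', b', rfl, hab', hD', hX'⟩ := h'
  have hN1 : (N : ℝ)⁻¹ ≤ 1 := inv_le_one_of_one_le₀ (by exact_mod_cast hN)
  have hη0 := hη.nonneg
  have h1 := (hD.sub hD').norm_le (M := fun k => η * ‖W k‖) (hW.norm.const_mul _) fun k => by
    have e1 := norm_trace_sub_le hab.1 hab.2 hab'.1 hab'.2 hη (wave (-k))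
    have e2 : ‖densityFT a b k - densityFT a' b' k‖ ≤ η :=
      e1.trans (mul_le_of_le_one_left hη0 (norm_wave_le _))
    rw [← sub_smul, ← mul_sub, ← mul_sub, norm_smul, norm_mul, norm_mul, norm_inv,
      Complex.norm_natCast]
    have e3 := norm_wave_le k
    calc ‖W k‖ * ((N : ℝ)⁻¹ * ‖densityFT a b k - densityFT a' b' k‖) * ‖wave k‖
        ≤ ‖W k‖ * (1 * η) * 1 := by gcongr
      _ = _ := by ring
  have h2 := (hX.sub hX').norm_le (M := fun k => η * ‖W k‖) (hW.norm.const_mul _) fun k => by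
    have e : (W k * (N : ℂ)⁻¹) • (wave k * Y * wave (-k))
        - (W k * (N : ℂ)⁻¹) • (wave k * Y' * wave (-k))
        = (W k * (N : ℂ)⁻¹) • (wave k * (Y - Y') * wave (-k)) := by
      rw [← smul_sub]; congr 1; noncomm_ring
    rw [e, norm_smul, norm_mul, norm_inv, Complex.norm_natCast]
    have e3 := (norm_wave_conj_le k (Y - Y')).trans hη.norm_le
    calc ‖W k‖ * (N : ℝ)⁻¹ * ‖wave k * (Y - Y') * wave (-k)‖ ≤ ‖W k‖ * 1 * η := by gcongr
      _ = _ := by ring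
  rw [integral_const_mul] at h1 h2
  have e : D - X - (D' - X') = (D - D') - (X - X') := by abel
  rw [e]
  linarith [_root_.norm_sub_le (D - D') (X - X')]

section Solution

variable {V : Space → ℝ} {W : Space → ℂ} {N : ℕ} {ε : ℝ} {ω : ℝ → Op}

theorem IsSolution.exists_potential (h : IsSolution V N ε ω) (hV : HasFourierTransform V W)
    (hW : Integrable W) : ∃ B : ℝ → Op, (∀ t, IsPotential W N (ω t) (B t)) ∧
      ∀ (t : ℝ) (φ ψ : 𝓢(Space, ℂ)), HasDerivAt
        (fun s => Complex.I * (ε : ℂ) * ⟪φ.toLp 2 volume, ω s (ψ.toLp 2 volume)⟫_ℂ)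
        (⟪(-((ε : ℂ) ^ 2 • Δ φ)).toLp 2 volume, ω t (ψ.toLp 2 volume)⟫_ℂ
          - ⟪φ.toLp 2 volume, ω t ((-((ε : ℂ) ^ 2 • Δ ψ)).toLp 2 volume)⟫_ℂ
          + ⟪φ.toLp 2 volume, (B t * ω t - ω t * B t) (ψ.toLp 2 volume)⟫_ℂ) t := by
  choose D X hD hX hd using h.equation
  refine ⟨fun t => D t - X t, fun t => ?_, hd⟩
  obtain ⟨a, b, hab, hD'⟩ := hD t
  obtain ⟨a', b', hab', hX'⟩ := hX t
  exact ⟨D t, X t, a, b, rfl, hab, weakIntegral_direct hV hW hab hD',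
    weakIntegral_exchange hV hW hab' hX'⟩

theorem IsSolution.trCont (h : IsSolution V N ε ω) : TrCont ω := fun t η hη => by
  filter_upwards [(h.continuous t).eventually_lt_const (ENNReal.ofReal_pos.2 hη)] with s hs
  exact (traceNorm_le_iff hη.le).1 hs.le

theorem IsSolution.continuous_potential (h : IsSolution V N ε ω) (hW : Integrable W) (hN : 1 ≤ N)
    {B : ℝ → Op} (hB : ∀ t, IsPotential W N (ω t) (B t)) : Continuous B := by
  refine continuous_iff_continuousAt.2 fun t => Metric.tendsto_nhds.2 fun r hr => ?_
  have hI : 0 ≤ ∫ k, ‖W k‖ := integral_nonneg fun _ => norm_nonneg _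
  filter_upwards [h.trCont t (r / (2 * (∫ k, ‖W k‖) + 1)) (by positivity)] with s hs
  rw [dist_eq_norm]
  refine ((hB s).norm_sub_le hW hN (hB t) hs).trans_lt ?_
  rw [mul_div_assoc', div_mul_eq_mul_div, div_lt_iff₀ (by positivity)]
  linarith

/-- Affine changes of time: with σ = ±1 the forward estimates also cover negative times, and t₀
allows a restart. -/
theorem IsSolution.weakEvolution (h : IsSolution V N ε ω) (hε : ε ≠ 0) (hW : Integrable W)
    (hN : 1 ≤ N) {B : ℝ → Op} (hB : ∀ t, IsPotential W N (ω t) (B t))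
    (hd : ∀ (t : ℝ) (φ ψ : 𝓢(Space, ℂ)), HasDerivAt
        (fun s => Complex.I * (ε : ℂ) * ⟪φ.toLp 2 volume, ω s (ψ.toLp 2 volume)⟫_ℂ)
        (⟪(-((ε : ℂ) ^ 2 • Δ φ)).toLp 2 volume, ω t (ψ.toLp 2 volume)⟫_ℂ
          - ⟪φ.toLp 2 volume, ω t ((-((ε : ℂ) ^ 2 • Δ ψ)).toLp 2 volume)⟫_ℂ
          + ⟪φ.toLp 2 volume, (B t * ω t - ω t * B t) (ψ.toLp 2 volume)⟫_ℂ) t)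
    (t₀ σ : ℝ) :
    WeakEvolution (σ / ε) ε (fun s => ω (t₀ + σ * s)) fun s => B (t₀ + σ * s) where
  selfAdjoint t := h.selfAdjoint _
  nuclear t := by
    obtain ⟨D, X, a, b, -, hab, -⟩ := hB (t₀ + σ * t)
    exact ⟨a, b, hab⟩
  trCont t η hη := by
    have hc : Tendsto (fun s => t₀ + σ * s) (𝓝 t) (𝓝 (t₀ + σ * t)) :=
      (by fun_prop : Continuous fun s => t₀ + σ * s).tendsto t
    exact hc.eventually (h.trCont (t₀ + σ * t) η hη)
  continuous := (h.continuous_potential hW hN hB).comp (by fun_prop)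
  deriv t φ ψ := by
    have h1 := (hd (t₀ + σ * t) φ ψ).const_mul (-Complex.I / ε)
    have hε' : (ε : ℂ) ≠ 0 := by exact_mod_cast hε
    have e : ∀ z : ℂ, -Complex.I / ε * (Complex.I * ε * z) = z := fun z => by
      field_simp
      rw [Complex.I_sq]; ring
    simp only [e] at h1
    have h2 : HasDerivAt (fun s => t₀ + σ * s) σ t := by
      simpa using ((hasDerivAt_id t).const_mul σ).const_add t₀
    have h3 := h1.scomp t h2
    convert! h3 using 1
    rw [Complex.real_smul]
    push_cast
    ring

/-- These two bounds are all that is later needed of the projection property at positive and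
negative times; neither norm grows in the frame, and the frame is undone by contractions. -/
theorem IsSolution.conserved (h : IsSolution V N ε ω) (hV : HasFourierTransform V W) (hε : ε ≠ 0)
    (hW : Integrable W) (hN : 1 ≤ N) {M : ℝ} (h0 : TrLE (ω 0) M) (h1 : ‖ω 0‖ ≤ 1) (t : ℝ) :
    TrLE (ω t) M ∧ ‖ω t‖ ≤ 1 := by
  obtain ⟨B, hB, hd⟩ := h.exists_potential hV hW
  have main : ∀ σ : ℝ, ∀ s, 0 ≤ s → TrLE (ω (σ * s)) M ∧ ‖ω (σ * s)‖ ≤ 1 := by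
    intro σ s hs
    have hev := (h.weakEvolution hε hW hN hB hd 0 σ).trEvolution
    simp only [zero_add] at hev
    set c := -(2 * Real.pi) ^ 2 * (σ / ε) * ε ^ 2
    have e0 : frame c (fun s => ω (σ * s)) 0 = ω 0 := by rw [frame_zero, mul_zero]
    have e1 : free (c * s) * frame c (fun s => ω (σ * s)) s * free (-(c * s)) = ω (σ * s) := by
      calc _ = (free (c * s) * free (-(c * s))) * ω (σ * s) * (free (c * s) * free (-(c * s))) := by
            simp only [frame]; noncomm_ring
        _ = _ := by rw [free_mul_neg, one_mul, mul_one]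
    have a1 := hev.tn_le (M := M) (by rwa [e0]) hs
    have a2 := hev.norm_le (M := 1) (by rwa [e0]) hs
    constructor
    · rw [← e1]
      exact (a1.contraction_mul (norm_free_le _)).mul_contraction (norm_free_le _)
    · rw [← e1]
      calc ‖free (c * s) * frame c (fun s => ω (σ * s)) s * free (-(c * s))‖
          ≤ ‖free (c * s)‖ * ‖frame c (fun s => ω (σ * s)) s‖ * ‖free (-(c * s))‖ :=
            (norm_mul_le _ _).trans (mul_le_mul_of_nonneg_right (norm_mul_le _ _) (norm_nonneg _))
        _ ≤ 1 * 1 * 1 := by gcongr <;> exact norm_free_le _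
        _ = 1 := by norm_num
  rcases le_total 0 t with ht | ht
  · simpa using main 1 t ht
  · simpa using main (-1) (-t) (by linarith)

theorem IsSolution.comm_weyl_le (h : IsSolution V N ε ω) (hV : HasFourierTransform V W) (hε : 0 < ε)
    (hNε : (N : ℝ)⁻¹ ≤ ε) (hW : Integrable W) (hW2 : Integrable fun k => (1 + ‖k‖ ^ 2) * ‖W k‖)
    (hN : 1 ≤ N) (h0 : TrLE (ω 0) N) (h1 : ‖ω 0‖ ≤ 1) {M : ℝ}
    (hM : ∀ p q, TrLE (weyl ε p q * ω 0 - ω 0 * weyl ε p q) (M * (‖p‖ + ‖q‖))) (n : ℕ) :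
    ∀ t : ℝ, |t| ≤ n → ∀ p q, TrLE (weyl ε p q * ω t - ω t * weyl ε p q)
      ((distortion * Real.exp (growthRate W)) ^ n * M * (‖p‖ + ‖q‖)) := by
  obtain ⟨B, hB, hd⟩ := h.exists_potential hV hW
  have hcons := h.conserved hV hε.ne' hW hN h0 h1
  induction n with
  | zero =>
    intro t ht p q
    have : t = 0 := by simpa using ht
    subst this
    simpa using hM p q
  | succ n ih =>
    intro t ht p q
    have key : ∀ σ t₀ s : ℝ, |σ| = 1 → |t₀| ≤ n → s ∈ Set.Icc (0 : ℝ) 1 → t₀ + σ * s = t →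
        TrLE (weyl ε p q * ω t - ω t * weyl ε p q)
          ((distortion * Real.exp (growthRate W)) ^ (n + 1) * M * (‖p‖ + ‖q‖)) := by
      intro σ t₀ s hσ ht₀ hs e
      have := (h.weakEvolution hε.ne' hW hN hB hd t₀ σ).comm_weyl_le hε
        (by rw [abs_div, hσ, abs_of_pos hε, one_div_mul_cancel hε.ne']) hNε hW hW2
        (fun t => (hB _).isMeanField hN (hcons _).1) (fun t => (hcons _).2)
        (M := (distortion * Real.exp (growthRate W)) ^ n * M)
        (by simpa using ih t₀ ht₀) hs p q
      simp only [e] at this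
      refine this.mono (le_of_eq ?_)
      rw [pow_succ]; ring
    push_cast at ht
    rw [abs_le] at ht
    -- For |t| ≤ 1 the evolution starts at 0, otherwise one unit of time nearer to 0 than t, where
    -- the induction hypothesis applies.
    rcases le_total 0 t with h0 | h0
    · rcases le_total t 1 with h2 | h2
      · exact key 1 0 t (by simp) (by simp) ⟨h0, h2⟩ (by ring)
      · exact key 1 (t - 1) 1 (by simp) (abs_le.2 ⟨by linarith, by linarith⟩) (by simp) (by ring)
    · rcases le_total (-1) t with h2 | h2
      · exact key (-1) 0 (-t) (by simp) (by simp) ⟨by linarith, by linarith⟩ (by ring)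
      · exact key (-1) (t + 1) 1 (by simp) (abs_le.2 ⟨by linarith, by linarith⟩) (by simp) (by ring)

end Solution

/-! ### Commutators with unbounded multiplication operators -/

/-- Bounded families of operators converge weakly along ultrafilters. -/
theorem exists_weak_limit {α : Type*} (U : Ultrafilter α) {T : α → Op} {M : ℝ}
    (hT : ∀ s, ‖T s‖ ≤ M) :
    ∃ C : Op, ∀ f g, Tendsto (fun s => ⟪f, T s g⟫_ℂ) U (𝓝 ⟪f, C g⟫_ℂ) := by
  have hb : ∀ (f g : OneParticle) (s : α), ‖⟪T s f, g⟫_ℂ‖ ≤ M * ‖f‖ * ‖g‖ := fun f g s =>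
    (norm_inner_le_norm _ _).trans
      (mul_le_mul_of_nonneg_right ((T s).le_of_opNorm_le (hT s) f) (norm_nonneg g))
  have hex : ∀ f g : OneParticle, ∃ z : ℂ, Tendsto (fun s => ⟪T s f, g⟫_ℂ) U (𝓝 z) := by
    intro f g
    obtain ⟨z, -, hz⟩ := (isCompact_closedBall (0 : ℂ) (M * ‖f‖ * ‖g‖)).ultrafilter_le_nhds
      (U.map fun s => ⟪T s f, g⟫_ℂ) (le_principal_iff.2 (Ultrafilter.mem_map.2
        (univ_mem' fun s => mem_closedBall_zero_iff.2 (hb f g s))))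
    exact ⟨z, hz⟩
  choose B hB using hex
  let L : OneParticle →ₗ⋆[ℂ] OneParticle →ₗ[ℂ] ℂ := LinearMap.mk₂'ₛₗ _ _ B
    (fun f f' g => tendsto_nhds_unique (hB _ _) (by
      simpa only [map_add, inner_add_left] using (hB f g).add (hB f' g)))
    (fun c f g => tendsto_nhds_unique (hB _ _) (by
      simpa only [map_smul, inner_smul_left, smul_eq_mul] using (hB f g).const_mul (conj c)))
    (fun f g g' => tendsto_nhds_unique (hB _ _) (by
      simpa only [inner_add_right] using (hB f g).add (hB f g')))
    (fun c f g => tendsto_nhds_unique (hB _ _) (by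
      simpa only [inner_smul_right, smul_eq_mul, RingHom.id_apply] using (hB f g).const_mul c))
  have hL : ∀ f g, ‖L f g‖ ≤ M * ‖f‖ * ‖g‖ := fun f g =>
    le_of_tendsto (hB f g).norm (Eventually.of_forall (hb f g))
  refine ⟨InnerProductSpace.continuousLinearMapOfBilin (L.mkContinuous₂ M hL), fun f g => ?_⟩
  have h1 : ⟪InnerProductSpace.continuousLinearMapOfBilin (L.mkContinuous₂ M hL) g, f⟫_ℂ
      = B g f := InnerProductSpace.continuousLinearMapOfBilin_apply _ g f
  rw [← inner_conj_symm, h1]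
  have h2 := (Complex.continuous_conj.tendsto _).comp (hB g f)
  refine h2.congr fun s => ?_
  exact inner_conj_symm f (T s g)

/-- The graph of multiplication by `θ`. -/
def MulGraph (θ : C(Space, ℝ)) (f g : OneParticle) : Prop :=
  (g : Space → ℂ) =ᵐ[volume] fun x => ((θ x : ℝ) : ℂ) * f x

theorem MulGraph.symm {θ : C(Space, ℝ)} {f f' g g' : OneParticle} (hf : MulGraph θ f f')
    (hg : MulGraph θ g g') : ⟪f', g⟫_ℂ = ⟪f, g'⟫_ℂ := by
  rw [L2.inner_def, L2.inner_def]
  refine integral_congr_ae ?_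
  filter_upwards [hf, hg] with x h1 h2
  rw [h1, h2]
  simp only [RCLike.inner_apply, map_mul, Complex.conj_ofReal]
  ring

theorem MulGraph.phase {θ η : C(Space, ℝ)} {f f' : OneParticle} (hf : MulGraph θ f f') :
    MulGraph θ (phase η f) (phase η f') := by
  filter_upwards [hf, coeFn_phase η f, coeFn_phase η f'] with x h1 h2 h3
  rw [h3, h1, h2]; ring

theorem hasDerivAt_inner_phase {θ : C(Space, ℝ)} {f f' g g' : OneParticle} (hf : MulGraph θ f f')
    (hg : MulGraph θ g g') (A : Op) (s : ℝ) :
    HasDerivAt (fun s : ℝ => ⟪phase (s • θ) f, A (phase (s • θ) g)⟫_ℂ)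
      (Complex.I * (⟪phase (s • θ) f, A (phase (s • θ) g')⟫_ℂ
        - ⟪phase (s • θ) f', A (phase (s • θ) g)⟫_ℂ)) s := by
  have h1 := hasDerivAt_phase hf s
  have h2 := (A.restrictScalars ℝ).hasFDerivAt.comp_hasDerivAt s (hasDerivAt_phase hg s)
  have h3 := h1.inner ℂ h2
  convert! h3 using 1
  simp only [ContinuousLinearMap.coe_restrictScalars', map_smul, inner_smul_left, inner_smul_right,
    Complex.conj_I, Function.comp_apply]
  ring

theorem contractive_cutoff (θ : C(Space, ℝ)) (n : ℕ) :
    Contractive fun x => if |θ x| ≤ n + 1 then 1 else 0 := by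
  refine ⟨Measurable.ite (measurableSet_le (by fun_prop) (by fun_prop)) measurable_const
    measurable_const, fun x => ?_⟩
  dsimp only
  split_ifs <;> simp

/-- Multiplication by the indicator function of `{|θ| ≤ n + 1}`. -/
def cutoff (θ : C(Space, ℝ)) (n : ℕ) : Op := mulOp _ (contractive_cutoff θ n)

theorem contractive_cutoff_mul (θ : C(Space, ℝ)) (n : ℕ) :
    Contractive fun x => if |θ x| ≤ n + 1 then ((θ x / (n + 1) : ℝ) : ℂ) else 0 := by
  refine ⟨Measurable.ite (measurableSet_le (by fun_prop) (by fun_prop)) (by fun_prop)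
    measurable_const, fun x => ?_⟩
  dsimp only
  split_ifs with h
  · rw [Complex.norm_real, Real.norm_eq_abs, abs_div, abs_of_pos (by positivity : (0 : ℝ) < n + 1)]
    exact (div_le_one (by positivity)).2 h
  · simp

theorem mulGraph_cutoff (θ : C(Space, ℝ)) (n : ℕ) (f : OneParticle) :
    MulGraph θ (cutoff θ n f) (((n : ℂ) + 1) • mulOp _ (contractive_cutoff_mul θ n) f) := by
  filter_upwards [coeFn_mulOp (contractive_cutoff θ n) f,
    coeFn_mulOp (contractive_cutoff_mul θ n) f,
    Lp.coeFn_smul ((n : ℂ) + 1) (mulOp _ (contractive_cutoff_mul θ n) f)] with x h1 h2 h3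
  rw [h3, Pi.smul_apply, h2, cutoff, h1, smul_eq_mul]
  have : (n : ℂ) + 1 ≠ 0 := by exact_mod_cast n.succ_ne_zero
  split_ifs
  · push_cast; field_simp
  · simp

theorem star_cutoff (θ : C(Space, ℝ)) (n : ℕ) : star (cutoff θ n) = cutoff θ n := by
  rw [cutoff, star_mulOp]
  refine mulOp_congr _ _ fun x => ?_
  split_ifs <;> simp

theorem tendsto_cutoff (θ : C(Space, ℝ)) (f : OneParticle) :
    Tendsto (fun n => cutoff θ n f) atTop (𝓝 f) := by
  rw [← tendsto_sub_nhds_zero_iff]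
  refine tendsto_zero_of_dominated
    (v := fun n x => (if |θ x| ≤ n + 1 then 1 else 0) * f x - f x) (fun n => ?_) f
    (Eventually.of_forall fun n => Eventually.of_forall fun x => ?_)
    (Eventually.of_forall fun x => ?_)
  · filter_upwards [coeFn_mulOp (contractive_cutoff θ n) f, Lp.coeFn_sub (cutoff θ n f) f]
      with x h1 h2
    rw [h2, Pi.sub_apply, cutoff, h1]
  · split_ifs <;> simp
  · obtain ⟨n, hn⟩ := exists_nat_ge |θ x|
    refine tendsto_const_nhds.congr' ?_
    filter_upwards [eventually_ge_atTop n] with m hm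
    have : |θ x| ≤ m + 1 := by
      have : (n : ℝ) ≤ m := by exact_mod_cast hm
      linarith
    simp [this]

/-- The derivative of exp(−isθ) A exp(isθ) is −i exp(−isθ) C exp(isθ), of trace norm at most M, and
is integrated from 0 to s. As θ may be unbounded, this is done between cutoffs mapping into its
domain, which are then removed by weak lower semicontinuity. -/
theorem trLE_comm_phase {θ : C(Space, ℝ)} {A C : Op} {M : ℝ} (h : IsCommutator (MulGraph θ) A C)
    (hC : TrLE C M) (s : ℝ) :
    TrLE (phase (s • θ) * A - A * phase (s • θ)) (|s| * M) := by
  set T : Op := phase (-(s • θ)) * A * phase (s • θ) - A with hT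
  have hcut : ∀ n, TrLE (cutoff θ n * T * cutoff θ n) (|s| * M) := by
    intro n m f g hf hg
    set F : ℝ → ℂ := fun s => ∑ i, ⟪phase (s • θ) (cutoff θ n (f i)),
      A (phase (s • θ) (cutoff θ n (g i)))⟫_ℂ with hF
    have hd : ∀ r : ℝ, HasDerivAt F (∑ i, -(Complex.I * ⟪phase (r • θ) (cutoff θ n (f i)),
        C (phase (r • θ) (cutoff θ n (g i)))⟫_ℂ)) r := by
      intro r
      refine HasDerivAt.fun_sum fun i _ => ?_
      have h1 := hasDerivAt_inner_phase (mulGraph_cutoff θ n (f i)) (mulGraph_cutoff θ n (g i)) A r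
      have h2 := (mulGraph_cutoff θ n (f i)).phase (η := r • θ)
      have h3 := (mulGraph_cutoff θ n (g i)).phase (η := r • θ)
      rw [h2.symm (h _ _ h3), inner_add_right] at h1
      convert! h1 using 1
      ring
    have hb : ∀ r : ℝ, ‖∑ i, -(Complex.I * ⟪phase (r • θ) (cutoff θ n (f i)),
        C (phase (r • θ) (cutoff θ n (g i)))⟫_ℂ)‖ ≤ M := by
      intro r
      rw [Finset.sum_neg_distrib, ← Finset.mul_sum, norm_neg, norm_mul, Complex.norm_I, one_mul]
      exact hC m _ _ ((hf.map (norm_mulOp_le _)).map (norm_phase_le _))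
        ((hg.map (norm_mulOp_le _)).map (norm_phase_le _))
    have := Convex.norm_image_sub_le_of_norm_hasDerivWithin_le
      (s := Set.univ) (fun (r : ℝ) _ => (hd r).hasDerivWithinAt) (fun r _ => hb r) convex_univ
      (Set.mem_univ (0 : ℝ)) (Set.mem_univ s)
    rw [sub_zero, Real.norm_eq_abs, mul_comm] at this
    refine le_trans (le_of_eq (congrArg _ ?_)) this
    rw [hF]
    simp only [← Finset.sum_sub_distrib]
    refine Finset.sum_congr rfl fun i _ => ?_
    rw [zero_smul, phase_zero, op_mul_apply, op_mul_apply, ← ContinuousLinearMap.adjoint_inner_left,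
      ← ContinuousLinearMap.star_eq_adjoint, star_cutoff, hT, sub_apply, inner_sub_right,
      op_mul_apply, op_mul_apply, ← ContinuousLinearMap.adjoint_inner_left,
      ← ContinuousLinearMap.star_eq_adjoint, star_phase, neg_neg]
    rfl
  have hTr : TrLE T (|s| * M) := by
    refine trLE_of_tendsto (Eventually.of_forall hcut) (l := atTop) fun f g => ?_
    have e : ∀ n, ⟪f, (cutoff θ n * T * cutoff θ n) g⟫_ℂ = ⟪cutoff θ n f, T (cutoff θ n g)⟫_ℂ := by
      intro n
      rw [op_mul_apply, op_mul_apply, ← ContinuousLinearMap.adjoint_inner_left,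
        ← ContinuousLinearMap.star_eq_adjoint, star_cutoff]
    simp only [e]
    exact (tendsto_cutoff θ f).inner ((T.continuous.tendsto _).comp (tendsto_cutoff θ g))
  have h1 := (hTr.contraction_mul (norm_phase_le (s • θ))).neg
  have e : phase (s • θ) * A - A * phase (s • θ) = -(phase (s • θ) * T) := by
    rw [hT, mul_sub, ← mul_assoc, ← mul_assoc, phase_mul_neg, one_mul]
    abel
  rwa [e]

/-- C is a weak limit of difference quotients of exp(−isθ) A exp(isθ), along an ultrafilter so that
compactness provides the limit. The resulting form identity places A g in the domain of the adjoint
of θ; self-adjointness of θ is made concrete by testing on the sets |θ| ≤ n + 1. -/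
theorem exists_commutator {θ : C(Space, ℝ)} {A : Op} {M : ℝ}
    (h : ∀ s : ℝ, TrLE (phase (s • θ) * A - A * phase (s • θ)) (|s| * M)) :
    ∃ C, IsCommutator (MulGraph θ) A C ∧ TrLE C M := by
  have hM : 0 ≤ M := by simpa using (h 1).nonneg
  set T : ℝ → Op := fun s => (Complex.I * (s : ℂ)⁻¹) • (phase (-(s • θ)) * A * phase (s • θ) - A)
    with hT
  have hTM : ∀ s, TrLE (T s) M := by
    intro s
    have h1 := (((h s).contraction_mul (norm_phase_le (-(s • θ)))).neg).smul (Complex.I * (s : ℂ)⁻¹)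
    have e : -(phase (-(s • θ)) * (phase (s • θ) * A - A * phase (s • θ)))
        = phase (-(s • θ)) * A * phase (s • θ) - A := by
      rw [mul_sub, ← mul_assoc, ← mul_assoc, phase_neg_mul, one_mul]
      abel
    rw [e] at h1
    refine h1.mono ?_
    rw [norm_mul, Complex.norm_I, one_mul, norm_inv, Complex.norm_real, Real.norm_eq_abs,
      ← mul_assoc]
    exact mul_le_of_le_one_left hM inv_mul_le_one
  set U : Ultrafilter ℝ := Ultrafilter.of (𝓝[≠] (0 : ℝ)) with hU
  obtain ⟨C, hC⟩ := exists_weak_limit U fun s => (hTM s).norm_le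
  refine ⟨C, ?_, trLE_of_tendsto (Eventually.of_forall hTM) hC⟩
  have hform : ∀ f f' g g', MulGraph θ f f' → MulGraph θ g g' →
      ⟪f', A g⟫_ℂ = ⟪f, A g' + C g⟫_ℂ := by
    intro f f' g g' hf hg
    have h1 := (hasDerivAt_iff_tendsto_slope.1 (hasDerivAt_inner_phase hf hg A 0)).mono_left
      (Ultrafilter.of_le (𝓝[≠] (0 : ℝ)))
    have h2 := h1.const_mul Complex.I
    have h3 : Tendsto (fun s => ⟪f, T s g⟫_ℂ) U (𝓝 (Complex.I *
        (Complex.I * (⟪phase ((0 : ℝ) • θ) f, A (phase ((0 : ℝ) • θ) g')⟫_ℂ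
        - ⟪phase ((0 : ℝ) • θ) f', A (phase ((0 : ℝ) • θ) g)⟫_ℂ)))) := by
      refine h2.congr fun s => ?_
      rw [hT, slope, sub_zero, vsub_eq_sub, zero_smul, phase_zero, smul_apply, inner_smul_right,
        sub_apply, inner_sub_right, op_mul_apply, op_mul_apply,
        ← ContinuousLinearMap.adjoint_inner_left (phase (-(s • θ))),
        ← ContinuousLinearMap.star_eq_adjoint, star_phase, neg_neg, Complex.real_smul, mul_assoc,
        Complex.ofReal_inv]
      rfl
    have h4 := tendsto_nhds_unique h3 (hC f g)
    rw [zero_smul, phase_zero, ← mul_assoc, Complex.I_mul_I] at h4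
    rw [inner_add_right, ← h4]
    simp only [one_apply_eq_self]
    ring
  intro g g' hg
  have hloc : ∀ n : ℕ, ((n : ℂ) + 1) • mulOp _ (contractive_cutoff_mul θ n) (A g)
      = cutoff θ n (A g' + C g) := by
    intro n
    refine ext_inner_left ℂ fun φ => ?_
    have h1 := hform _ _ _ _ (mulGraph_cutoff θ n φ) hg
    have e1 : star (mulOp _ (contractive_cutoff_mul θ n)) = mulOp _ (contractive_cutoff_mul θ n) := by
      rw [star_mulOp]
      refine mulOp_congr _ _ fun x => ?_
      split_ifs
      · exact Complex.conj_ofReal _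
      · simp
    rw [← star_cutoff, ContinuousLinearMap.star_eq_adjoint, ContinuousLinearMap.adjoint_inner_right,
      ← h1, inner_smul_left, inner_smul_right, ← e1, ContinuousLinearMap.star_eq_adjoint,
      ContinuousLinearMap.adjoint_inner_right, ← ContinuousLinearMap.star_eq_adjoint, e1]
    simp
  have hae : ∀ᵐ x : Space, ∀ n : ℕ,
      ((((n : ℂ) + 1) • mulOp _ (contractive_cutoff_mul θ n) (A g) : OneParticle) : Space → ℂ) x
        = (θ x : ℂ) * (cutoff θ n (A g)) x :=
    ae_all_iff.2 fun n => mulGraph_cutoff θ n (A g)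
  have hae2 : ∀ᵐ x : Space, ∀ n : ℕ,
      (cutoff θ n (A g) : Space → ℂ) x = (if |θ x| ≤ n + 1 then 1 else 0) * (A g) x :=
    ae_all_iff.2 fun n => coeFn_mulOp (contractive_cutoff θ n) (A g)
  have hae3 : ∀ᵐ x : Space, ∀ n : ℕ,
      (cutoff θ n (A g' + C g) : Space → ℂ) x
        = (if |θ x| ≤ n + 1 then 1 else 0) * (A g' + C g : OneParticle) x :=
    ae_all_iff.2 fun n => coeFn_mulOp (contractive_cutoff θ n) (A g' + C g)
  simp only [MulGraph]
  filter_upwards [hae, hae2, hae3] with x h1 h2 h3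
  obtain ⟨n, hn⟩ := exists_nat_ge |θ x|
  have hn' : |θ x| ≤ n + 1 := by linarith
  have h4 := h1 n
  rw [hloc, h3, h2, if_pos hn', one_mul, one_mul] at h4
  exact h4

/-! ### Position and gradient as generators of Weyl operators -/

/-- The coordinate `x_j`. -/
def coord (j : Fin 3) : C(Space, ℝ) := ⟨fun x => x j, by fun_prop⟩

theorem linPhase_single (j : Fin 3) (s : ℝ) :
    linPhase (s • EuclideanSpace.single j 1) = (2 * Real.pi * s) • coord j := by
  ext x
  simp [coord, inner_smul_left, EuclideanSpace.inner_single_left]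
  ring

theorem integral_fourier_mul (w : 𝓢(Space, ℂ)) (f : OneParticle) :
    ∫ x, (𝓕 w) x * f x = ∫ x, w x * (fourierL2 f) x := by
  have h := congrArg (fun T : 𝓢'(Space, ℂ) => T w) (Lp.fourier_toTemperedDistribution_eq f)
  rw [TemperedDistribution.fourier_apply, Lp.toTemperedDistribution_apply,
    Lp.toTemperedDistribution_apply] at h
  exact h

theorem lineDeriv_fourier_single (j : Fin 3) (w : 𝓢(Space, ℂ)) :
    ∃ v : 𝓢(Space, ℂ), (∀ x, v x = -(2 * Real.pi * Complex.I) * ((x j : ℝ) * w x)) ∧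
      ∂_{(EuclideanSpace.single j (1 : ℝ) : Space)} (𝓕 w) = 𝓕 v := by
  have ht : (fun x : Space => ⟪x, EuclideanSpace.single j (1 : ℝ)⟫_ℝ).HasTemperateGrowth := by
    fun_prop
  refine ⟨_, fun x => ?_, SchwartzMap.lineDerivOp_fourier_eq w _⟩
  rw [smul_apply, SchwartzMap.smulLeftCLM_apply_apply ht]
  simp [EuclideanSpace.inner_single_right]

/-- Testing with Fourier transforms of Schwartz functions turns the weak derivative into
multiplication by 2πiε ξ_j. The factor −i makes the multiplier real, so the results on real
multiplication operators apply. -/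
theorem scaledGradient_iff {ε : ℝ} {j : Fin 3} {f g : OneParticle} :
    ScaledGradient ε j f g ↔
      MulGraph ((2 * Real.pi * ε) • coord j) (fourierL2 f) (-Complex.I • fourierL2 g) := by
  have hw : ScaledGradient ε j f g ↔ ∀ w : 𝓢(Space, ℂ),
      ∫ x, w x * ((2 * Real.pi * Complex.I * ε * (x j : ℝ)) * (fourierL2 f) x)
        = ∫ x, w x * (fourierL2 g) x := by
    have hφ : ScaledGradient ε j f g ↔ ∀ w : 𝓢(Space, ℂ),
        (ε : ℂ) * ∫ x, (∂_{(EuclideanSpace.single j (1 : ℝ) : Space)} (𝓕 w)) x * f x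
          = - ∫ x, (𝓕 w) x * g x :=
      ⟨fun h w => h _, fun h φ => by simpa using h (𝓕⁻ φ)⟩
    rw [hφ]
    refine forall_congr' fun w => ?_
    obtain ⟨v, hv, e⟩ := lineDeriv_fourier_single j w
    rw [e, integral_fourier_mul, integral_fourier_mul, ← integral_const_mul, eq_neg_iff_add_eq_zero,
      ← sub_eq_zero (a := ∫ x, w x * _), ← neg_eq_zero, neg_add, ← sub_eq_add_neg,
      ← integral_neg]
    refine Eq.congr (congrArg (· - _) (integral_congr_ae (Eventually.of_forall fun x => ?_))) rfl
    dsimp only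
    rw [hv]
    ring
  have hcoe : MulGraph ((2 * Real.pi * ε) • coord j) (fourierL2 f) (-Complex.I • fourierL2 g) ↔
      ∀ᵐ x : Space, (2 * Real.pi * Complex.I * ε * (x j : ℝ)) * (fourierL2 f) x
        = (fourierL2 g) x := by
    refine eventually_congr ?_
    filter_upwards [Lp.coeFn_smul (-Complex.I) (fourierL2 g)] with x hx
    rw [hx, Pi.smul_apply, smul_eq_mul]
    have e : (((2 * Real.pi * ε) • coord j) x : ℝ) = 2 * Real.pi * ε * x j := rfl
    rw [e]
    push_cast
    constructor
    · intro h
      linear_combination (-Complex.I) * h - (fourierL2 g x) * Complex.I_sq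
    · intro h
      linear_combination Complex.I * h
        - (2 * Real.pi * ε * (x j : ℝ) * (fourierL2 f) x) * Complex.I_sq
  rw [hw, hcoe]
  refine ⟨fun h => ?_, fun h w => ?_⟩
  · have l1 : LocallyIntegrable (fourierL2 f : Space → ℂ) volume :=
      (Lp.memLp (fourierL2 f)).locallyIntegrable (by norm_num)
    have l2 : LocallyIntegrable (fourierL2 g : Space → ℂ) volume :=
      (Lp.memLp (fourierL2 g)).locallyIntegrable (by norm_num)
    refine ae_eq_of_integral_contDiff_smul_eq ?_ l2 fun φ hφ hc => ?_
    · refine locallyIntegrableOn_univ.1 ((locallyIntegrableOn_univ.2 l1).continuousOn_mul ?_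
        isOpen_univ.isLocallyClosed)
      fun_prop
    · have hφ' : ContDiff ℝ ((⊤ : ℕ∞) : WithTop ℕ∞) fun x => (φ x : ℂ) :=
        Complex.ofRealCLM.contDiff.comp hφ
      have hc' : HasCompactSupport fun x => (φ x : ℂ) := hc.comp_left Complex.ofReal_zero
      simpa [Complex.real_smul] using h (hc'.toSchwartzMap hφ')
  · refine integral_congr_ae ?_
    filter_upwards [h] with x hx
    rw [hx]

theorem isCommutator_scaledGradient_iff {ε : ℝ} {j : Fin 3} {A C : Op} :
    IsCommutator (ScaledGradient ε j) A C ↔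
      IsCommutator (MulGraph ((2 * Real.pi * ε) • coord j)) (fconj.symm A)
        (-Complex.I • fconj.symm C) := by
  constructor
  · intro h f g hfg
    have h1 : ScaledGradient ε j (fourierL2.symm f) (fourierL2.symm (Complex.I • g)) := by
      rw [scaledGradient_iff]
      simpa [smul_smul] using hfg
    have h2 := scaledGradient_iff.1 (h _ _ h1)
    simpa [fconj_symm_apply, smul_smul, smul_add] using h2
  · intro h f g hfg
    have h1 := h _ _ (scaledGradient_iff.1 hfg)
    rw [scaledGradient_iff]
    simpa [fconj_symm_apply, smul_add] using h1

theorem commutatorTraceLE_mulGraph_iff {θ : C(Space, ℝ)} {A : Op} {M : ℝ} (hM : 0 ≤ M) :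
    CommutatorTraceLE (MulGraph θ) A M ↔
      ∀ s : ℝ, TrLE (phase (s • θ) * A - A * phase (s • θ)) (|s| * M) := by
  constructor
  · rintro ⟨C, hC, hC2⟩ s
    exact trLE_comm_phase hC ((traceNorm_le_iff hM).1 hC2) s
  · intro h
    obtain ⟨C, hC, hC2⟩ := exists_commutator h
    exact ⟨C, hC, (traceNorm_le_iff hM).2 hC2⟩

theorem commutatorTraceLE_position_iff {j : Fin 3} {A : Op} {M : ℝ} (hM : 0 ≤ M) :
    CommutatorTraceLE (Position j) A M ↔ ∀ s : ℝ,
      TrLE (wave (s • EuclideanSpace.single j 1) * A - A * wave (s • EuclideanSpace.single j 1))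
        (2 * Real.pi * |s| * M) := by
  refine (commutatorTraceLE_mulGraph_iff (θ := coord j) hM).trans ?_
  have hπ := Real.two_pi_pos
  refine ⟨fun h s => ?_, fun h s => ?_⟩
  · have := h (2 * Real.pi * s)
    rwa [abs_mul, abs_of_pos hπ, ← linPhase_single] at this
  · have := h (s / (2 * Real.pi))
    rw [abs_div, abs_of_pos hπ, mul_div_cancel₀ _ hπ.ne', wave, linPhase_single,
      mul_div_cancel₀ _ hπ.ne'] at this
    exact this

theorem commutatorTraceLE_scaledGradient_iff {ε : ℝ} {j : Fin 3} {A : Op} {M : ℝ} (hM : 0 ≤ M) :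
    CommutatorTraceLE (ScaledGradient ε j) A M ↔ ∀ s : ℝ,
      TrLE (shift (ε • s • EuclideanSpace.single j 1) * A
        - A * shift (ε • s • EuclideanSpace.single j 1)) (|s| * M) := by
  have h1 : CommutatorTraceLE (ScaledGradient ε j) A M ↔
      CommutatorTraceLE (MulGraph ((2 * Real.pi * ε) • coord j)) (fconj.symm A) M := by
    constructor
    · rintro ⟨C, hC, hC2⟩
      refine ⟨_, isCommutator_scaledGradient_iff.1 hC, ?_⟩
      rw [traceNorm_le_iff hM] at hC2 ⊢
      simpa using hC2.fconj_symm.smul (-Complex.I)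
    · rintro ⟨C, hC, hC2⟩
      refine ⟨fconj (Complex.I • C), isCommutator_scaledGradient_iff.2 (by simpa [smul_smul]), ?_⟩
      rw [traceNorm_le_iff hM] at hC2 ⊢
      simpa using (hC2.smul Complex.I).fconj
  rw [h1, commutatorTraceLE_mulGraph_iff hM]
  refine forall_congr' fun s => ?_
  have e1 : shift (ε • s • EuclideanSpace.single j 1)
      = fconj (phase (s • (2 * Real.pi * ε) • coord j)) := by
    rw [shift, smul_smul, linPhase_single, smul_smul]
    congr 3
    ring
  have e2 : fconj (phase (s • (2 * Real.pi * ε) • coord j) * fconj.symm A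
      - fconj.symm A * phase (s • (2 * Real.pi * ε) • coord j))
      = shift (ε • s • EuclideanSpace.single j 1) * A
        - A * shift (ε • s • EuclideanSpace.single j 1) := by
    rw [map_sub, map_mul, map_mul, e1, StarAlgEquiv.apply_symm_apply]
  rw [← e2]
  refine ⟨fun h => h.fconj, fun h => ?_⟩
  simpa using h.fconj_symm

/-! ### From coordinate commutators to Weyl operators, and the conclusion -/

theorem eq_sum_single (p : Space) :
    p = p 0 • EuclideanSpace.single 0 1 + p 1 • EuclideanSpace.single 1 1
      + p 2 • EuclideanSpace.single 2 1 := by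
  ext j
  fin_cases j <;> simp

/-- The Leibniz rule over the coordinates. The constant 6π is three coordinates times the 2π in the
plane waves; translations alone would need only 3. -/
theorem comm_weyl_le_of_coord {ε : ℝ} {A : Op} {M : ℝ} (hM : 0 ≤ M)
    (hx : ∀ j, CommutatorTraceLE (Position j) A M)
    (hd : ∀ j, CommutatorTraceLE (ScaledGradient ε j) A M) (p q : Space) :
    TrLE (weyl ε p q * A - A * weyl ε p q) (6 * Real.pi * M * (‖p‖ + ‖q‖)) := by
  have hπ := Real.pi_gt_three
  have h1 := fun j => (commutatorTraceLE_position_iff hM).1 (hx j) (p j)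
  have h2 := fun j => (commutatorTraceLE_scaledGradient_iff hM).1 (hd j) (q j)
  have hp : TrLE (wave p * A - A * wave p) (6 * Real.pi * M * ‖p‖) := by
    have n1 := norm_mul_le (wave (p 0 • EuclideanSpace.single 0 1))
      (wave (p 1 • EuclideanSpace.single 1 1))
    have := ((h1 0).comm_mul (h1 1) (norm_wave_le _) (norm_wave_le _)).comm_mul (h1 2)
      (n1.trans (mul_le_one₀ (norm_wave_le _) (norm_nonneg _) (norm_wave_le _))) (norm_wave_le _)
    rw [← wave_add, ← wave_add, ← eq_sum_single] at this
    refine this.mono ?_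
    have b : ∀ j, 2 * Real.pi * |p j| * M ≤ 2 * Real.pi * ‖p‖ * M := fun j => by
      have := PiLp.norm_apply_le p j
      rw [Real.norm_eq_abs] at this
      gcongr
    linarith [b 0, b 1, b 2]
  have hq : TrLE (shift (ε • q) * A - A * shift (ε • q)) (6 * Real.pi * M * ‖q‖) := by
    have n1 := norm_mul_le (shift (ε • q 0 • EuclideanSpace.single 0 1))
      (shift (ε • q 1 • EuclideanSpace.single 1 1))
    have := ((h2 0).comm_mul (h2 1) (norm_shift_le _) (norm_shift_le _)).comm_mul (h2 2)
      (n1.trans (mul_le_one₀ (norm_shift_le _) (norm_nonneg _) (norm_shift_le _)))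
      (norm_shift_le _)
    rw [← shift_add, ← shift_add, ← smul_add, ← smul_add, ← eq_sum_single] at this
    refine this.mono ?_
    have b : ∀ j, |q j| * M ≤ ‖q‖ * M := fun j => by
      have := PiLp.norm_apply_le q j
      rw [Real.norm_eq_abs] at this
      gcongr
    have : 3 * (‖q‖ * M) ≤ 6 * Real.pi * (‖q‖ * M) := by
      have := mul_nonneg (norm_nonneg q) hM
      nlinarith
    linarith [b 0, b 1, b 2]
  have := hp.comm_mul hq (norm_wave_le _) (norm_shift_le _)
  rwa [← mul_add] at this

theorem traceNorm_of_isStarProjection {H : Type*} [NormedAddCommGroup H] [InnerProductSpace ℂ H]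
    [CompleteSpace H] {P : H →L[ℂ] H} (hP : IsStarProjection P) : traceNorm P = posTrace P := by
  rw [traceNorm, CFC.abs_of_nonneg P hP.nonneg]

theorem trLE_of_posTrace {P : Op} (hP : IsStarProjection P) {N : ℕ} (h : posTrace P = N) :
    TrLE P N := by
  refine (traceNorm_le_iff N.cast_nonneg).1 ?_
  rw [traceNorm_of_isStarProjection hP, h, ENNReal.ofReal_natCast]

/-- Rounding the time up to an integer costs one further factor G. -/
theorem pow_ceil_le {G t : ℝ} (hG : 1 ≤ G) (ht : 0 ≤ t) :
    G ^ ⌈t⌉₊ ≤ G * Real.exp (Real.log G * t) := by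
  have h0 : 0 < G := by linarith
  rw [← Real.rpow_natCast, Real.rpow_def_of_pos h0]
  nth_rw 2 [← Real.exp_log h0]
  rw [← Real.exp_add]
  refine Real.exp_le_exp.2 ?_
  have h1 := mul_le_mul_of_nonneg_left (Nat.ceil_lt_add_one ht).le (Real.log_nonneg hG)
  linarith

theorem IsSolution.commutatorTraceLE {V : Space → ℝ} {W : Space → ℂ} {N : ℕ} {ε : ℝ} {ω : ℝ → Op}
    (h : IsSolution V N ε ω) (hV : HasFourierTransform V W) (hε : 0 < ε) (hNε : (N : ℝ)⁻¹ ≤ ε)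
    (hW : Integrable W) (hW2 : Integrable fun k => (1 + ‖k‖ ^ 2) * ‖W k‖) (hN : 1 ≤ N)
    (h0 : TrLE (ω 0) N) (h1 : ‖ω 0‖ ≤ 1) {M : ℝ} (hM : 0 ≤ M)
    (hx : ∀ j, CommutatorTraceLE (Position j) (ω 0) M)
    (hd : ∀ j, CommutatorTraceLE (ScaledGradient ε j) (ω 0) M) (t : ℝ) (j : Fin 3) {M' : ℝ}
    (hM' : (distortion * Real.exp (growthRate W)) ^ ⌈|t|⌉₊ * (6 * Real.pi * M) ≤ M') :
    CommutatorTraceLE (Position j) (ω t) M' ∧ CommutatorTraceLE (ScaledGradient ε j) (ω t) M' := by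
  have hπ := Real.pi_gt_three
  have key := h.comm_weyl_le hV hε hNε hW hW2 hN h0 h1
    (comm_weyl_le_of_coord hM hx hd) ⌈|t|⌉₊ t (Nat.le_ceil _)
  have hL := one_le_distortion
  have hM'0 : 0 ≤ M' := le_trans (by positivity) hM'
  have hs : ∀ s : ℝ, ‖s • (EuclideanSpace.single j 1 : Space)‖ = |s| := fun s => by
    rw [norm_smul, Real.norm_eq_abs, PiLp.norm_single, norm_one, mul_one]
  refine ⟨(commutatorTraceLE_position_iff hM'0).2 fun s => ?_,
    (commutatorTraceLE_scaledGradient_iff hM'0).2 fun s => ?_⟩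
  · have h2 := key (s • EuclideanSpace.single j 1) 0
    rw [weyl_zero_right, norm_zero, add_zero, hs] at h2
    refine h2.mono ((mul_le_mul_of_nonneg_right hM' (abs_nonneg s)).trans ?_)
    have := mul_nonneg hM'0 (abs_nonneg s)
    nlinarith
  · have h2 := key 0 (s • EuclideanSpace.single j 1)
    rw [weyl_zero_left, norm_zero, zero_add, hs] at h2
    refine h2.mono ((mul_le_mul_of_nonneg_right hM' (abs_nonneg s)).trans ?_)
    rw [mul_comm]

end

end HartreeFock

open HartreeFock in
theorem proposition6p3 (V : HartreeFock.Space → ℝ) (hV : HartreeFock.AdmissiblePotential V)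
    (K : ℝ) (hK : 0 < K) :
    ∃ C c : ℝ, 0 < C ∧ 0 < c ∧
      ∀ (N : ℕ) (_ : 1 ≤ N) (ε : ℝ) (_ : ε = (N : ℝ) ^ (-(1 / 3 : ℝ)))
        (ωN : HartreeFock.Op) (_ : IsStarProjection ωN) (_ : HartreeFock.posTrace ωN = N)
        (_ : ∀ j, HartreeFock.CommutatorTraceLE (HartreeFock.Position j) ωN (K * N * ε))
        (_ : ∀ j, HartreeFock.CommutatorTraceLE (HartreeFock.ScaledGradient ε j) ωN (K * N * ε))
        (ω : ℝ → HartreeFock.Op) (_ : HartreeFock.IsSolution V N ε ω) (_ : ω 0 = ωN),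
        ∀ (t : ℝ) (j : Fin 3),
          HartreeFock.CommutatorTraceLE (HartreeFock.Position j) (ω t)
              (C * N * ε * Real.exp (c * |t|)) ∧
            HartreeFock.CommutatorTraceLE (HartreeFock.ScaledGradient ε j) (ω t)
              (C * N * ε * Real.exp (c * |t|)) := by
  obtain ⟨W, hVW, hWw⟩ := hV
  have hW : MeasureTheory.Integrable W := integrable_of_weighted hWw
  have hW2 : MeasureTheory.Integrable fun k => (1 + ‖k‖ ^ 2) * ‖W k‖ := by
    refine hWw.norm.congr (Filter.Eventually.of_forall fun k => ?_)
    dsimp only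
    rw [norm_mul, Complex.norm_real, Real.norm_of_nonneg (by positivity)]
  have hπ := Real.pi_gt_three
  have hg : 0 ≤ growthRate W := by
    have h1 : 0 ≤ ∫ k, ‖W k‖ := MeasureTheory.integral_nonneg fun _ => norm_nonneg _
    have h2 : 0 ≤ ∫ k, (1 + ‖k‖ ^ 2) * ‖W k‖ :=
      MeasureTheory.integral_nonneg fun _ => by positivity
    have := one_le_distortion
    unfold growthRate
    positivity
  set G := distortion * Real.exp (growthRate W) with hG
  have hG1 : 1 < G := by
    have h1 : 1 < distortion := by unfold distortion; linarith
    have h2 := Real.one_le_exp hg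
    nlinarith
  -- 6πK comes from the passage to Weyl operators and the factor G from rounding up the time. G is
  -- the growth per unit time, and G > 1 makes the rate log G positive.
  refine ⟨6 * Real.pi * K * G, Real.log G, by positivity, Real.log_pos hG1, ?_⟩
  intro N hN ε hε ωN hP htr hx hd ω hsol h0 t j
  have hN1 : (1 : ℝ) ≤ N := by exact_mod_cast hN
  have hN0 : (0 : ℝ) < N := by linarith
  have hεpos : 0 < ε := by rw [hε]; positivity
  -- The exponent −1/3 enters only through ε > 0 and this inequality.
  have hNε : (N : ℝ)⁻¹ ≤ ε := by
    rw [hε, ← Real.rpow_neg_one]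
    exact Real.rpow_le_rpow_of_exponent_le hN1 (by norm_num)
  subst h0
  refine hsol.commutatorTraceLE hVW hεpos hNε hW hW2 hN (trLE_of_posTrace hP htr) hP.norm_le
    (by positivity) hx hd t j ?_
  have h3 := mul_le_mul_of_nonneg_right (pow_ceil_le hG1.le (abs_nonneg t))
    (by positivity : 0 ≤ 6 * Real.pi * (K * N * ε))
  refine h3.trans (le_of_eq ?_)
  ring
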